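/- Let $\Gamma:\mathbb R\to\mathbb R^3$ be a curve parametrized by arc length, $|\dot\Gamma|=1$, with orthonormal Frenet triad $(t,n,b)$, $t=\dot\Gamma$, curvature $\gamma$ and torsion $\tau$: $$\dot t=\gamma n,\qquad \dot n=-\gamma t+\tau b,\qquad \dot b=-\tau n .$$ Given $\alpha:\mathbb R\to\mathbb R$ and an open bounded set $M\subset\mathbb R^2$ containing the origin, whose points are described by polar coordinates $(r,\theta)$, put $$x(s,r,\theta)=\Gamma(s)-r\big[n(s)\cos(\theta-\alpha(s))+b(s)\sin(\theta-\alpha(s))\big],\qquad (s,r,\theta)\in\mathbb R\times M .$$ Assume: (a) $\Gamma$ is $C^2$; (b) either $\gamma$ and $\tau$ vanish outside $[-s_0,s_0]$ for some $s_0>0$, or $\Gamma$ is $C^4$, $\tau$ and $\dot\tau$ are bounded, and $\gamma,\dot\gamma,\ddot\gamma$ tend to zero as $|s|\to\infty$; (c) $|\Gamma(s)-\Gamma(s')|\to\infty$ as $|s-s'|\to\infty$; (d) the map $x$ is injective on $\mathbb R\times M$; (e) $\dot\alpha=\tau$; (f) $V\in L^\infty(\mathbb R^2)$, $V\ge 0$,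 $V$ is not almost everywhere zero, and $V$ vanishes outside $M$. At the points where $\gamma=0$, where the triad is not determined by the curve, it is enough instead of the last two Frenet formulas and (e) that for every $\theta$ the vector $n\cos(\theta-\alpha)+b\sin(\theta-\alpha)$ is differentiable there with derivative zero (which follows if the formulas and (e) do hold there); the bounds on $\tau,\dot\tau$ and the limits of $\dot\gamma,\ddot\gamma$ in (b) are then needed only on the set where $\gamma\neq 0$. Let $\tilde V:\mathbb R^3\to\mathbb R$ be given by $\tilde V(x(s,r,\theta))=V(r,\theta)$ on the tube $x(\mathbb R\times M)$ and $\tilde V=0$ outside it, and let $H_{\Gamma,V}=-\Delta-\tilde V$ on $L^2(\mathbb R^3)$ with domain $H^2(\mathbb R^3)$. Let $\epsilon_0=\inf\sigma(h_V)$ be the bottom of the spectrum of $h_V=-\Delta-V$ on $L^2(\mathbb R^2)$ with domain $H^2(\mathbb R^2)$, let $\phi_0$ be a corresponding strictly positive eigenfunction, and put $\kappa_0=\sqrt{-\epsilon_0}$. With $x=x(s,r,\theta)$, $x'=x(s',r',\theta')$ and with $x_0=(s,r\cos\theta,r\sin\theta)$, $x_0'=(s',r'\cos\theta',r'\sin\theta')$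 the corresponding points of the straight tube, define $$\mathcal C^\kappa_{\Gamma,V}(s,r,\theta;s',r',\theta')=\phi_0(r,\theta)V(r,\theta)\Big[\big(1+r\gamma(s)\cos(\theta-\alpha(s))\big)^{1/2}\frac{e^{-\kappa|x-x'|}}{4\pi|x-x'|}\big(1+r'\gamma(s')\cos(\theta'-\alpha(s'))\big)^{1/2}-\frac{e^{-\kappa|x_0-x_0'|}}{4\pi|x_0-x_0'|}\Big]V(r',\theta')\phi_0(r',\theta').$$ If $$\int_{\mathbb R^2}ds\,ds'\int_{M\times M}\mathcal C^{\kappa_0}_{\Gamma,V}(s,r,\theta;s',r',\theta')\,rr'\,dr\,dr'\,d\theta\,d\theta'>0 ,$$ where the outer integral is a Lebesgue integral whose positive part may be infinite but whose negative part is finite, then $\sigma_{\rm disc}(H_{\Gamma,V})\ne\emptyset$, i.e. $H_{\Gamma,V}$ has an isolated eigenvalue of finite multiplicity. -/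

import Mathlib

open MeasureTheory Filter Topology
open scoped ENNReal SchwartzMap Laplacian

noncomputable section

namespace SoftWaveguide

/-! ### Unbounded operators, their spectrum and discrete spectrum -/

section Spectrum

variable {X : Type*} [NormedAddCommGroup X] [NormedSpace ℂ X]

/-- The resolvent set of an unbounded operator `T`: those `z` for which `T - z`, as a map from the
domain of `T` to `X`, has an everywhere defined bounded two-sided inverse. -/
def resolventSet (T : X →ₗ.[ℂ] X) : Set ℂ :=
  {z | ∃ R : X →L[ℂ] X,
    (∀ g : X, ∃ h : R g ∈ T.domain, T ⟨R g, h⟩ - z • R g = g) ∧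
    ∀ f : T.domain, R (T f - z • (f : X)) = f}

/-- The spectrum of an unbounded operator. -/
def spec (T : X →ₗ.[ℂ] X) : Set ℂ := (resolventSet T)ᶜ

/-- The eigenspace `ker (T - z)`. -/
def eigenspace (T : X →ₗ.[ℂ] X) (z : ℂ) : Submodule ℂ X :=
  (LinearMap.ker (T.toFun - z • T.domain.subtype)).map T.domain.subtype

/-- The discrete spectrum: the isolated points of the spectrum that are eigenvalues of finite
multiplicity. -/
def discSpec (T : X →ₗ.[ℂ] X) : Set ℂ :=
  {z | z ∈ spec T ∧ (∃ ε > 0, ∀ w ∈ spec T, dist w z < ε → w = z) ∧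
    eigenspace T z ≠ ⊥ ∧ FiniteDimensional ℂ (eigenspace T z)}

end Spectrum

/-! ### Schrödinger operators on `L²` -/

section Schrodinger

variable (E : Type*) [NormedAddCommGroup E] [InnerProductSpace ℝ E] [FiniteDimensional ℝ E]
  [MeasurableSpace E] [BorelSpace E]

/-- The Hilbert space `L²(E; ℂ)`. -/
abbrev L2 : Type _ := Lp ℂ 2 (volume : Measure E)

/-- The Sobolev space `H²(E)`. -/
def sobolevH2 : Submodule ℂ (L2 E) where
  carrier := {f | TemperedDistribution.MemSobolev 2 2 (f : 𝓢'(E, ℂ))}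
  zero_mem' := by
    change TemperedDistribution.MemSobolev 2 2 _
    rw [← Lp.toTemperedDistributionCLM_apply, map_zero]
    exact TemperedDistribution.memSobolev_fun_zero E ℂ 2 2
  add_mem' := by
    intro f g hf hg
    change TemperedDistribution.MemSobolev 2 2 _
    rw [← Lp.toTemperedDistributionCLM_apply, map_add]
    exact hf.add hg
  smul_mem' := by
    intro c f hf
    change TemperedDistribution.MemSobolev 2 2 _
    rw [← Lp.toTemperedDistributionCLM_apply, map_smul]
    exact hf.smul c

variable {E}

theorem exists_laplacian (f : sobolevH2 E) :
    ∃ g : L2 E, Δ ((f : L2 E) : 𝓢'(E, ℂ)) = (g : 𝓢'(E, ℂ)) := by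
  have h := TemperedDistribution.MemSobolev.laplacian (s := 2) f.2
  rw [sub_self, TemperedDistribution.memSobolev_zero_iff] at h
  exact h

theorem toTemperedDistribution_injective {f g : L2 E}
    (h : (f : 𝓢'(E, ℂ)) = (g : 𝓢'(E, ℂ))) : f = g := by
  have hinj : Function.Injective (Lp.toTemperedDistributionCLM ℂ (volume : Measure E) 2) :=
    LinearMap.ker_eq_bot.1 Lp.ker_toTemperedDistributionCLM_eq_bot
  exact hinj h

variable (E) in
/-- The Laplacian `Δ : H²(E) → L²(E)`: the distributional Laplacian, which on `H²(E)` takes values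
in `L²(E)`. -/
def laplacianL2 : sobolevH2 E →ₗ[ℂ] L2 E where
  toFun f := (exists_laplacian f).choose
  map_add' f g := by
    apply toTemperedDistribution_injective
    have h := (exists_laplacian (f + g)).choose_spec
    have hf := (exists_laplacian f).choose_spec
    have hg := (exists_laplacian g).choose_spec
    simp only [← Lp.toTemperedDistributionCLM_apply,
      ← TemperedDistribution.laplacianCLM_apply] at h hf hg ⊢
    rw [map_add, ← h, ← hf, ← hg, Submodule.coe_add, map_add, map_add]
  map_smul' c f := by
    apply toTemperedDistribution_injective
    have h := (exists_laplacian (c • f)).choose_spec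
    have hf := (exists_laplacian f).choose_spec
    simp only [← Lp.toTemperedDistributionCLM_apply,
      ← TemperedDistribution.laplacianCLM_apply, RingHom.id_apply] at h hf ⊢
    rw [map_smul, ← h, ← hf, Submodule.coe_smul, map_smul, map_smul]

/-- The maximal domain of the operator of multiplication by `W`; all of `L²(E)` if `W` is
essentially bounded. -/
def mulDomain (W : E → ℝ) : Submodule ℂ (L2 E) where
  carrier := {f | MemLp (fun y => (W y : ℂ) * f y) 2 volume}
  zero_mem' := by
    refine (MemLp.zero (ε := ℂ)).ae_eq ?_
    filter_upwards [Lp.coeFn_zero ℂ 2 (volume : Measure E)] with y hy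
    simp
  add_mem' := by
    intro f g hf hg
    refine (MemLp.add hf hg).ae_eq ?_
    filter_upwards [Lp.coeFn_add f g] with y hy
    rw [hy, Pi.add_apply, Pi.add_apply, mul_add]
  smul_mem' := by
    intro c f hf
    refine (MemLp.const_smul hf c).ae_eq ?_
    filter_upwards [Lp.coeFn_smul c f] with y hy
    simp [hy, mul_left_comm]

theorem memLp_of_mem_mulDomain {W : E → ℝ} (f : mulDomain W) :
    MemLp (fun y => (W y : ℂ) * (f : L2 E) y) 2 volume := f.2

/-- The operator of multiplication by `W`. -/
def mulOp (W : E → ℝ) : mulDomain W →ₗ[ℂ] L2 E where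
  toFun f := (memLp_of_mem_mulDomain f).toLp
  map_add' f g := by
    apply Lp.ext
    filter_upwards [(memLp_of_mem_mulDomain (f + g)).coeFn_toLp,
      (memLp_of_mem_mulDomain f).coeFn_toLp, (memLp_of_mem_mulDomain g).coeFn_toLp,
      Lp.coeFn_add (memLp_of_mem_mulDomain f).toLp (memLp_of_mem_mulDomain g).toLp,
      Lp.coeFn_add (f : L2 E) g] with y h1 h2 h3 h4 h5
    rw [h1, h4, Pi.add_apply, h2, h3, Submodule.coe_add, h5, Pi.add_apply, mul_add]
  map_smul' c f := by
    apply Lp.ext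
    rw [RingHom.id_apply]
    filter_upwards [(memLp_of_mem_mulDomain (c • f)).coeFn_toLp,
      (memLp_of_mem_mulDomain f).coeFn_toLp,
      Lp.coeFn_smul c (memLp_of_mem_mulDomain f).toLp,
      Lp.coeFn_smul c (f : L2 E)] with y h1 h2 h3 h4
    rw [h1, h3, Pi.smul_apply, h2, Submodule.coe_smul, h4, Pi.smul_apply, smul_eq_mul,
      smul_eq_mul, mul_left_comm]

/-- The Schrödinger operator `-Δ - W` on `L²(E)`; its domain is `H²(E)` if `W` is essentially
bounded. -/
def schrodinger (W : E → ℝ) : L2 E →ₗ.[ℂ] L2 E where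
  domain := sobolevH2 E ⊓ mulDomain W
  toFun := -(laplacianL2 E ∘ₗ Submodule.inclusion inf_le_left) -
    mulOp W ∘ₗ Submodule.inclusion inf_le_right

/-- The bottom of the (real) spectrum of `-Δ - W`. -/
def specBottom (W : E → ℝ) : ℝ := sInf {e : ℝ | (e : ℂ) ∈ spec (schrodinger W)}

/-- `φ` is an almost everywhere positive eigenfunction of `-Δ - W` at the bottom of the
spectrum. -/
def IsGroundState (W φ : E → ℝ) : Prop :=
  (∀ᵐ y, 0 < φ y) ∧
  ∃ f : (schrodinger W).domain, ((f : L2 E) : E → ℂ) =ᵐ[volume] (fun y => (φ y : ℂ)) ∧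
    schrodinger W f = (specBottom W : ℂ) • (f : L2 E)

end Schrodinger

/-! ### The curve and the tube -/

/-- The plane of the cross sections. -/
abbrev E2 : Type := EuclideanSpace ℝ (Fin 2)

/-- The ambient space. -/
abbrev E3 : Type := EuclideanSpace ℝ (Fin 3)

/-- The coordinate `r cos (θ - α)` of the point `u` with polar coordinates `(r, θ)`. -/
def rotCos (α : ℝ) (u : E2) : ℝ := u 0 * Real.cos α + u 1 * Real.sin α

/-- The coordinate `r sin (θ - α)` of the point `u` with polar coordinates `(r, θ)`. -/
def rotSin (α : ℝ) (u : E2) : ℝ := u 1 * Real.cos α - u 0 * Real.sin α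

theorem rotCos_polar (α r θ : ℝ) :
    rotCos α !₂[r * Real.cos θ, r * Real.sin θ] = r * Real.cos (θ - α) := by
  simp [rotCos, Real.cos_sub]
  ring

theorem rotSin_polar (α r θ : ℝ) :
    rotSin α !₂[r * Real.cos θ, r * Real.sin θ] = r * Real.sin (θ - α) := by
  simp [rotSin, Real.sin_sub]
  ring

/-- `(Γ', n, b)` is an orthonormal triad along the curve `Γ` obeying the Frenet formulas with
curvature `γ` and torsion `τ`. Where the curvature vanishes the triad is not determined by the
curve, and nothing but `t' = γ n = 0` is required there. -/
structure IsFrenetTriad (Γ n b : ℝ → E3) (γ τ : ℝ → ℝ) : Prop where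
  orthonormal : ∀ s, Orthonormal ℝ ![deriv Γ s, n s, b s]
  deriv_t : ∀ s, HasDerivAt (deriv Γ) (γ s • n s) s
  deriv_n : ∀ s, γ s ≠ 0 → HasDerivAt n (-γ s • deriv Γ s + τ s • b s) s
  deriv_b : ∀ s, γ s ≠ 0 → HasDerivAt b (-τ s • n s) s

/-- The Tang condition `α' = τ`. At the points where the curvature vanishes, where the local triads
may have to be glued after a rotation in the normal plane, it says that the normal directions
`n cos (θ - α) + b sin (θ - α)` are glued differentiably and do not rotate (their derivative is
`-γ cos (θ - α) t = 0`). For a triad that obeys the Frenet formulas on all of `ℝ` this follows from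
`α' = τ`. -/
structure IsTangAngle (n b : ℝ → E3) (γ τ α : ℝ → ℝ) : Prop where
  deriv_angle : ∀ s, γ s ≠ 0 → HasDerivAt α (τ s) s
  glue : ∀ s, γ s = 0 → ∀ θ : ℝ,
    HasDerivAt (fun σ => Real.cos (θ - α σ) • n σ + Real.sin (θ - α σ) • b σ) 0 s

/-- Either curvature and torsion vanish outside a compact interval, or the curve is `C⁴`, the
torsion and its derivative are bounded, and the curvature and its first two derivatives tend to
zero at infinity; all conditions other than `γ → 0` are imposed only where `γ ≠ 0`. -/
def IsAsymptoticallyStraight (Γ : ℝ → E3) (γ τ : ℝ → ℝ) : Prop :=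
  (∃ s₀ > 0, ∀ s, s₀ < |s| → γ s = 0 ∧ τ s = 0) ∨
  (ContDiff ℝ 4 Γ ∧
    (∃ K : ℝ, ∀ s, γ s ≠ 0 → |τ s| ≤ K ∧ |deriv τ s| ≤ K) ∧
    Tendsto γ (cocompact ℝ) (𝓝 0) ∧
    Tendsto (deriv γ) (cocompact ℝ ⊓ 𝓟 {s | γ s ≠ 0}) (𝓝 0) ∧
    Tendsto (deriv (deriv γ)) (cocompact ℝ ⊓ 𝓟 {s | γ s ≠ 0}) (𝓝 0))

/-- The map `x(s, r, θ) = Γ(s) - r [n(s) cos (θ - α(s)) + b(s) sin (θ - α(s))]`, as a function of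
`s` and of the point `u` of the plane with polar coordinates `(r, θ)`. -/
def tubeMap (Γ n b : ℝ → E3) (α : ℝ → ℝ) (s : ℝ) (u : E2) : E3 :=
  Γ s - (rotCos (α s) u • n s + rotSin (α s) u • b s)

/-- The map of the straight tube. -/
def straightMap (s : ℝ) (u : E2) : E3 := !₂[s, u 0, u 1]

/-- The potential `Ṽ`: it equals `V(u)` at the point `x(s, u)` with `u ∈ M`, and vanishes outside
the tube `x(ℝ × M)`. -/
def tubePotential (Γ n b : ℝ → E3) (α : ℝ → ℝ) (M : Set E2) (V : E2 → ℝ) : E3 → ℝ :=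
  Function.extend (fun p : ℝ × M => tubeMap Γ n b α p.1 p.2) (fun p => V p.2) 0

/-! ### The kernel -/

/-- The kernel of `(-Δ + κ²)⁻¹` in dimension three. -/
def green (κ : ℝ) (y y' : E3) : ℝ :=
  Real.exp (-κ * ‖y - y'‖) / (4 * Real.pi * ‖y - y'‖)

/-- The factor `1 + r γ(s) cos (θ - α(s))`. -/
def jac (γ α : ℝ → ℝ) (s : ℝ) (u : E2) : ℝ := 1 + γ s * rotCos (α s) u

/-- The kernel `C^κ(s, u; s', u')`. -/
def kernelC (Γ n b : ℝ → E3) (γ α : ℝ → ℝ) (V φ : E2 → ℝ) (κ : ℝ)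
    (s : ℝ) (u : E2) (s' : ℝ) (u' : E2) : ℝ :=
  φ u * V u *
    (Real.sqrt (jac γ α s u) * green κ (tubeMap Γ n b α s u) (tubeMap Γ n b α s' u') *
        Real.sqrt (jac γ α s' u') -
      green κ (straightMap s u) (straightMap s' u')) *
    (V u' * φ u')

/-- The Lebesgue integral of `F` over `ℝ²` exists, with a value in `(-∞, ∞]`, and is positive: the
integral of the negative part is smaller than that of the positive part (and hence finite). For
an integrable `F` this says `0 < ∫ F`. -/
def HasPositiveIntegral (F : ℝ × ℝ → ℝ) : Prop :=
  ∫⁻ p, ENNReal.ofReal (-F p) < ∫⁻ p, ENNReal.ofReal (F p)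

/-- A positive Bochner integral is a special case. -/
theorem hasPositiveIntegral_of_integral_pos {F : ℝ × ℝ → ℝ} (h : 0 < ∫ p, F p) :
    HasPositiveIntegral F := by
  have hF : Integrable F := by
    by_contra hF
    rw [integral_undef hF] at h
    exact lt_irrefl _ h
  rw [integral_eq_lintegral_pos_part_sub_lintegral_neg_part hF, sub_pos] at h
  have hne : ∫⁻ p, ENNReal.ofReal (-F p) ≠ ∞ := by
    have := hF.neg.lintegral_lt_top
    exact this.ne
  exact (ENNReal.toReal_lt_toReal hne hF.lintegral_lt_top.ne).1 h

end SoftWaveguide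

end

open MeasureTheory Filter Topology
open scoped ENNReal SchwartzMap Laplacian

set_option linter.unusedSectionVars false

/-! Write `U` for the tube potential, `H = -Δ - U`, and `G_κ = (-Δ + κ²)⁻¹`. The proof has two
halves: the spectrum of `H` reaches below `-κ₀²`, and what lies below `-κ₀²` is discrete.

Existence. If some `η` satisfies `(Uη, η) < (Uη, G_{κ₀} Uη)`, then `ψ = G_{κ₀} Uη` is a test vector
with `(ψ, (H + κ₀²)ψ) ≤ (Uη, η) - (Uη, ψ) < 0`, because `(U(ψ - η), ψ - η) ≥ 0`; this is the
Birman–Schwinger principle without square roots of `U` (`exists_hamil_lt`). The trial function is `η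
= φ J^{-1/2} χ_n(s)`, where `φ` is the transverse ground state, `J` the Jacobian of the tube and
`χ_n` a wide tent in the longitudinal variable. In tube coordinates the powers of `J` become exactly
the weights of `C^{κ₀}`, and the excess `(Uη, G_{κ₀} Uη) - (Uη, η)` equals `∫∫ χ_n χ_n' F - ½ ∫∫
(χ_n - χ_n')² β(s - s')`, where `F` is the integral of `C^{κ₀}` over the cross sections and `β` the
corresponding form of the straight tube. Here `∫ β = ∫ V φ²`: integrating the three-dimensional
kernel along a line gives the two-dimensional one, and `φ` solves the transverse integral equation.
Since `β` has a finite second moment, the error is `O(1/n)`, while the main term tends to `∫ F > 0`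
(`exists_tent_lt`, `exists_trial`).

Discreteness. For `κ > κ₀` weakly null approximate eigenvectors at `-κ²` must tend to zero. A
bounded piece of the tube acts compactly, since `G_κ` has a square integrable kernel. Outside it the
weighted Schur test with weight `φ` gives a norm below one: the curvature tends to zero, so the
distant tube is nearly isometric to the straight one at bounded longitudinal distances, while
longitudinally distant points are far apart in space. The Schur integral is therefore close to the
transverse integral at a slightly smaller `κ₁ > κ₀`, which lies below `φ` by a uniform gap
(`exists_gap`, `exists_schur`, `tendsto_zero_of_schur`).

The spectral theory is carried out on the bounded positive symmetric operator `R = (H + c)⁻¹`, whose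
norm corresponds to the bottom of the spectrum of `H`. If `R` is proper at `‖R‖` (`ProperAt`), then
`‖R‖` is an isolated eigenvalue of finite multiplicity, and this passes to `H`
(`discSpec_nonempty_of_resolvent`).

Geometry. The condition `α' = τ` turns the Frenet triad into a rotation-minimizing frame with
continuous curvatures, in which the derivative of the tube map is diagonal; injectivity of the tube
map forces the Jacobian to be positive (`isBishopFrame`, `frameJac_pos`, `isTubeChart`). -/

noncomputable section

namespace SoftWaveguide


/-! ### Heat kernel and its Laplace transform, the free resolvent kernel. -/

section HeatKernel

open Real Set
open scoped FourierTransform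

variable {E : Type*} [NormedAddCommGroup E] [InnerProductSpace ℝ E] [FiniteDimensional ℝ E]
  [MeasurableSpace E] [BorelSpace E]

/-- The heat kernel. -/
def heat (t : ℝ) (x : E) : ℝ :=
  (4 * π * t) ^ (-(Module.finrank ℝ E : ℝ) / 2) * exp (-‖x‖ ^ 2 / (4 * t))

/-- The heat representation of the kernel of `(-Δ + κ²)⁻¹`. -/
def resK (κ : ℝ) (x : E) : ℝ≥0∞ :=
  ∫⁻ t in Ioi (0 : ℝ), ENNReal.ofReal (exp (-κ ^ 2 * t) * heat t x)

/-- The kernel of `(-Δ + κ²)⁻¹`, with value `0` where the heat representation diverges. -/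
def resG (κ : ℝ) (x : E) : ℝ := (resK κ x).toReal

theorem heat_nonneg {t : ℝ} (ht : 0 < t) (x : E) : 0 ≤ heat t x := by
  unfold heat; positivity

theorem measurable_heat : Measurable (fun p : E × ℝ => heat p.2 p.1) := by
  unfold heat
  fun_prop

theorem heat_neg (t : ℝ) (x : E) : heat t (-x) = heat t x := by
  simp [heat]

theorem resK_neg (κ : ℝ) (x : E) : resK κ (-x) = resK κ x := by
  simp [resK, heat_neg]

theorem resK_sub_comm (κ : ℝ) (x y : E) : resK κ (x - y) = resK κ (y - x) := by
  rw [← resK_neg, neg_sub]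

theorem resG_neg (κ : ℝ) (x : E) : resG κ (-x) = resG κ x := by
  simp [resG, resK_neg]

theorem resG_sub_comm (κ : ℝ) (x y : E) : resG κ (x - y) = resG κ (y - x) := by
  rw [← resG_neg, neg_sub]

theorem resG_nonneg (κ : ℝ) (x : E) : 0 ≤ resG κ x := ENNReal.toReal_nonneg

theorem measurable_resK (κ : ℝ) : Measurable (resK κ : E → ℝ≥0∞) := by
  unfold resK
  apply Measurable.lintegral_prod_right'
    (f := fun p : E × ℝ => ENNReal.ofReal (exp (-κ ^ 2 * p.2) * heat p.2 p.1))
  have := measurable_heat (E := E)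
  fun_prop

theorem measurable_resG (κ : ℝ) : Measurable (resG κ : E → ℝ) :=
  (measurable_resK κ).ennreal_toReal

theorem fourier_heat {t : ℝ} (ht : 0 < t) (w : E) :
    𝓕 (fun x : E => (heat t x : ℂ)) w = (exp (-(4 * π ^ 2 * ‖w‖ ^ 2) * t) : ℝ) := by
  have hb : 0 < ((1 / (4 * t) : ℝ) : ℂ).re := by
    rw [Complex.ofReal_re]; positivity
  have h := fourier_gaussian_innerProductSpace hb w
  have e : (fun x : E => (heat t x : ℂ)) =
      (((4 * π * t) ^ (-(Module.finrank ℝ E : ℝ) / 2) : ℝ) : ℂ) •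
        (fun v : E => Complex.exp (-((1 / (4 * t) : ℝ) : ℂ) * ‖v‖ ^ 2)) := by
    funext x
    simp only [heat, Pi.smul_apply, smul_eq_mul]
    push_cast
    congr 2
    ring
  have hsm : 𝓕 ((((4 * π * t) ^ (-(Module.finrank ℝ E : ℝ) / 2) : ℝ) : ℂ) •
        (fun v : E => Complex.exp (-((1 / (4 * t) : ℝ) : ℂ) * ‖v‖ ^ 2))) w =
      (((4 * π * t) ^ (-(Module.finrank ℝ E : ℝ) / 2) : ℝ) : ℂ) *
        𝓕 (fun v : E => Complex.exp (-((1 / (4 * t) : ℝ) : ℂ) * ‖v‖ ^ 2)) w := by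
    rw [Real.fourier_eq', Real.fourier_eq', ← integral_const_mul]
    refine integral_congr_ae (ae_of_all _ fun x => ?_)
    simp only [Pi.smul_apply, smul_eq_mul]
    ring
  rw [e, hsm, h, ← mul_assoc]
  have h1 : (((4 * π * t) ^ (-(Module.finrank ℝ E : ℝ) / 2) : ℝ) : ℂ) *
      (π / ((1 / (4 * t) : ℝ) : ℂ)) ^ (Module.finrank ℝ E / 2 : ℂ) = 1 := by
    have : (π / ((1 / (4 * t) : ℝ) : ℂ)) = ((4 * π * t : ℝ) : ℂ) := by
      push_cast; field_simp
    have e2 : (Module.finrank ℝ E / 2 : ℂ) = ((Module.finrank ℝ E / 2 : ℝ) : ℂ) := by push_cast; rfl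
    rw [this, e2, ← Complex.ofReal_cpow (by positivity), ← Complex.ofReal_mul,
      ← Real.rpow_add (by positivity), ← Complex.ofReal_one]
    congr 1
    rw [show -(Module.finrank ℝ E : ℝ) / 2 + (Module.finrank ℝ E : ℝ) / 2 = 0 by ring,
      Real.rpow_zero]
  rw [h1, one_mul]
  push_cast
  congr 1
  field_simp

theorem integrable_heat {t : ℝ} (ht : 0 < t) : Integrable (fun x : E => heat t x) := by
  have hb : 0 < ((1 / (4 * t) : ℝ) : ℂ).re := by
    rw [Complex.ofReal_re]; positivity
  have h := (GaussianFourier.integrable_cexp_neg_mul_sq_norm_add hb 0 (0 : E)).re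
  have := h.const_mul ((4 * π * t) ^ (-(Module.finrank ℝ E : ℝ) / 2))
  refine this.congr (ae_of_all _ fun x => ?_)
  simp only [heat]
  congr 1
  have : (-((1 / (4 * t) : ℝ) : ℂ) * (‖x‖ : ℂ) ^ 2 + 0 * ((inner ℝ (0 : E) x : ℝ) : ℂ)) =
     ((-‖x‖ ^ 2 / (4 * t) : ℝ) : ℂ) := by
    push_cast; ring
  simp only [this]
  rw [← Complex.ofReal_exp]
  rfl

theorem integral_heat {t : ℝ} (ht : 0 < t) : ∫ x : E, heat t x = 1 := by
  have h := fourier_heat ht (0 : E)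
  rw [Real.fourier_eq'] at h
  simp only [inner_zero_right, mul_zero, Complex.ofReal_zero, zero_mul, Complex.exp_zero,
    one_smul, norm_zero] at h
  rw [integral_complex_ofReal] at h
  have := Complex.ofReal_injective h
  rw [this]; simp

theorem lintegral_heat {t : ℝ} (ht : 0 < t) : ∫⁻ x : E, ENNReal.ofReal (heat t x) = 1 := by
  rw [← ofReal_integral_eq_lintegral_ofReal (integrable_heat ht)
    (ae_of_all _ fun x => heat_nonneg ht x), integral_heat ht, ENNReal.ofReal_one]

theorem lintegral_exp_neg {a : ℝ} (ha : 0 < a) :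
    ∫⁻ t in Ioi (0 : ℝ), ENNReal.ofReal (exp (-a * t)) = ENNReal.ofReal (1 / a) := by
  rw [← ofReal_integral_eq_lintegral_ofReal (exp_neg_integrableOn_Ioi 0 ha)
    (ae_of_all _ fun x => (exp_pos _).le), integral_exp_mul_Ioi (by linarith)]
  simp

/-- Every heat kernel has mass one, so only `∫ e^{-κ²t} dt` remains. The value bounds the norm of
the convolution operator and makes the kernel finite almost everywhere. -/
theorem lintegral_resK {κ : ℝ} (hκ : 0 < κ) :
    ∫⁻ x : E, resK κ x = ENNReal.ofReal (1 / κ ^ 2) := by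
  unfold resK
  rw [lintegral_lintegral_swap]
  · rw [← lintegral_exp_neg (pow_pos hκ 2)]
    refine setLIntegral_congr_fun measurableSet_Ioi fun t ht => ?_
    simp_rw [ENNReal.ofReal_mul (exp_pos _).le]
    rw [lintegral_const_mul' _ _ ENNReal.ofReal_ne_top, lintegral_heat ht, mul_one]
  · have := measurable_heat (E := E)
    exact Measurable.aemeasurable (by fun_prop)

theorem ae_resK_lt_top {κ : ℝ} (hκ : 0 < κ) : ∀ᵐ x : E, resK κ x < ∞ :=
  ae_lt_top (measurable_resK κ) (by rw [lintegral_resK hκ]; exact ENNReal.ofReal_ne_top)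

theorem ofReal_resG {κ : ℝ} {x : E} (h : resK κ x < ∞) : ENNReal.ofReal (resG κ x) = resK κ x :=
  ENNReal.ofReal_toReal h.ne

theorem integrable_resG {κ : ℝ} (hκ : 0 < κ) : Integrable (resG κ : E → ℝ) :=
  integrable_toReal_of_lintegral_ne_top (measurable_resK κ).aemeasurable
    (by rw [lintegral_resK hκ]; exact ENNReal.ofReal_ne_top)

theorem resG_eq_integral (κ : ℝ) (x : E) :
    resG κ x = ∫ t in Ioi (0 : ℝ), exp (-κ ^ 2 * t) * heat t x := by
  rw [integral_eq_lintegral_of_nonneg_ae]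
  · rfl
  · filter_upwards [ae_restrict_mem measurableSet_Ioi] with t ht
    have := heat_nonneg ht x
    positivity
  · have := measurable_heat (E := E)
    have h2 : Measurable fun t : ℝ => heat t x := this.comp (measurable_const.prodMk measurable_id)
    exact Measurable.aestronglyMeasurable (by fun_prop)

theorem integrable_prod_heat {κ : ℝ} (hκ : 0 < κ) :
    Integrable (fun p : E × ℝ => exp (-κ ^ 2 * p.2) * heat p.2 p.1)
      (volume.prod (volume.restrict (Ioi 0))) := by
  have hm : Measurable (fun p : E × ℝ => exp (-κ ^ 2 * p.2) * heat p.2 p.1) := by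
    have := measurable_heat (E := E)
    fun_prop
  refine ⟨hm.aestronglyMeasurable, ?_⟩
  rw [hasFiniteIntegral_iff_enorm, lintegral_prod _ hm.enorm.aemeasurable]
  calc _ = ∫⁻ x : E, resK κ x := by
        refine lintegral_congr fun x => ?_
        refine setLIntegral_congr_fun measurableSet_Ioi fun t ht => ?_
        rw [Real.enorm_of_nonneg]
        have := heat_nonneg ht x
        positivity
    _ < ∞ := by rw [lintegral_resK hκ]; exact ENNReal.ofReal_lt_top

theorem fourier_resG {κ : ℝ} (hκ : 0 < κ) (w : E) :
    𝓕 (fun x : E => (resG κ x : ℂ)) w = ((1 / (4 * π ^ 2 * ‖w‖ ^ 2 + κ ^ 2) : ℝ) : ℂ) := by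
  rw [Real.fourier_eq']
  have h1 : ∀ x : E, (Complex.exp (((-2 * π * inner ℝ x w : ℝ) : ℂ) * Complex.I)) • (resG κ x : ℂ) =
      ∫ t in Ioi (0 : ℝ), (Complex.exp (((-2 * π * inner ℝ x w : ℝ) : ℂ) * Complex.I)) *
        ((exp (-κ ^ 2 * t) * heat t x : ℝ) : ℂ) := by
    intro x
    rw [resG_eq_integral, ← integral_complex_ofReal, smul_eq_mul, integral_const_mul]
  rw [integral_congr_ae (ae_of_all _ h1), integral_integral_swap]
  · have h2 : ∀ t ∈ Ioi (0 : ℝ), (∫ x : E,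
        (Complex.exp (((-2 * π * inner ℝ x w : ℝ) : ℂ) * Complex.I)) *
        ((exp (-κ ^ 2 * t) * heat t x : ℝ) : ℂ)) =
        ((exp (-(4 * π ^ 2 * ‖w‖ ^ 2 + κ ^ 2) * t) : ℝ) : ℂ) := by
      intro t ht
      have h3 := fourier_heat ht w
      rw [Real.fourier_eq'] at h3
      have : ((exp (-(4 * π ^ 2 * ‖w‖ ^ 2 + κ ^ 2) * t) : ℝ) : ℂ) =
          (exp (-κ ^ 2 * t) : ℝ) * (exp (-(4 * π ^ 2 * ‖w‖ ^ 2) * t) : ℝ) := by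
        rw [← Complex.ofReal_mul, ← Real.exp_add]; congr 2; ring
      rw [this, ← h3, ← integral_const_mul]
      refine integral_congr_ae (ae_of_all _ fun x => ?_)
      simp only [smul_eq_mul]
      push_cast
      ring
    rw [setIntegral_congr_fun measurableSet_Ioi h2, integral_complex_ofReal,
      integral_exp_mul_Ioi (by have := sq_nonneg ‖w‖; have := pow_pos hκ 2; nlinarith [sq_nonneg (π * ‖w‖)])]
    congr 1
    rw [mul_zero, exp_zero, neg_div_neg_eq]
  · have hc : Continuous fun p : E × ℝ =>
        Complex.exp (((-2 * π * inner ℝ p.1 w : ℝ) : ℂ) * Complex.I) := by fun_prop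
    refine Integrable.bdd_mul (c := 1) (integrable_prod_heat hκ).ofReal
      hc.aestronglyMeasurable (ae_of_all _ fun p => ?_)
    rw [Complex.norm_exp_ofReal_mul_I]

end HeatKernel


/-! ### Monotonicity, square integrability and explicit form of the resolvent kernel. -/

section GreenFunction

open Real Set

variable {E : Type*} [NormedAddCommGroup E] [InnerProductSpace ℝ E] [FiniteDimensional ℝ E]
  [MeasurableSpace E] [BorelSpace E]

theorem lintegral_mul_sq_le {X : Type*} [MeasurableSpace X] {μ : Measure X} {f g : X → ℝ≥0∞}
    (hf : AEMeasurable f μ) (hg : AEMeasurable g μ) :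
    (∫⁻ x, f x * g x ∂μ) ^ 2 ≤ (∫⁻ x, f x ^ 2 ∂μ) * ∫⁻ x, g x ^ 2 ∂μ := by
  have h := ENNReal.lintegral_mul_le_Lp_mul_Lq μ Real.HolderConjugate.two_two hf hg
  have h2 := pow_le_pow_left' h 2
  refine h2.trans_eq ?_
  rw [mul_pow, ← ENNReal.rpow_natCast, ← ENNReal.rpow_natCast, ← ENNReal.rpow_mul,
    ← ENNReal.rpow_mul]
  simp

/-- The heat kernel decreases in `‖x‖`, so the difference of the two Laplace integrals is at least
its positive value at radius `ρ`. This uniform gap later gives both the positivity of the ground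
state and the strict Schur bound. -/
theorem exists_add_le_resK {κ₀ κ₁ : ℝ} (h₀ : 0 < κ₀) (h₁ : κ₀ < κ₁) (ρ : ℝ) :
    ∃ c : ℝ≥0∞, c ≠ 0 ∧ ∀ x : E, ‖x‖ ≤ ρ → resK κ₁ x + c ≤ resK κ₀ x := by
  have hlt : ∀ t : ℝ, 0 < t → exp (-κ₁ ^ 2 * t) < exp (-κ₀ ^ 2 * t) := by
    intro t ht
    apply exp_lt_exp.2
    have : κ₀ ^ 2 < κ₁ ^ 2 := by gcongr
    nlinarith
  refine ⟨∫⁻ t in Ioi (0 : ℝ), ENNReal.ofReal ((exp (-κ₀ ^ 2 * t) - exp (-κ₁ ^ 2 * t)) *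
    ((4 * π * t) ^ (-(Module.finrank ℝ E : ℝ) / 2) * exp (-ρ ^ 2 / (4 * t)))), ?_, ?_⟩
  · refine (setLIntegral_pos_iff (Measurable.ennreal_ofReal (by fun_prop))).2 ?_ |>.ne'
    have : Ioi (0 : ℝ) ⊆ (Function.support fun t : ℝ =>
        ENNReal.ofReal ((exp (-κ₀ ^ 2 * t) - exp (-κ₁ ^ 2 * t)) *
        ((4 * π * t) ^ (-(Module.finrank ℝ E : ℝ) / 2) * exp (-ρ ^ 2 / (4 * t))))) ∩
        Ioi (0 : ℝ) := by
      intro t ht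
      refine ⟨?_, ht⟩
      have ht' : 0 < t := ht
      have := sub_pos.2 (hlt t ht')
      rw [Function.mem_support]
      exact (ENNReal.ofReal_pos.2 (by positivity)).ne'
    exact lt_of_lt_of_le (by simp) (measure_mono this)
  · intro x hx
    unfold resK
    rw [← lintegral_add_right _ (Measurable.ennreal_ofReal (by fun_prop))]
    refine setLIntegral_mono' measurableSet_Ioi fun t ht => ?_
    have ht' : 0 < t := ht
    have hp := sub_pos.2 (hlt t ht')
    have hh := heat_nonneg ht' x
    rw [← ENNReal.ofReal_add (by positivity) (by positivity)]
    apply ENNReal.ofReal_le_ofReal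
    have : (4 * π * t) ^ (-(Module.finrank ℝ E : ℝ) / 2) * exp (-ρ ^ 2 / (4 * t)) ≤ heat t x := by
      unfold heat
      gcongr
    nlinarith

theorem resK_anti {κ₀ κ₁ : ℝ} (h₀ : 0 ≤ κ₀) (h₁ : κ₀ ≤ κ₁) (x : E) : resK κ₁ x ≤ resK κ₀ x := by
  refine setLIntegral_mono' measurableSet_Ioi fun t ht => ?_
  have ht' : 0 < t := ht
  have hh := heat_nonneg ht' x
  gcongr

theorem heat_sq {t : ℝ} (ht : 0 < t) (x : E) :
    heat t x ^ 2 = (8 * π * t) ^ (-(Module.finrank ℝ E : ℝ) / 2) * heat (t / 2) x := by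
  unfold heat
  rw [mul_pow, ← mul_assoc, ← mul_rpow (by positivity) (by positivity), ← exp_nat_mul,
    ← rpow_natCast, ← rpow_mul (by positivity)]
  congr 1
  · rw [show 8 * π * t * (4 * π * (t / 2)) = (4 * π * t) ^ (2 : ℝ) by
      rw [rpow_two]; ring, ← rpow_mul (by positivity)]
    congr 1
    push_cast
    ring
  · congr 1
    field_simp
    ring

/-- Cauchy–Schwarz in `t` with the weights `t^{∓d/8}` leaves `∫ heat(t,·)²`, of order `t^{-d/2}`,
against `t^{d/4}`. The resulting `t^{-d/4}` is integrable at zero exactly for `d < 4`. -/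
theorem lintegral_resK_sq_lt_top (hd : Module.finrank ℝ E < 4) {κ : ℝ} (hκ : 0 < κ) :
    ∫⁻ x : E, resK κ x ^ 2 < ∞ := by
  set d : ℝ := (Module.finrank ℝ E : ℝ) with hdd
  have hd4 : d < 4 := by rw [hdd]; exact_mod_cast hd
  have hfinite : ∫⁻ t in Ioi (0 : ℝ), ENNReal.ofReal (t ^ (-d / 4) * exp (-κ ^ 2 * t)) < ∞ := by
    have := integrableOn_rpow_mul_exp_neg_mul_rpow (p := 1) (s := -d / 4) (b := κ ^ 2)
      (by linarith) (by norm_num) (by positivity)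
    simp only [rpow_one] at this
    exact this.lintegral_lt_top
  have hmh : Measurable (fun p : E × ℝ => heat p.2 p.1) := measurable_heat
  have hmh' : ∀ x : E, Measurable fun t : ℝ => heat t x := fun x =>
    hmh.comp (measurable_const.prodMk measurable_id)
  have hpt : ∀ x : E, resK κ x ^ 2 ≤
      (∫⁻ t in Ioi (0 : ℝ), ENNReal.ofReal (t ^ (-d / 4) * exp (-κ ^ 2 * t))) *
      ∫⁻ t in Ioi (0 : ℝ), ENNReal.ofReal (t ^ (d / 4) * exp (-κ ^ 2 * t) * heat t x ^ 2) := by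
    intro x
    have h1 : resK κ x = ∫⁻ t in Ioi (0 : ℝ),
        ENNReal.ofReal (t ^ (-d / 8) * exp (-κ ^ 2 * t / 2)) *
        ENNReal.ofReal (t ^ (d / 8) * exp (-κ ^ 2 * t / 2) * heat t x) := by
      refine setLIntegral_congr_fun measurableSet_Ioi fun t ht => ?_
      have ht' : 0 < t := ht
      have hh := heat_nonneg ht' x
      rw [← ENNReal.ofReal_mul (by positivity)]
      congr 1
      rw [show t ^ (-d / 8) * exp (-κ ^ 2 * t / 2) * (t ^ (d / 8) * exp (-κ ^ 2 * t / 2) * heat t x)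
        = (t ^ (-d / 8) * t ^ (d / 8)) * (exp (-κ ^ 2 * t / 2) * exp (-κ ^ 2 * t / 2)) * heat t x by
        ring, ← rpow_add ht', ← exp_add, show -d / 8 + d / 8 = 0 by ring, rpow_zero, one_mul]
      congr 2
      ring
    have hm := hmh' x
    rw [h1]
    refine (lintegral_mul_sq_le (by fun_prop) (by fun_prop)).trans_eq ?_
    congr 1
    · refine setLIntegral_congr_fun measurableSet_Ioi fun t ht => ?_
      have ht' : 0 < t := ht
      rw [← ENNReal.ofReal_pow (by positivity), mul_pow, ← exp_nat_mul, ← rpow_natCast,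
        ← rpow_mul ht'.le]
      congr 2
      · congr 1; push_cast; ring
      · congr 1; push_cast; ring
    · refine setLIntegral_congr_fun measurableSet_Ioi fun t ht => ?_
      have ht' : 0 < t := ht
      have hh := heat_nonneg ht' x
      rw [← ENNReal.ofReal_pow (by positivity), mul_pow, mul_pow, ← exp_nat_mul, ← rpow_natCast,
        ← rpow_mul ht'.le]
      congr 3
      · congr 1; push_cast; ring
      · congr 1; push_cast; ring
  refine (lintegral_mono hpt).trans_lt ?_
  rw [lintegral_const_mul' _ _ hfinite.ne]
  refine ENNReal.mul_lt_top hfinite ?_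
  rw [lintegral_lintegral_swap (Measurable.aemeasurable (by fun_prop))]
  have hin : ∀ t ∈ Ioi (0 : ℝ), ∫⁻ x : E, ENNReal.ofReal
      (t ^ (d / 4) * exp (-κ ^ 2 * t) * heat t x ^ 2) =
      ENNReal.ofReal ((8 * π) ^ (-d / 2)) * ENNReal.ofReal (t ^ (-d / 4) * exp (-κ ^ 2 * t)) := by
    intro t ht
    have ht' : 0 < t := ht
    have hx : ∀ x : E, ENNReal.ofReal (t ^ (d / 4) * exp (-κ ^ 2 * t) * heat t x ^ 2) =
        ENNReal.ofReal ((8 * π) ^ (-d / 2) * (t ^ (-d / 4) * exp (-κ ^ 2 * t))) *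
        ENNReal.ofReal (heat (t / 2) x) := by
      intro x
      rw [← ENNReal.ofReal_mul (by positivity), heat_sq ht', ← hdd,
        mul_rpow (by positivity) ht'.le]
      congr 1
      rw [show t ^ (-d / 4) = t ^ (d / 4) * t ^ (-d / 2) by
        rw [← rpow_add ht']; congr 1; ring]
      ring
    simp_rw [hx]
    rw [lintegral_const_mul' _ _ ENNReal.ofReal_ne_top, lintegral_heat (by positivity), mul_one,
      ENNReal.ofReal_mul (by positivity)]
  rw [setLIntegral_congr_fun measurableSet_Ioi hin, lintegral_const_mul' _ _ ENNReal.ofReal_ne_top]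
  exact ENNReal.mul_lt_top ENNReal.ofReal_lt_top hfinite

/-! ### Dimension three -/

theorem norm_straightMap_sq (s : ℝ) (u : E2) : ‖straightMap s u‖ ^ 2 = s ^ 2 + ‖u‖ ^ 2 := by
  simp [straightMap, EuclideanSpace.norm_sq_eq, Fin.sum_univ_three, Fin.sum_univ_two]
  ring

theorem straightMap_sub (s s' : ℝ) (u u' : E2) :
    straightMap s u - straightMap s' u' = straightMap (s - s') (u - u') := by
  ext i
  fin_cases i <;> simp [straightMap]

theorem heat_straightMap {t : ℝ} (ht : 0 < t) (s : ℝ) (u : E2) :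
    heat t (straightMap s u) = heat t u * heat t s := by
  have h3 : Module.finrank ℝ E3 = 3 := by simp
  have h2 : Module.finrank ℝ E2 = 2 := by simp
  unfold heat
  rw [norm_straightMap_sq, h3, h2, Module.finrank_self, mul_mul_mul_comm, ← rpow_add (by positivity),
    ← exp_add]
  congr 1
  · congr 1; norm_num
  · congr 1; rw [Real.norm_eq_abs, sq_abs]; ring

/-- The heat kernel factorizes over orthogonal coordinates and its longitudinal factor has mass one.
This is the link between the tube and the transverse operator. -/
theorem lintegral_resK_straightMap (κ : ℝ) (u : E2) :
    ∫⁻ s, resK κ (straightMap s u) = resK κ u := by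
  unfold resK
  have hmh : Measurable (fun p : E3 × ℝ => heat p.2 p.1) := measurable_heat
  have hms : Measurable (fun p : ℝ × ℝ => (straightMap p.1 u, p.2)) := by
    refine Measurable.prodMk ?_ measurable_snd
    have : Continuous fun s : ℝ => straightMap s u := by unfold straightMap; fun_prop
    exact this.measurable.comp measurable_fst
  rw [lintegral_lintegral_swap]
  · refine setLIntegral_congr_fun measurableSet_Ioi fun t ht => ?_
    have ht' : 0 < t := ht
    have : ∀ s : ℝ, ENNReal.ofReal (exp (-κ ^ 2 * t) * heat t (straightMap s u)) =
        ENNReal.ofReal (exp (-κ ^ 2 * t) * heat t u) * ENNReal.ofReal (heat t s) := by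
      intro s
      have := heat_nonneg ht' u
      rw [← ENNReal.ofReal_mul (by positivity), heat_straightMap ht', mul_assoc]
    simp_rw [this]
    rw [lintegral_const_mul' _ _ ENNReal.ofReal_ne_top, lintegral_heat ht', mul_one]
  · have h3 : Measurable (fun p : ℝ × ℝ => heat p.2 (straightMap p.1 u)) := hmh.comp hms
    exact Measurable.aemeasurable (f := fun p : ℝ × ℝ =>
      ENNReal.ofReal (exp (-κ ^ 2 * p.2) * heat p.2 (straightMap p.1 u))) (by fun_prop)

/-- The Yukawa potential. -/
def yukawa (κ r : ℝ) : ℝ := exp (-κ * r) / (4 * π * r)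

/-- The error function, without normalization. -/
def errInt (z : ℝ) : ℝ := ∫ x in (0 : ℝ)..z, exp (-1 * x ^ 2)

theorem hasDerivAt_errInt (z : ℝ) : HasDerivAt errInt (exp (-1 * z ^ 2)) z := by
  have hc : Continuous fun x : ℝ => exp (-1 * x ^ 2) := by fun_prop
  exact intervalIntegral.integral_hasDerivAt_right (hc.intervalIntegrable _ _)
    (hc.stronglyMeasurableAtFilter _ _) hc.continuousAt

theorem tendsto_errInt_atTop : Tendsto errInt atTop (𝓝 (√π / 2)) := by
  have h := intervalIntegral_tendsto_integral_Ioi 0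
    (integrable_exp_neg_mul_sq (b := 1) one_pos).integrableOn tendsto_id
  rw [integral_gaussian_Ioi, div_one] at h
  exact h

theorem errInt_neg (z : ℝ) : errInt (-z) = -errInt z := by
  unfold errInt
  have h := intervalIntegral.integral_comp_neg (a := 0) (b := z) fun x : ℝ => exp (-1 * x ^ 2)
  simp only [neg_sq, neg_zero] at h
  rw [intervalIntegral.integral_symm, h]

theorem tendsto_errInt_atBot : Tendsto errInt atBot (𝓝 (-(√π / 2))) := by
  have h := (tendsto_errInt_atTop.comp tendsto_neg_atBot_atTop).neg
  refine h.congr fun z => ?_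
  simp [errInt_neg]

/-- Completing the square in two ways gives an antiderivative made of two error functions: in the
sum of the derivatives the `t^{-1/2}` terms cancel and the `t^{-3/2}` terms add. -/
theorem lintegral_heat_three {κ r : ℝ} (hκ : 0 < κ) (hr : 0 < r) :
    ∫⁻ t in Ioi (0 : ℝ), ENNReal.ofReal (t ^ (-3 / 2 : ℝ) * exp (-κ ^ 2 * t - r ^ 2 / (4 * t))) =
      ENNReal.ofReal (2 * √π / r * exp (-κ * r)) := by
  let F : ℝ → ℝ := fun t => exp (-κ * r) * errInt (κ * √t - r / (2 * √t)) +
    exp (κ * r) * errInt (-κ * √t - r / (2 * √t))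
  let L₀ : ℝ := exp (-κ * r) * (-(√π / 2)) + exp (κ * r) * (-(√π / 2))
  let L₁ : ℝ := exp (-κ * r) * (√π / 2) + exp (κ * r) * (-(√π / 2))
  -- At `t = 0` the formula for `F` divides by zero; the limit from the right is put in its place so
  -- that the fundamental theorem applies on `[0, ∞)`.
  let g : ℝ → ℝ := fun t => if t ≤ 0 then L₀ else F t
  have hFd : ∀ t : ℝ, 0 < t → HasDerivAt F
      (r / 2 * (t ^ (-3 / 2 : ℝ) * exp (-κ ^ 2 * t - r ^ 2 / (4 * t)))) t := by
    intro t ht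
    have hs : 0 < √t := sqrt_pos.2 ht
    have hss : √t ^ 2 = t := sq_sqrt ht.le
    have hd := hasDerivAt_sqrt ht.ne'
    have hd2 : HasDerivAt (fun t : ℝ => r / (2 * √t)) (-(r / (4 * (√t) ^ 3))) t := by
      have := (hd.const_mul 2).inv (by positivity) |>.const_mul r
      refine (this.congr_deriv ?_)
      field_simp
      norm_num
    have ha := (hasDerivAt_errInt (κ * √t - r / (2 * √t))).comp t ((hd.const_mul κ).sub hd2)
    have hb := (hasDerivAt_errInt (-κ * √t - r / (2 * √t))).comp t ((hd.const_mul (-κ)).sub hd2)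
    refine ((ha.const_mul (exp (-κ * r))).add (hb.const_mul (exp (κ * r)))).congr_deriv ?_
    have e1 : exp (-κ * r) * (exp (-1 * (κ * √t - r / (2 * √t)) ^ 2)) =
        exp (-κ ^ 2 * t - r ^ 2 / (4 * t)) := by
      rw [← exp_add]; congr 1
      rw [← hss]; simp only [sqrt_sq hs.le]; field_simp; ring
    have e2 : exp (κ * r) * (exp (-1 * (-κ * √t - r / (2 * √t)) ^ 2)) =
        exp (-κ ^ 2 * t - r ^ 2 / (4 * t)) := by
      rw [← exp_add]; congr 1
      rw [← hss]; simp only [sqrt_sq hs.le]; field_simp; ring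
    have e3 : t ^ (-3 / 2 : ℝ) = 1 / √t ^ 3 := by
      rw [sqrt_eq_rpow, ← rpow_natCast, ← rpow_mul ht.le, one_div, ← rpow_neg ht.le]
      congr 1; norm_num
    rw [← mul_assoc, ← mul_assoc, e1, e2, e3]
    field_simp
    ring
  have hz1 : Tendsto (fun t : ℝ => r / (2 * √t)) (𝓝[>] 0) atTop := by
    have h1 : Tendsto (fun t : ℝ => 2 * √t) (𝓝[>] 0) (𝓝[>] 0) := by
      refine tendsto_nhdsWithin_iff.2 ⟨?_, ?_⟩
      · have : Continuous fun t : ℝ => 2 * √t := by fun_prop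
        have := this.tendsto 0
        simp only [sqrt_zero, mul_zero] at this
        exact this.mono_left nhdsWithin_le_nhds
      · filter_upwards [self_mem_nhdsWithin] with t ht
        have := sqrt_pos.2 (show 0 < t from ht)
        simpa using this
    have := (tendsto_inv_nhdsGT_zero.comp h1).const_mul_atTop hr
    exact this
  have hz2 : ∀ c : ℝ, Tendsto (fun t : ℝ => c * √t) (𝓝[>] 0) (𝓝 0) := by
    intro c
    have : Continuous fun t : ℝ => c * √t := by fun_prop
    have := this.tendsto 0
    simp only [sqrt_zero, mul_zero] at this
    exact this.mono_left nhdsWithin_le_nhds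
  have hi1 : Tendsto (fun t : ℝ => r / (2 * √t)) atTop (𝓝 0) :=
    Tendsto.const_div_atTop (tendsto_sqrt_atTop.const_mul_atTop (by norm_num)) r
  have hg0 : ContinuousWithinAt g (Ici 0) 0 := by
    rw [← continuousWithinAt_Ioi_iff_Ici]
    have h1 : Tendsto F (𝓝[>] 0) (𝓝 L₀) := by
      refine Tendsto.add (Tendsto.const_mul _ ?_) (Tendsto.const_mul _ ?_)
      · refine tendsto_errInt_atBot.comp ?_
        simp only [sub_eq_add_neg]
        exact (hz2 κ).add_atBot (tendsto_neg_atTop_atBot.comp hz1)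
      · refine tendsto_errInt_atBot.comp ?_
        simp only [sub_eq_add_neg]
        exact (hz2 (-κ)).add_atBot (tendsto_neg_atTop_atBot.comp hz1)
    have : g 0 = L₀ := by simp [g]
    rw [ContinuousWithinAt, this]
    refine h1.congr' ?_
    filter_upwards [self_mem_nhdsWithin] with t ht
    simp [g, not_le.2 (show 0 < t from ht)]
  have hgd : ∀ t ∈ Ioi (0 : ℝ), HasDerivAt g
      (r / 2 * (t ^ (-3 / 2 : ℝ) * exp (-κ ^ 2 * t - r ^ 2 / (4 * t)))) t := by
    intro t ht
    refine (hFd t ht).congr_of_eventuallyEq ?_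
    filter_upwards [Ioi_mem_nhds (show 0 < t from ht)] with x hx
    simp [g, not_le.2 (show 0 < x from hx)]
  have hgi : Tendsto g atTop (𝓝 L₁) := by
    have h1 : Tendsto F atTop (𝓝 L₁) := by
      refine Tendsto.add (Tendsto.const_mul _ ?_) (Tendsto.const_mul _ ?_)
      · refine tendsto_errInt_atTop.comp ?_
        simp only [sub_eq_add_neg]
        refine (tendsto_sqrt_atTop.const_mul_atTop hκ).atTop_add (C := 0) ?_
        simpa using hi1.neg
      · refine tendsto_errInt_atBot.comp ?_
        simp only [sub_eq_add_neg]
        refine (tendsto_sqrt_atTop.const_mul_atTop_of_neg (neg_lt_zero.2 hκ)).atBot_add (C := 0) ?_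
        simpa using hi1.neg
    refine h1.congr' ?_
    filter_upwards [Ioi_mem_atTop 0] with t ht
    simp [g, not_le.2 (show 0 < t from ht)]
  have hpos : ∀ t ∈ Ioi (0 : ℝ),
      0 ≤ r / 2 * (t ^ (-3 / 2 : ℝ) * exp (-κ ^ 2 * t - r ^ 2 / (4 * t))) := by
    intro t ht
    have : 0 < t := ht
    positivity
  have hI := integrableOn_Ioi_deriv_of_nonneg hg0 hgd hpos hgi
  have hV := integral_Ioi_of_hasDerivAt_of_nonneg hg0 hgd hpos hgi
  have hI' : IntegrableOn (fun t : ℝ => t ^ (-3 / 2 : ℝ) * exp (-κ ^ 2 * t - r ^ 2 / (4 * t)))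
      (Ioi 0) := by
    refine (hI.const_mul (2 / r)).congr (ae_of_all _ fun t => ?_)
    field_simp
  rw [← ofReal_integral_eq_lintegral_ofReal hI']
  · congr 1
    rw [integral_const_mul] at hV
    have : g 0 = L₀ := by simp [g]
    rw [this] at hV
    simp only [L₁, L₀] at hV
    generalize (∫ a in Ioi (0 : ℝ), a ^ (-3 / 2 : ℝ) * exp (-κ ^ 2 * a - r ^ 2 / (4 * a))) = I at *
    rw [div_mul_eq_mul_div, eq_div_iff hr.ne']
    linarith
  · filter_upwards [ae_restrict_mem measurableSet_Ioi] with t ht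
    have : 0 < t := ht
    positivity

theorem resK_three {κ : ℝ} (hκ : 0 < κ) {x : E3} (hx : x ≠ 0) :
    resK κ x = ENNReal.ofReal (yukawa κ ‖x‖) := by
  have hr : 0 < ‖x‖ := norm_pos_iff.2 hx
  have h3 : Module.finrank ℝ E3 = 3 := by simp
  have e : yukawa κ ‖x‖ = (4 * π) ^ (-3 / 2 : ℝ) * (2 * √π / ‖x‖ * exp (-κ * ‖x‖)) := by
    have : (4 * π) ^ (-3 / 2 : ℝ) = 1 / (8 * π * √π) := by
      rw [show (-3 / 2 : ℝ) = -(1 + 1 / 2) by norm_num, rpow_neg (by positivity),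
        rpow_add (by positivity), rpow_one, ← sqrt_eq_rpow, sqrt_mul (by norm_num),
        show (4 : ℝ) = 2 ^ 2 by norm_num, sqrt_sq (by norm_num)]
      rw [one_div]; congr 1; ring
    rw [this, yukawa]
    have : √π ≠ 0 := by positivity
    field_simp
    norm_num
  rw [e, ENNReal.ofReal_mul (by positivity), ← lintegral_heat_three hκ hr,
    ← lintegral_const_mul' _ _ ENNReal.ofReal_ne_top]
  refine setLIntegral_congr_fun measurableSet_Ioi fun t ht => ?_
  have ht' : 0 < t := ht
  rw [← ENNReal.ofReal_mul (by positivity), heat, h3, mul_rpow (by positivity) ht'.le]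
  congr 1
  rw [show -κ ^ 2 * t - ‖x‖ ^ 2 / (4 * t) = -κ ^ 2 * t + (-‖x‖ ^ 2 / (4 * t)) by ring, exp_add]
  push_cast
  ring

theorem yukawa_nonneg {κ r : ℝ} (hr : 0 ≤ r) : 0 ≤ yukawa κ r := by
  unfold yukawa; positivity

theorem yukawa_anti {κ r r' : ℝ} (hκ : 0 ≤ κ) (hr : 0 < r) (h : r ≤ r') :
    yukawa κ r' ≤ yukawa κ r := by
  unfold yukawa
  have : exp (-κ * r') ≤ exp (-κ * r) := exp_le_exp.2 (by nlinarith)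
  gcongr

theorem yukawa_mul {κ q r : ℝ} (hq : 0 < q) : yukawa κ (q * r) = q⁻¹ * yukawa (κ * q) r := by
  unfold yukawa
  rw [show -κ * (q * r) = -(κ * q) * r by ring]
  field_simp

end GreenFunction


/-! ### The Helmholtz operator on Schwartz functions. -/

section SchwartzResolvent

open Real
open scoped FourierTransform

variable {E : Type*} [NormedAddCommGroup E] [InnerProductSpace ℝ E] [FiniteDimensional ℝ E]
  [MeasurableSpace E] [BorelSpace E]

theorem fourier_helmholtz (κ : ℝ) (η : 𝓢(E, ℂ)) (w : E) :
    (𝓕 ((κ ^ 2 : ℝ) • η - Δ η) : 𝓢(E, ℂ)) w =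
      ((4 * π ^ 2 * ‖w‖ ^ 2 + κ ^ 2 : ℝ) : ℂ) * (𝓕 η : 𝓢(E, ℂ)) w := by
  have hg : (fun x : E => ‖x‖ ^ 2).HasTemperateGrowth := by fun_prop
  have h1 : 𝓕 (Δ η) = (-(2 * π) ^ 2 : ℝ) • SchwartzMap.smulLeftCLM ℂ (fun x : E => ‖x‖ ^ 2) (𝓕 η) := by
    rw [SchwartzMap.laplacian_eq_fourierMultiplierCLM, FourierTransform.fourier_smul,
      SchwartzMap.fourierMultiplierCLM_apply, FourierTransform.fourier_fourierInv_eq]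
  have h2 : 𝓕 ((κ ^ 2 : ℝ) • η - Δ η) = (κ ^ 2 : ℝ) • 𝓕 η - 𝓕 (Δ η) := by
    rw [sub_eq_add_neg, ← neg_one_smul ℝ (Δ η), FourierTransform.fourier_add,
      FourierTransform.fourier_smul, FourierTransform.fourier_smul, neg_one_smul, sub_eq_add_neg]
  rw [h2, h1, _root_.sub_apply,
    _root_.smul_apply, _root_.smul_apply, SchwartzMap.smulLeftCLM_apply_apply hg]
  simp only [Complex.real_smul]
  push_cast
  ring

/-- A rescaling of the argument by `2π/κ` reduces the symbol to `(1 + ‖w‖²)⁻¹`. -/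
theorem hasTemperateGrowth_helmholtz_inv {κ : ℝ} (hκ : 0 < κ) :
    (fun w : E => (4 * π ^ 2 * ‖w‖ ^ 2 + κ ^ 2)⁻¹).HasTemperateGrowth := by
  have h1 : (fun w : E => (1 + ‖w‖ ^ 2) ^ (-1 : ℝ)).HasTemperateGrowth :=
    Function.hasTemperateGrowth_one_add_norm_sq_rpow E (-1)
  have h2 : (fun w : E => (2 * π / κ) • w).HasTemperateGrowth :=
    ((2 * π / κ) • ContinuousLinearMap.id ℝ E).hasTemperateGrowth
  have h3 := (Function.HasTemperateGrowth.const (κ ^ 2)⁻¹ (E := E)).mul (h1.comp h2)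
  refine (congrArg Function.HasTemperateGrowth ?_).mpr h3
  funext w
  simp only [Pi.mul_apply, Function.comp_apply]
  rw [rpow_neg_one, ← mul_inv, norm_smul, mul_pow, Real.norm_eq_abs, sq_abs]
  congr 1
  field_simp
  ring

theorem exists_helmholtz_eq {κ : ℝ} (hκ : 0 < κ) (ζ : 𝓢(E, ℂ)) :
    ∃ η : 𝓢(E, ℂ), (κ ^ 2 : ℝ) • η - Δ η = ζ := by
  have hg := hasTemperateGrowth_helmholtz_inv (E := E) hκ
  refine ⟨𝓕⁻ (SchwartzMap.smulLeftCLM ℂ (fun w : E => (4 * π ^ 2 * ‖w‖ ^ 2 + κ ^ 2)⁻¹) (𝓕 ζ)), ?_⟩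
  rw [← FourierTransform.fourierInv_fourier_eq (F := 𝓢(E, ℂ)) ζ,
    ← FourierTransform.fourierInv_fourier_eq (F := 𝓢(E, ℂ)) ((κ ^ 2 : ℝ) • _ - _)]
  congr 1
  ext w
  rw [fourier_helmholtz, FourierTransform.fourier_fourierInv_eq,
    SchwartzMap.smulLeftCLM_apply_apply hg, Complex.real_smul, ← mul_assoc, ← Complex.ofReal_mul,
    mul_inv_cancel₀ (by positivity), Complex.ofReal_one, one_mul,
    FourierTransform.fourier_fourierInv_eq]

/-- By the self-adjointness of the Fourier transform the integral moves to the frequency side, where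
the transform of the kernel cancels the Helmholtz symbol; Fourier inversion finishes. -/
theorem integral_resG_helmholtz {κ : ℝ} (hκ : 0 < κ) (η : 𝓢(E, ℂ)) (x : E) :
    ∫ y, (resG κ (x - y) : ℂ) * ((κ ^ 2 : ℝ) • η - Δ η) y = η x := by
  set ζ : 𝓢(E, ℂ) := (κ ^ 2 : ℝ) • η - Δ η with hζ
  have hinv : ∀ (ξ : 𝓢(E, ℂ)) (y : E), ξ y =
      ∫ w, Complex.exp (((2 * π * inner ℝ w y : ℝ) : ℂ) * Complex.I) * (𝓕 ξ : 𝓢(E, ℂ)) w := by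
    intro ξ y
    conv_lhs => rw [← FourierTransform.fourierInv_fourier_eq (F := 𝓢(E, ℂ)) ξ,
      SchwartzMap.fourierInv_coe, Real.fourierInv_eq']
    simp only [smul_eq_mul]
  let g : E → ℂ := fun w =>
    Complex.exp (((2 * π * inner ℝ w x : ℝ) : ℂ) * Complex.I) * (𝓕 ζ : 𝓢(E, ℂ)) w
  have hgi : Integrable g := by
    have hc : Continuous fun w : E =>
        Complex.exp (((2 * π * inner ℝ w x : ℝ) : ℂ) * Complex.I) := by fun_prop
    refine Integrable.bdd_mul (c := 1) (𝓕 ζ : 𝓢(E, ℂ)).integrable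
      hc.aestronglyMeasurable (ae_of_all _ fun p => ?_)
    rw [Complex.norm_exp_ofReal_mul_I]
  have hgF : ∀ y : E, 𝓕 g y = ζ (x - y) := by
    intro y
    rw [hinv ζ, Real.fourier_eq']
    refine integral_congr_ae (ae_of_all _ fun w => ?_)
    simp only [g, smul_eq_mul]
    rw [← mul_assoc, ← Complex.exp_add]
    congr 2
    rw [inner_sub_right]
    push_cast
    ring
  have hflip : ∫ w, 𝓕 (fun y : E => (resG κ y : ℂ)) w • g w =
      ∫ y, (resG κ y : ℂ) • 𝓕 g y := by
    have h := VectorFourier.integral_fourierIntegral_smul_eq_flip (L := innerₗ E)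
      (μ := volume) (ν := volume) Real.continuous_fourierChar continuous_inner
      (integrable_resG (E := E) hκ).ofReal hgi
    simpa using! h
  have hsub : ∫ y, (resG κ (x - y) : ℂ) * ζ y = ∫ y, (resG κ y : ℂ) * ζ (x - y) := by
    rw [← integral_sub_left_eq_self (fun y => (resG κ (x - y) : ℂ) * ζ y) volume x]
    simp
  rw [hsub]
  simp only [smul_eq_mul] at hflip
  simp_rw [hgF] at hflip
  rw [← hflip, hinv η x]
  refine integral_congr_ae (ae_of_all _ fun w => ?_)
  simp only [g]
  rw [fourier_resG hκ, hζ, fourier_helmholtz]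
  have : ((1 / (4 * π ^ 2 * ‖w‖ ^ 2 + κ ^ 2) : ℝ) : ℂ) *
      ((4 * π ^ 2 * ‖w‖ ^ 2 + κ ^ 2 : ℝ) : ℂ) = 1 := by
    rw [← Complex.ofReal_mul, one_div, inv_mul_cancel₀ (by positivity), Complex.ofReal_one]
  linear_combination (Complex.exp (((2 * π * inner ℝ w x : ℝ) : ℂ) * Complex.I) *
    (𝓕 η : 𝓢(E, ℂ)) w) * this

/-- `H²` is defined through the multiplier `1 + ‖x‖²`; with `2π` in the Fourier exponent this is `1
- (2π)⁻² Δ`. Membership in `H²` thereby reduces to `Δf ∈ L²`. -/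
theorem besselPotential_two_apply (f : 𝓢'(E, ℂ)) :
    TemperedDistribution.besselPotential E ℂ 2 f = f - ((2 * π) ^ 2 : ℝ)⁻¹ • Δ f := by
  have h1 : TemperedDistribution.fourierMultiplierCLM ℂ (fun x : E => (((1 + ‖x‖ ^ 2) : ℝ) : ℂ)) f =
      f + TemperedDistribution.fourierMultiplierCLM ℂ (fun x : E => ((‖x‖ ^ 2 : ℝ) : ℂ)) f := by
    have : (fun x : E => (((1 + ‖x‖ ^ 2) : ℝ) : ℂ)) =
        (fun _ => (1 : ℂ)) + (fun x : E => ((‖x‖ ^ 2 : ℝ) : ℂ)) := by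
      funext x; simp
    rw [this]
    simp only [TemperedDistribution.fourierMultiplierCLM_apply]
    rw [TemperedDistribution.smulLeftCLM_add (by fun_prop) (by fun_prop), _root_.add_apply,
      FourierTransform.fourierInv_add, TemperedDistribution.smulLeftCLM_const, one_smul,
      FourierTransform.fourierInv_fourier_eq]
  rw [TemperedDistribution.laplacian_eq_fourierMultiplierCLM, smul_smul]
  have : ((2 * π) ^ 2 : ℝ)⁻¹ * (-(2 * π) ^ 2) = -1 := by
    field_simp
  rw [this, neg_one_smul, sub_neg_eq_add, ← h1, TemperedDistribution.besselPotential]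
  simp

end SchwartzResolvent


/-- The weighted Schur test for a symmetric nonnegative kernel. -/
theorem lintegral_sq_lintegral_le_of_schur {X : Type*} [MeasurableSpace X] {μ : Measure X}
    [SFinite μ] {k : X → X → ℝ≥0∞} (hk : Measurable (Function.uncurry k))
    (hsymm : ∀ x y, k x y = k y x) {w : X → ℝ≥0∞} (hw : Measurable w)
    (hw0 : ∀ᵐ x ∂μ, w x ≠ 0) (hwt : ∀ᵐ x ∂μ, w x ≠ ∞) {q : ℝ≥0∞}
    (h : ∀ᵐ x ∂μ, ∫⁻ y, k x y * w y ∂μ ≤ q * w x) {F : X → ℝ≥0∞} (hF : AEMeasurable F μ) :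
    ∫⁻ x, (∫⁻ y, k x y * F y ∂μ) ^ 2 ∂μ ≤ q ^ 2 * ∫⁻ x, F x ^ 2 ∂μ := by
  have hkx : ∀ x, Measurable (k x) := fun x => hk.comp measurable_prodMk_left
  have h1 : ∀ᵐ x ∂μ, (∫⁻ y, k x y * F y ∂μ) ^ 2 ≤
      ∫⁻ y, q * w x * (k x y * (F y ^ 2 / w y)) ∂μ := by
    filter_upwards [h] with x hx
    -- Cauchy–Schwarz is applied to `kF = (kw)^{1/2} · (k/w)^{1/2} F`. The first factor is
    -- controlled by the hypothesis at `x`, the second, after exchanging integrals, by symmetry and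
    -- the hypothesis at `y`.
    have e : ∫⁻ y, k x y * F y ∂μ =
        ∫⁻ y, (k x y * w y) ^ (1 / 2 : ℝ) * ((k x y / w y) ^ (1 / 2 : ℝ) * F y) ∂μ := by
      refine lintegral_congr_ae ?_
      filter_upwards [hw0, hwt] with y h0 ht
      rw [← mul_assoc, ← ENNReal.mul_rpow_of_nonneg _ _ (by norm_num)]
      congr 1
      rw [div_eq_mul_inv, mul_mul_mul_comm, ENNReal.mul_inv_cancel h0 ht, mul_one, ← sq,
        ← ENNReal.rpow_natCast, ← ENNReal.rpow_mul]
      norm_num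
    have hsq : ∀ a : ℝ≥0∞, (a ^ (1 / 2 : ℝ)) ^ 2 = a := fun a => by
      rw [← ENNReal.rpow_natCast, ← ENNReal.rpow_mul]
      norm_num
    have hm := hkx x
    rw [e]
    refine (lintegral_mul_sq_le (by fun_prop) (by fun_prop)).trans ?_
    simp_rw [mul_pow, hsq]
    rw [lintegral_const_mul'' _ (by fun_prop)]
    refine mul_le_mul' hx (lintegral_mono fun y => ?_)
    rw [div_eq_mul_inv, div_eq_mul_inv, mul_assoc, mul_comm (w y)⁻¹]
  refine (lintegral_mono_ae h1).trans ?_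
  rw [lintegral_lintegral_swap]
  · have h2 : ∀ᵐ y ∂μ, ∫⁻ x, q * w x * (k x y * (F y ^ 2 / w y)) ∂μ ≤ q ^ 2 * F y ^ 2 := by
      filter_upwards [h, hw0, hwt] with y hy h0 ht
      have e : ∀ x, q * w x * (k x y * (F y ^ 2 / w y)) = (k y x * w x) * (q * (F y ^ 2 / w y)) := by
        intro x
        rw [hsymm x y]; ring
      have hm := hkx y
      simp_rw [e]
      rw [lintegral_mul_const'' _ (by fun_prop)]
      calc _ ≤ q * w y * (q * (F y ^ 2 / w y)) := mul_le_mul_left hy _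
        _ = q ^ 2 * F y ^ 2 * (w y * (w y)⁻¹) := by rw [div_eq_mul_inv]; ring
        _ = q ^ 2 * F y ^ 2 := by rw [ENNReal.mul_inv_cancel h0 ht, mul_one]
    refine (lintegral_mono_ae h2).trans ?_
    rw [lintegral_const_mul'' _ (by fun_prop)]
  · have hF2 : AEMeasurable (fun p : X × X => F p.2) (μ.prod μ) :=
      hF.comp_quasiMeasurePreserving Measure.quasiMeasurePreserving_snd
    have hk' : AEMeasurable (fun p : X × X => k p.1 p.2) (μ.prod μ) := hk.aemeasurable
    have hw1 : AEMeasurable (fun p : X × X => w p.1) (μ.prod μ) :=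
      (hw.comp measurable_fst).aemeasurable
    have hw2 : AEMeasurable (fun p : X × X => w p.2) (μ.prod μ) :=
      (hw.comp measurable_snd).aemeasurable
    have : AEMeasurable (fun p : X × X => q * w p.1 * (k p.1 p.2 * (F p.2 ^ 2 / w p.2)))
      (μ.prod μ) := by fun_prop
    exact this

/-! ### The free resolvent on `L²` and the Laplacian on `H²`. -/

section FreeResolvent

variable {E : Type*} [NormedAddCommGroup E] [InnerProductSpace ℝ E] [FiniteDimensional ℝ E]
  [MeasurableSpace E] [BorelSpace E]

theorem lintegral_sq_resK_conv_le {κ : ℝ} (hκ : 0 < κ) {F : E → ℝ≥0∞} (hF : AEMeasurable F) :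
    ∫⁻ x, (∫⁻ y, resK κ (x - y) * F y) ^ 2 ≤
      ENNReal.ofReal (1 / κ ^ 2) ^ 2 * ∫⁻ x, F x ^ 2 := by
  refine lintegral_sq_lintegral_le_of_schur (k := fun x y => resK κ (x - y)) (w := fun _ => 1)
    ((measurable_resK κ).comp (measurable_fst.sub measurable_snd)) (resK_sub_comm κ)
    measurable_const (by simp) (by simp) (ae_of_all _ fun x => ?_) hF
  simp only [mul_one]
  rw [lintegral_sub_left_eq_self (fun y => resK κ y) x, lintegral_resK hκ]

theorem lintegral_enorm_sq_lt_top {f : E → ℂ} (hf : MemLp f 2) : ∫⁻ x, ‖f x‖ₑ ^ 2 < ∞ := by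
  have := (eLpNorm_lt_top_iff_lintegral_rpow_enorm_lt_top (by norm_num) (by norm_num)).1 hf.2
  simpa using this

theorem eLpNorm_two_sq (f : E → ℂ) : eLpNorm f 2 volume ^ 2 = ∫⁻ x, ‖f x‖ₑ ^ 2 := by
  have h := eLpNorm_nnreal_pow_eq_lintegral (f := f) (μ := (volume : Measure E)) (p := 2)
    (by norm_num)
  simpa using h

theorem enorm_resG_le (κ : ℝ) (x : E) : ‖(resG κ x : ℂ)‖ₑ ≤ resK κ x := by
  rw [← ofReal_norm, Complex.norm_real, Real.norm_of_nonneg (resG_nonneg _ _)]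
  exact ENNReal.ofReal_toReal_le

theorem aestronglyMeasurable_resG_mul (κ : ℝ) {f : E → ℂ} (hf : AEStronglyMeasurable f) :
    AEStronglyMeasurable (fun p : E × E => (resG κ (p.1 - p.2) : ℂ) * f p.2)
      (volume.prod volume) := by
  have h1 : Measurable fun p : E × E => (resG κ (p.1 - p.2) : ℂ) :=
    Complex.measurable_ofReal.comp
      ((measurable_resG κ).comp (measurable_fst.sub measurable_snd))
  exact h1.aestronglyMeasurable.mul hf.comp_snd

/-- Convolution with the kernel of `(-Δ + κ²)⁻¹`. -/
def resConv (κ : ℝ) (f : E → ℂ) (x : E) : ℂ := ∫ y, (resG κ (x - y) : ℂ) * f y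

theorem enorm_resConv_le (κ : ℝ) (f : E → ℂ) (x : E) :
    ‖resConv κ f x‖ₑ ≤ ∫⁻ y, resK κ (x - y) * ‖f y‖ₑ := by
  refine (enorm_integral_le_lintegral_enorm _).trans (lintegral_mono fun y => ?_)
  rw [enorm_mul]
  exact mul_le_mul_left (enorm_resG_le κ _) _

theorem lintegral_resConv_sq_le {κ : ℝ} (hκ : 0 < κ) {f : E → ℂ} (hf : AEStronglyMeasurable f) :
    ∫⁻ x, ‖resConv κ f x‖ₑ ^ 2 ≤ ENNReal.ofReal (1 / κ ^ 2) ^ 2 * ∫⁻ x, ‖f x‖ₑ ^ 2 :=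
  (lintegral_mono fun x => pow_le_pow_left' (enorm_resConv_le κ f x) 2).trans
    (lintegral_sq_resK_conv_le hκ hf.enorm)

theorem eLpNorm_resConv_le {κ : ℝ} (hκ : 0 < κ) {f : E → ℂ} (hf : AEStronglyMeasurable f) :
    eLpNorm (resConv κ f) 2 volume ≤ ENNReal.ofReal (1 / κ ^ 2) * eLpNorm f 2 volume := by
  have h := lintegral_resConv_sq_le hκ hf
  rw [← eLpNorm_two_sq, ← eLpNorm_two_sq, ← mul_pow] at h
  exact (ENNReal.pow_le_pow_left_iff two_ne_zero).1 h

theorem memLp_resConv {κ : ℝ} (hκ : 0 < κ) {f : E → ℂ} (hf : MemLp f 2) :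
    MemLp (resConv κ f) 2 := by
  refine ⟨(aestronglyMeasurable_resG_mul κ hf.1).integral_prod_right', ?_⟩
  exact (eLpNorm_resConv_le hκ hf.1).trans_lt (ENNReal.mul_lt_top ENNReal.ofReal_lt_top hf.2)

theorem ae_lintegral_resK_mul_lt_top {κ : ℝ} (hκ : 0 < κ) {F : E → ℝ≥0∞} (hF : AEMeasurable F)
    (hF2 : ∫⁻ x, F x ^ 2 < ∞) : ∀ᵐ x : E, ∫⁻ y, resK κ (x - y) * F y < ∞ := by
  have h := (lintegral_sq_resK_conv_le hκ hF).trans_lt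
    (ENNReal.mul_lt_top (ENNReal.pow_lt_top ENNReal.ofReal_lt_top) hF2)
  have hm : AEMeasurable (fun x : E => (∫⁻ y, resK κ (x - y) * F y) ^ 2) := by
    refine AEMeasurable.pow_const ?_ 2
    refine AEMeasurable.lintegral_prod_right' (f := fun p : E × E => resK κ (p.1 - p.2) * F p.2) ?_
    have h1 : AEMeasurable (fun p : E × E => F p.2) (volume.prod volume) :=
      hF.comp_quasiMeasurePreserving Measure.quasiMeasurePreserving_snd
    exact ((measurable_resK κ).comp (measurable_fst.sub measurable_snd)).aemeasurable.mul h1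
  filter_upwards [ae_lt_top' hm h.ne] with x hx
  exact (ENNReal.pow_lt_top_iff.1 hx).resolve_right (by norm_num)

theorem ae_integrable_resG_mul {κ : ℝ} (hκ : 0 < κ) {f : E → ℂ} (hf : MemLp f 2) :
    ∀ᵐ x : E, Integrable fun y => (resG κ (x - y) : ℂ) * f y := by
  filter_upwards [ae_lintegral_resK_mul_lt_top hκ hf.1.enorm (lintegral_enorm_sq_lt_top hf)]
    with x hx
  have h1 : Measurable fun y : E => (resG κ (x - y) : ℂ) :=
    Complex.measurable_ofReal.comp ((measurable_resG κ).comp (measurable_const.sub measurable_id))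
  refine ⟨h1.aestronglyMeasurable.mul hf.1, ?_⟩
  refine lt_of_le_of_lt (lintegral_mono fun y => ?_) hx
  rw [enorm_mul]
  exact mul_le_mul_left (enorm_resG_le κ _) _

theorem integrable_prod_resG {κ : ℝ} (hκ : 0 < κ) {f g : E → ℂ} (hf : MemLp f 2) (hg : MemLp g 2) :
    Integrable (fun p : E × E => f p.1 * ((resG κ (p.1 - p.2) : ℂ) * g p.2))
      (volume.prod volume) := by
  have hm : AEStronglyMeasurable (fun p : E × E => f p.1 * ((resG κ (p.1 - p.2) : ℂ) * g p.2))
      (volume.prod volume) := hf.1.comp_fst.mul (aestronglyMeasurable_resG_mul κ hg.1)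
  refine ⟨hm, ?_⟩
  rw [hasFiniteIntegral_iff_enorm, lintegral_prod _ hm.enorm]
  have hmc : AEMeasurable (fun x : E => ∫⁻ y, resK κ (x - y) * ‖g y‖ₑ) := by
    refine AEMeasurable.lintegral_prod_right'
      (f := fun p : E × E => resK κ (p.1 - p.2) * ‖g p.2‖ₑ) ?_
    exact ((measurable_resK κ).comp (measurable_fst.sub measurable_snd)).aemeasurable.mul
      hg.1.comp_snd.enorm
  have h1 : ∫⁻ x : E, ∫⁻ y : E, ‖f x * ((resG κ (x - y) : ℂ) * g y)‖ₑ ≤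
      ∫⁻ x : E, ‖f x‖ₑ * ∫⁻ y, resK κ (x - y) * ‖g y‖ₑ := by
    refine lintegral_mono fun x => ?_
    simp_rw [enorm_mul]
    rw [lintegral_const_mul' _ _ enorm_ne_top]
    gcongr
    exact enorm_resG_le κ _
  refine h1.trans_lt ?_
  have h2 := lintegral_mul_sq_le hf.1.enorm hmc
  have h3 := h2.trans_lt (ENNReal.mul_lt_top (lintegral_enorm_sq_lt_top hf)
    ((lintegral_sq_resK_conv_le hκ hg.1.enorm).trans_lt (ENNReal.mul_lt_top
    (ENNReal.pow_lt_top ENNReal.ofReal_lt_top) (lintegral_enorm_sq_lt_top hg))))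
  exact (ENNReal.pow_lt_top_iff.1 h3).resolve_right (by norm_num)

theorem integral_mul_resConv {κ : ℝ} (hκ : 0 < κ) {f g : E → ℂ} (hf : MemLp f 2)
    (hg : MemLp g 2) : ∫ x, f x * resConv κ g x = ∫ x, g x * resConv κ f x := by
  simp only [resConv, ← integral_const_mul]
  rw [integral_integral_swap (integrable_prod_resG hκ hf hg)]
  refine integral_congr_ae (ae_of_all _ fun x => integral_congr_ae (ae_of_all _ fun y => ?_))
  simp only [resG_sub_comm κ x y]
  ring

theorem resConv_congr (κ : ℝ) {f g : E → ℂ} (h : f =ᵐ[volume] g) (x : E) :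
    resConv κ f x = resConv κ g x := by
  refine integral_congr_ae ?_
  filter_upwards [h] with y hy
  rw [hy]

/-- The free resolvent `(-Δ + κ²)⁻¹`. -/
def freeRes (κ : ℝ) (hκ : 0 < κ) : L2 E →L[ℂ] L2 E :=
  LinearMap.mkContinuous
    { toFun := fun g => (memLp_resConv hκ (Lp.memLp g)).toLp
      map_add' := fun f g => by
        rw [← MemLp.toLp_add]
        refine MemLp.toLp_congr _ _ ?_
        filter_upwards [ae_integrable_resG_mul hκ (Lp.memLp f),
          ae_integrable_resG_mul hκ (Lp.memLp g)] with x hf hg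
        rw [resConv_congr κ (Lp.coeFn_add f g)]
        simp only [resConv, Pi.add_apply, mul_add]
        exact integral_add hf hg
      map_smul' := fun c f => by
        rw [RingHom.id_apply, ← MemLp.toLp_const_smul]
        refine MemLp.toLp_congr _ _ (ae_of_all _ fun x => ?_)
        rw [resConv_congr κ (Lp.coeFn_smul c f)]
        simp only [resConv, Pi.smul_apply, smul_eq_mul, mul_left_comm _ c]
        rw [integral_const_mul] }
    (1 / κ ^ 2) fun g => by
      simp only [LinearMap.coe_mk, AddHom.coe_mk, Lp.norm_toLp]
      have h := eLpNorm_resConv_le hκ (Lp.memLp g).1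
      rw [Lp.norm_def, ← ENNReal.toReal_ofReal (show 0 ≤ 1 / κ ^ 2 by positivity),
        ← ENNReal.toReal_mul]
      refine ENNReal.toReal_mono (ENNReal.mul_ne_top ENNReal.ofReal_ne_top (Lp.eLpNorm_ne_top g)) h

theorem coeFn_freeRes {κ : ℝ} (hκ : 0 < κ) (g : L2 E) :
    (freeRes κ hκ g : E → ℂ) =ᵐ[volume] resConv κ g :=
  (memLp_resConv hκ (Lp.memLp g)).coeFn_toLp

theorem norm_freeRes_le {κ : ℝ} (hκ : 0 < κ) : ‖(freeRes κ hκ : L2 E →L[ℂ] L2 E)‖ ≤ 1 / κ ^ 2 :=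
  LinearMap.mkContinuous_norm_le _ (by positivity) _

theorem inner_freeRes {κ : ℝ} (hκ : 0 < κ) (f g : L2 E) :
    inner ℂ (freeRes κ hκ f) g = inner ℂ f (freeRes κ hκ g) := by
  have hconj : MemLp (fun x => (starRingEnd ℂ) (f x)) 2 (volume : Measure E) :=
    (Lp.memLp f).star
  -- The kernel is real and symmetric, so the bilinear identity with `f` conjugated is the
  -- sesquilinear one.
  have h := integral_mul_resConv hκ (Lp.memLp g) hconj
  rw [L2.inner_def, L2.inner_def]
  calc ∫ x, inner ℂ ((freeRes κ hκ f : L2 E) x) (g x) =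
      ∫ x, g x * resConv κ (fun x => (starRingEnd ℂ) (f x)) x := by
        refine integral_congr_ae ?_
        filter_upwards [coeFn_freeRes hκ f] with x hx
        rw [hx, RCLike.inner_apply, resConv, resConv, ← integral_conj]
        simp
    _ = _ := by
        rw [h]
        refine integral_congr_ae ?_
        filter_upwards [coeFn_freeRes hκ g] with x hx
        rw [hx, RCLike.inner_apply, mul_comm]

theorem integral_schwartz_mul_freeRes {κ : ℝ} (hκ : 0 < κ) (g : L2 E) (η : 𝓢(E, ℂ)) :
    ∫ x, ((κ ^ 2 : ℝ) • η - Δ η) x * freeRes κ hκ g x = ∫ x, η x * g x := by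
  have h := integral_mul_resConv hκ (((κ ^ 2 : ℝ) • η - Δ η).memLp 2) (Lp.memLp g)
  calc _ = ∫ x, ((κ ^ 2 : ℝ) • η - Δ η) x * resConv κ g x := by
        refine integral_congr_ae ?_
        filter_upwards [coeFn_freeRes hκ g] with x hx
        rw [hx]
    _ = _ := by
        rw [h]
        refine integral_congr_ae (ae_of_all _ fun x => ?_)
        simp only [resConv]
        rw [integral_resG_helmholtz hκ, mul_comm]

theorem mem_sobolevH2_of_laplacian {f g : L2 E}
    (h : Δ (f : 𝓢'(E, ℂ)) = (g : 𝓢'(E, ℂ))) : f ∈ sobolevH2 E := by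
  refine ⟨f - ((2 * Real.pi) ^ 2 : ℝ)⁻¹ • g, ?_⟩
  rw [besselPotential_two_apply, h]
  simp only [← Lp.toTemperedDistributionCLM_apply, map_sub]
  congr 1
  rw [ContinuousLinearMap.map_smul_of_tower]

theorem laplacianL2_eq {f : sobolevH2 E} {g : L2 E}
    (h : Δ ((f : L2 E) : 𝓢'(E, ℂ)) = (g : 𝓢'(E, ℂ))) : laplacianL2 E f = g := by
  apply toTemperedDistribution_injective
  rw [← h]
  exact (exists_laplacian f).choose_spec.symm

theorem laplacian_coe_eq (f : sobolevH2 E) :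
    Δ ((f : L2 E) : 𝓢'(E, ℂ)) = (laplacianL2 E f : 𝓢'(E, ℂ)) :=
  (exists_laplacian f).choose_spec

theorem integrable_schwartz_mul (η : 𝓢(E, ℂ)) (g : L2 E) : Integrable fun x => η x * g x :=
  (η.memLp 2).integrable_mul (Lp.memLp g)

theorem laplacian_freeRes {κ : ℝ} (hκ : 0 < κ) (g : L2 E) :
    Δ (freeRes κ hκ g : 𝓢'(E, ℂ)) = ((((κ ^ 2 : ℝ) : ℂ) • freeRes κ hκ g - g : L2 E) : 𝓢'(E, ℂ)) := by
  ext η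
  rw [TemperedDistribution.laplacian_apply_apply, ← Lp.toTemperedDistributionCLM_apply,
    ← Lp.toTemperedDistributionCLM_apply, map_sub, map_smul]
  change _ = ((κ ^ 2 : ℝ) : ℂ) • (Lp.toTemperedDistributionCLM ℂ volume 2 (freeRes κ hκ g)) η -
    Lp.toTemperedDistributionCLM ℂ volume 2 g η
  simp only [Lp.toTemperedDistributionCLM_apply, Lp.toTemperedDistribution_apply, smul_eq_mul]
  rw [← integral_schwartz_mul_freeRes hκ g η, ← integral_const_mul,
    ← integral_sub ((integrable_schwartz_mul η _).const_mul _) (integrable_schwartz_mul _ _)]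
  refine integral_congr_ae (ae_of_all _ fun x => ?_)
  simp only [_root_.sub_apply, _root_.smul_apply, Complex.real_smul]
  ring

theorem freeRes_mem {κ : ℝ} (hκ : 0 < κ) (g : L2 E) : freeRes κ hκ g ∈ sobolevH2 E :=
  mem_sobolevH2_of_laplacian (laplacian_freeRes hκ g)

theorem laplacianL2_freeRes {κ : ℝ} (hκ : 0 < κ) (g : L2 E) :
    laplacianL2 E ⟨freeRes κ hκ g, freeRes_mem hκ g⟩ =
      ((κ ^ 2 : ℝ) : ℂ) • freeRes κ hκ g - g :=
  laplacianL2_eq (laplacian_freeRes hκ g)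

/-- Every Schwartz function is of the form `(κ² - Δ)η`, so a distributional solution of the
homogeneous equation vanishes on all test functions. -/
theorem eq_zero_of_helmholtz {κ : ℝ} (hκ : 0 < κ) {f : sobolevH2 E}
    (h : ((κ ^ 2 : ℝ) : ℂ) • (f : L2 E) - laplacianL2 E f = 0) : (f : L2 E) = 0 := by
  apply toTemperedDistribution_injective
  ext ζ
  obtain ⟨η, rfl⟩ := exists_helmholtz_eq hκ ζ
  have h1 : laplacianL2 E f = ((κ ^ 2 : ℝ) : ℂ) • (f : L2 E) := (sub_eq_zero.1 h).symm
  have h2 := congrArg (fun T : 𝓢'(E, ℂ) => T η) (laplacian_coe_eq f)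
  simp only [TemperedDistribution.laplacian_apply_apply, h1] at h2
  rw [← Lp.toTemperedDistributionCLM_apply, ← Lp.toTemperedDistributionCLM_apply, map_smul] at h2
  have h3 : Lp.toTemperedDistributionCLM ℂ volume 2 (f : L2 E) (Δ η) = ((κ ^ 2 : ℝ) : ℂ) •
    (Lp.toTemperedDistributionCLM ℂ volume 2 (f : L2 E)) η := h2
  rw [← Lp.toTemperedDistributionCLM_apply, ← Lp.toTemperedDistributionCLM_apply, map_zero,
    map_sub, h3, ← Complex.coe_smul, map_smul]
  simp

theorem freeRes_helmholtz {κ : ℝ} (hκ : 0 < κ) (f : sobolevH2 E) :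
    freeRes κ hκ (((κ ^ 2 : ℝ) : ℂ) • (f : L2 E) - laplacianL2 E f) = f := by
  set g := ((κ ^ 2 : ℝ) : ℂ) • (f : L2 E) - laplacianL2 E f with hg
  have h1 := laplacianL2_freeRes hκ g
  have h2 := eq_zero_of_helmholtz hκ (f := ⟨freeRes κ hκ g, freeRes_mem hκ g⟩ - f) (by
    rw [LinearMap.map_sub (laplacianL2 E), h1, Submodule.coe_sub, smul_sub]
    have : laplacianL2 E f = ((κ ^ 2 : ℝ) : ℂ) • (f : L2 E) - g := by rw [hg]; abel
    rw [this]
    abel)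
  rw [Submodule.coe_sub] at h2
  exact sub_eq_zero.1 h2

/-- Symmetry is inherited from the symmetric inverse `(1 - Δ)⁻¹`, which avoids integrating by parts.
-/
theorem inner_laplacianL2 (f g : sobolevH2 E) :
    inner ℂ (laplacianL2 E f) (g : L2 E) = inner ℂ (f : L2 E) (laplacianL2 E g) := by
  have hf := freeRes_helmholtz one_pos f
  have hg := freeRes_helmholtz one_pos g
  have h := inner_freeRes one_pos ((((1 : ℝ) ^ 2 : ℝ) : ℂ) • (f : L2 E) - laplacianL2 E f)
    ((((1 : ℝ) ^ 2 : ℝ) : ℂ) • (g : L2 E) - laplacianL2 E g)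
  rw [hf, hg] at h
  simp only [one_pow, Complex.ofReal_one, one_smul, inner_sub_left, inner_sub_right] at h
  linear_combination h

/-- The resolvent bound says `c‖f‖ ≤ ‖(c - Δ)f‖` for all `c > 0`; squaring gives `2c Re(Δf, f) ≤
‖Δf‖²`, and `c` is arbitrarily large. -/
theorem re_inner_laplacianL2_nonpos (f : sobolevH2 E) :
    (inner ℂ (laplacianL2 E f) (f : L2 E)).re ≤ 0 := by
  have key : ∀ c : ℝ, 0 < c →
      2 * c * (inner ℂ (laplacianL2 E f) (f : L2 E)).re ≤ ‖laplacianL2 E f‖ ^ 2 := by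
    intro c hc
    have hs : 0 < √c := Real.sqrt_pos.2 hc
    have h1 := freeRes_helmholtz hs f
    rw [Real.sq_sqrt hc.le] at h1
    have h2 : c * ‖(f : L2 E)‖ ≤ ‖(c : ℂ) • (f : L2 E) - laplacianL2 E f‖ := by
      conv_lhs => rw [← h1]
      have h3 := (freeRes (E := E) _ hs).le_of_opNorm_le (norm_freeRes_le hs)
        ((c : ℂ) • (f : L2 E) - laplacianL2 E f)
      rw [Real.sq_sqrt hc.le] at h3
      calc c * _ ≤ c * (1 / c * ‖(c : ℂ) • (f : L2 E) - laplacianL2 E f‖) := by gcongr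
        _ = _ := by field_simp
    have h4 : (c * ‖(f : L2 E)‖) ^ 2 ≤ ‖(c : ℂ) • (f : L2 E) - laplacianL2 E f‖ ^ 2 := by
      gcongr
    rw [norm_sub_sq (𝕜 := ℂ), norm_smul, Complex.norm_real, Real.norm_of_nonneg hc.le,
      inner_smul_left, Complex.conj_ofReal, RCLike.re_to_complex, Complex.re_ofReal_mul,
      ← inner_conj_symm, Complex.conj_re] at h4
    nlinarith
  by_contra hneg
  push Not at hneg
  set a := (inner ℂ (laplacianL2 E f) (f : L2 E)).re
  -- This `c` makes the left side `2(‖Δf‖² + 1)`, more than the right side.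
  have := key ((‖laplacianL2 E f‖ ^ 2 + 1) / a) (by positivity)
  have e : 2 * ((‖laplacianL2 E f‖ ^ 2 + 1) / a) * a = 2 * (‖laplacianL2 E f‖ ^ 2 + 1) := by
    field_simp
  rw [e] at this
  nlinarith [sq_nonneg ‖laplacianL2 E f‖]

end FreeResolvent


/-! ### Isolated eigenvalues of bounded symmetric operators. -/

section Abstract

variable {X : Type*} [NormedAddCommGroup X] [InnerProductSpace ℂ X] [CompleteSpace X]

/-- The sequence `x` tends weakly to zero. -/
def WeaklyNull (x : ℕ → X) : Prop := ∀ y, Tendsto (fun n => inner ℂ y (x n)) atTop (𝓝 0)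

/-- Sequential Banach–Alaoglu, transported to the space by the Riesz isomorphism. -/
theorem exists_weaklyNull_subseq [TopologicalSpace.SeparableSpace X] {x : ℕ → X} {A : ℝ}
    (hx : ∀ n, ‖x n‖ ≤ A) :
    ∃ φ : ℕ → ℕ, StrictMono φ ∧ ∃ x₀, WeaklyNull fun n => x (φ n) - x₀ := by
  obtain ⟨ℓ, -, φ, hφ, hlim⟩ := WeakDual.isSeqCompact_closedBall ℂ X 0 A
    (x := fun n => StrongDual.toWeakDual (InnerProductSpace.toDual ℂ X (x n)))
    (fun n => by simpa using hx n)
  refine ⟨φ, hφ, (InnerProductSpace.toDual ℂ X).symm (WeakDual.toStrongDual ℓ), fun y => ?_⟩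
  have h := ((WeakDual.eval_continuous y).tendsto ℓ).comp hlim
  have h1 : Tendsto (fun n => inner ℂ (x (φ n)) y) atTop (𝓝 (ℓ y)) := h
  have h2 : ℓ y = inner ℂ ((InnerProductSpace.toDual ℂ X).symm (WeakDual.toStrongDual ℓ)) y := by
    rw [InnerProductSpace.toDual_symm_apply]; rfl
  rw [h2] at h1
  have h3 := (Complex.continuous_conj.tendsto _).comp h1
  simp only [Function.comp_def, inner_conj_symm] at h3
  simp only [inner_sub_right]
  simpa using h3.sub_const (inner ℂ y ((InnerProductSpace.toDual ℂ X).symm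
    (WeakDual.toStrongDual ℓ)))

theorem WeaklyNull.map {x : ℕ → X} (hx : WeaklyNull x) (T : X →L[ℂ] X) :
    WeaklyNull fun n => T (x n) := by
  intro y
  simpa only [ContinuousLinearMap.adjoint_inner_left] using hx (T.adjoint y)

/-- Bounded weakly null sequences of approximate eigenvectors of `R` at `l` are null sequences, so
that `l` does not belong to the essential spectrum of a symmetric `R`. -/
def ProperAt (R : X →L[ℂ] X) (l : ℝ) : Prop :=
  ∀ x : ℕ → X, WeaklyNull x → (∃ A, ∀ n, ‖x n‖ ≤ A) →
    Tendsto (fun n => (l : ℂ) • x n - R (x n)) atTop (𝓝 0) → Tendsto x atTop (𝓝 0)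

variable {R : X →L[ℂ] X} {l : ℝ}

/-- A weak limit of approximate eigenvectors is an exact eigenvector, since `l - R` is weakly
continuous; properness applied to the differences makes the convergence strong. -/
theorem exists_tendsto_of_approx_eigen [TopologicalSpace.SeparableSpace X]
    (hP : ProperAt R l)
    {x : ℕ → X} {A : ℝ} (hx : ∀ n, ‖x n‖ ≤ A)
    (hl : Tendsto (fun n => (l : ℂ) • x n - R (x n)) atTop (𝓝 0)) :
    ∃ φ : ℕ → ℕ, StrictMono φ ∧ ∃ x₀, Tendsto (fun n => x (φ n)) atTop (𝓝 x₀) ∧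
      R x₀ = (l : ℂ) • x₀ := by
  obtain ⟨φ, hφ, x₀, hw⟩ := exists_weaklyNull_subseq hx
  have hl' : Tendsto (fun n => (l : ℂ) • x (φ n) - R (x (φ n))) atTop (𝓝 0) :=
    hl.comp hφ.tendsto_atTop
  have hx₀ : (l : ℂ) • x₀ - R x₀ = 0 := by
    rw [← inner_self_eq_zero (𝕜 := ℂ)]
    set y := (l : ℂ) • x₀ - R x₀ with hy
    have h1 := (hw.map ((l : ℂ) • ContinuousLinearMap.id ℂ X - R)) y
    have h2 : Tendsto (fun n => inner ℂ y ((l : ℂ) • x (φ n) - R (x (φ n)))) atTop (𝓝 0) := by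
      rw [← inner_zero_right (𝕜 := ℂ) y]
      exact Tendsto.inner tendsto_const_nhds hl'
    have h3 := h2.sub h1
    have h4 : ∀ n, inner ℂ y ((l : ℂ) • x (φ n) - R (x (φ n))) -
        inner ℂ y (((l : ℂ) • ContinuousLinearMap.id ℂ X - R) (x (φ n) - x₀)) = inner ℂ y y := by
      intro n
      rw [← inner_sub_right]
      congr 1
      simp only [_root_.sub_apply, _root_.smul_apply, ContinuousLinearMap.id_apply, map_sub, hy]
      abel
    simp only [h4, sub_zero] at h3
    exact tendsto_nhds_unique tendsto_const_nhds h3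
  refine ⟨φ, hφ, x₀, ?_, (sub_eq_zero.1 hx₀).symm⟩
  have h5 := hP (fun n => x (φ n) - x₀) hw ⟨A + ‖x₀‖, fun n => (norm_sub_le _ _).trans
    (add_le_add_left (hx _) _)⟩ (by
      refine hl'.congr fun n => ?_
      rw [map_sub, smul_sub, sub_sub_sub_comm, hx₀, sub_zero])
  simpa using h5.add_const x₀

variable [TopologicalSpace.SeparableSpace X]

/-- The eigenspace of a bounded operator as the kernel of `l - R`. -/
def eigenKer (R : X →L[ℂ] X) (l : ℝ) : Submodule ℂ X :=
  LinearMap.ker (((l : ℂ) • ContinuousLinearMap.id ℂ X - R).toLinearMap)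

theorem mem_eigenKer {x : X} : x ∈ eigenKer R l ↔ R x = (l : ℂ) • x := by
  rw [eigenKer, LinearMap.mem_ker]
  simp only [ContinuousLinearMap.coe_coe, _root_.sub_apply, _root_.smul_apply,
    ContinuousLinearMap.id_apply]
  rw [sub_eq_zero, eq_comm]

/-- Properness makes the unit ball of the eigenspace compact, and Riesz's theorem applies. -/
theorem finiteDimensional_eigenKer (hP : ProperAt R l) : FiniteDimensional ℂ (eigenKer R l) := by
  refine FiniteDimensional.of_isCompact_closedBall ℂ (r := 1) one_pos (c := 0) ?_
  rw [isCompact_iff_isSeqCompact]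
  intro x hx
  have hb : ∀ n, ‖(x n : X)‖ ≤ 1 := fun n => by simpa using hx n
  obtain ⟨φ, hφ, x₀, hlim, hx₀⟩ := exists_tendsto_of_approx_eigen hP (x := fun n => (x n : X)) hb (by
    have : ∀ n, (l : ℂ) • (x n : X) - R (x n) = 0 := fun n => by
      rw [mem_eigenKer.1 (x n).2, sub_self]
    simp only [this]
    exact tendsto_const_nhds)
  refine ⟨⟨x₀, mem_eigenKer.2 hx₀⟩, ?_, φ, hφ, tendsto_subtype_rng.2 hlim⟩
  simpa using le_of_tendsto hlim.norm (Eventually.of_forall fun n => hb (φ n))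

/-- Otherwise unit approximate eigenvectors orthogonal to the eigenspace would converge to a unit
eigenvector orthogonal to it. -/
theorem exists_bound_orthogonal_eigenKer (hP : ProperAt R l) :
    ∃ c > 0, ∀ x ∈ (eigenKer R l)ᗮ, c * ‖x‖ ≤ ‖(l : ℂ) • x - R x‖ := by
  by_contra hcon
  push Not at hcon
  have h1 : ∀ n : ℕ, ∃ x ∈ (eigenKer R l)ᗮ, ‖x‖ = 1 ∧
      ‖(l : ℂ) • x - R x‖ ≤ 1 / ((n : ℝ) + 1) := by
    intro n
    obtain ⟨x, hx, hlt⟩ := hcon (1 / ((n : ℝ) + 1)) (by positivity)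
    have hx0 : 0 < ‖x‖ := by
      rcases (norm_nonneg x).eq_or_lt with h | h
      · rw [← h, mul_zero] at hlt
        exact absurd hlt (not_lt.2 (norm_nonneg _))
      · exact h
    refine ⟨((‖x‖⁻¹ : ℝ) : ℂ) • x, Submodule.smul_mem _ _ hx, ?_, ?_⟩
    · rw [norm_smul, Complex.norm_real, norm_inv, norm_norm, inv_mul_cancel₀ hx0.ne']
    · rw [map_smul, smul_comm, ← smul_sub, norm_smul, Complex.norm_real, norm_inv, norm_norm,
        inv_mul_le_iff₀ hx0, mul_comm]
      exact hlt.le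
  choose x hxE hx1 hxl using h1
  obtain ⟨φ, hφ, x₀, hlim, hx₀⟩ := exists_tendsto_of_approx_eigen hP (x := x)
    (fun n => (hx1 n).le) (squeeze_zero_norm hxl tendsto_one_div_add_atTop_nhds_zero_nat)
  have hmem : x₀ ∈ (eigenKer R l)ᗮ :=
    (Submodule.isClosed_orthogonal _).mem_of_tendsto hlim (Eventually.of_forall fun n => hxE _)
  have hn : ‖x₀‖ = 1 := by
    have := hlim.norm
    simp only [hx1] at this
    exact tendsto_nhds_unique this tendsto_const_nhds
  have h0 : x₀ = 0 := by
    have := (Submodule.mem_orthogonal _ _).1 hmem x₀ (mem_eigenKer.2 hx₀)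
    exact inner_self_eq_zero.1 this
  rw [h0, norm_zero] at hn
  exact zero_ne_one hn

/-- Symmetry makes `R` preserve the orthogonal complement of the eigenspace. On the eigenspace `w -
R` is multiplication by `w - l`; on the complement it is bounded below by `c - ‖w - l‖`; Pythagoras
combines the two. -/
theorem exists_bound_sub_of_near (hP : ProperAt R l)
    (hsymm : ∀ x y, inner ℂ (R x) y = inner ℂ x (R y)) : ∃ ε > 0, ∀ w : ℂ, w ≠ l → ‖w - l‖ < ε →
    ∃ δ > 0, ∀ x, δ * ‖x‖ ≤ ‖w • x - R x‖ := by
  have hfd := finiteDimensional_eigenKer hP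
  obtain ⟨c, hc, hbound⟩ := exists_bound_orthogonal_eigenKer hP
  refine ⟨c, hc, fun w hw hwl => ⟨min ‖w - l‖ (c - ‖w - l‖),
    lt_min (norm_pos_iff.2 (sub_ne_zero.2 hw)) (sub_pos.2 hwl), fun x => ?_⟩⟩
  set δ := min ‖w - l‖ (c - ‖w - l‖) with hδ
  have hδ0 : 0 < δ := lt_min (norm_pos_iff.2 (sub_ne_zero.2 hw)) (sub_pos.2 hwl)
  obtain ⟨p, hp, q, hq, rfl⟩ := (eigenKer R l).exists_add_mem_mem_orthogonal x
  have hRq : R q ∈ (eigenKer R l)ᗮ := by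
    rw [Submodule.mem_orthogonal] at hq ⊢
    intro u hu
    rw [← hsymm, mem_eigenKer.1 hu, inner_smul_left, hq u hu, mul_zero]
  have e : w • (p + q) - R (p + q) = (w - l) • p + (w • q - R q) := by
    rw [map_add, mem_eigenKer.1 hp, smul_add, sub_smul]; abel
  have ho1 : inner ℂ ((w - (l : ℂ)) • p) (w • q - R q) = 0 := by
    have : w • q - R q ∈ (eigenKer R l)ᗮ := Submodule.sub_mem _ (Submodule.smul_mem _ _ hq) hRq
    exact (Submodule.mem_orthogonal _ _).1 this _ (Submodule.smul_mem _ _ hp)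
  have ho2 : inner ℂ p q = 0 := (Submodule.mem_orthogonal _ _).1 hq _ hp
  have h1 : ‖(w - (l : ℂ)) • p + (w • q - R q)‖ * ‖(w - (l : ℂ)) • p + (w • q - R q)‖ =
      ‖(w - (l : ℂ)) • p‖ * ‖(w - (l : ℂ)) • p‖ + ‖w • q - R q‖ * ‖w • q - R q‖ :=
    norm_add_sq_eq_norm_sq_add_norm_sq_of_inner_eq_zero _ _ ho1
  have h2 : ‖p + q‖ * ‖p + q‖ = ‖p‖ * ‖p‖ + ‖q‖ * ‖q‖ :=
    norm_add_sq_eq_norm_sq_add_norm_sq_of_inner_eq_zero _ _ ho2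
  have h3 : δ * ‖p‖ ≤ ‖(w - (l : ℂ)) • p‖ := by
    rw [norm_smul]
    exact mul_le_mul_of_nonneg_right (min_le_left _ _) (norm_nonneg _)
  have h4 : δ * ‖q‖ ≤ ‖w • q - R q‖ := by
    have h5 := hbound q hq
    have h6 : ‖(l : ℂ) • q - R q‖ ≤ ‖w • q - R q‖ + ‖w - l‖ * ‖q‖ := by
      rw [← norm_smul]
      have : (l : ℂ) • q - R q = (w • q - R q) - (w - l) • q := by rw [sub_smul]; abel
      rw [this]
      exact norm_sub_le _ _
    have h7 : δ * ‖q‖ ≤ (c - ‖w - l‖) * ‖q‖ :=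
      mul_le_mul_of_nonneg_right (min_le_right _ _) (norm_nonneg _)
    linarith
  rw [e]
  refine le_of_sq_le_sq ?_ (norm_nonneg _)
  have h3' := mul_self_le_mul_self (by positivity) h3
  have h4' := mul_self_le_mul_self (by positivity) h4
  calc (δ * ‖p + q‖) ^ 2 = δ * ‖p‖ * (δ * ‖p‖) + δ * ‖q‖ * (δ * ‖q‖) := by
        rw [mul_pow, sq ‖p + q‖, h2]; ring
    _ ≤ _ := by rw [sq, h1]; exact add_le_add h3' h4'

/-- The first bound gives injectivity and closed range. The orthogonal complement of the range is
the kernel at the conjugate point, trivial by the second bound. -/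
theorem exists_inverse_of_bound {w : ℂ} {δ δ' : ℝ} (hδ : 0 < δ) (hδ' : 0 < δ')
    (hsymm : ∀ x y, inner ℂ (R x) y = inner ℂ x (R y))
    (h : ∀ x, δ * ‖x‖ ≤ ‖w • x - R x‖)
    (h' : ∀ x, δ' * ‖x‖ ≤ ‖(starRingEnd ℂ) w • x - R x‖) :
    ∃ S : X →L[ℂ] X, (∀ x, w • S x - R (S x) = x) ∧ ∀ x, S (w • x - R x) = x := by
  let T : X →L[ℂ] X := w • ContinuousLinearMap.id ℂ X - R
  have hT : ∀ x, T x = w • x - R x := fun x => by simp [T]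
  have hanti : AntilipschitzWith (Real.toNNReal δ⁻¹) T := by
    refine AddMonoidHomClass.antilipschitz_of_bound T fun x => ?_
    rw [Real.coe_toNNReal _ (inv_nonneg.2 hδ.le), hT, ← div_eq_inv_mul, le_div_iff₀ hδ, mul_comm]
    exact h x
  have hinj : LinearMap.ker T.toLinearMap = ⊥ := LinearMap.ker_eq_bot.2 hanti.injective
  have hclosed : IsClosed (LinearMap.range T.toLinearMap : Set X) := by
    have := hanti.isClosed_range T.uniformContinuous
    simpa [LinearMap.coe_range] using this
  have hrange : LinearMap.range T.toLinearMap = ⊤ := by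
    have : CompleteSpace (LinearMap.range T.toLinearMap) := hclosed.completeSpace_coe
    rw [← Submodule.orthogonal_eq_bot_iff, Submodule.eq_bot_iff]
    intro y hy
    rw [Submodule.mem_orthogonal] at hy
    have h1 : (starRingEnd ℂ) w • y - R y = 0 := by
      rw [← inner_self_eq_zero (𝕜 := ℂ)]
      have h2 := hy (T ((starRingEnd ℂ) w • y - R y)) ⟨_, rfl⟩
      rw [hT, inner_sub_left, hsymm, inner_smul_left, ← inner_smul_right, ← inner_sub_right] at h2
      exact h2
    have h3 := h' y
    rw [h1, norm_zero] at h3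
    have : ‖y‖ ≤ 0 := by
      by_contra hne
      push Not at hne
      have := mul_pos hδ' hne
      linarith
    exact norm_le_zero_iff.1 this
  let e := ContinuousLinearEquiv.ofBijective T hinj hrange
  refine ⟨e.symm, fun x => ?_, fun x => ?_⟩
  · rw [← hT]
    exact ContinuousLinearEquiv.ofBijective_apply_symm_apply T hinj hrange x
  · rw [← hT]
    exact ContinuousLinearEquiv.ofBijective_symm_apply_apply T hinj hrange x

theorem exists_inverse_near (hP : ProperAt R l)
    (hsymm : ∀ x y, inner ℂ (R x) y = inner ℂ x (R y)) : ∃ ε > 0, ∀ w : ℂ, w ≠ l → ‖w - l‖ < ε →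
    ∃ S : X →L[ℂ] X, (∀ x, w • S x - R (S x) = x) ∧ ∀ x, S (w • x - R x) = x := by
  obtain ⟨ε, hε, h⟩ := exists_bound_sub_of_near hP hsymm
  refine ⟨ε, hε, fun w hw hwl => ?_⟩
  obtain ⟨δ, hδ, h1⟩ := h w hw hwl
  obtain ⟨δ', hδ', h2⟩ := h ((starRingEnd ℂ) w)
    (fun hc => hw (by have := congrArg (starRingEnd ℂ) hc; simpa using this))
    (by
      have : (starRingEnd ℂ) w - l = (starRingEnd ℂ) (w - l) := by simp
      rw [this, RCLike.norm_conj]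
      exact hwl)
  exact exists_inverse_of_bound hδ hδ' hsymm h1 h2

/-- A sequence in the unit ball with `‖R xₙ‖ → ‖R‖ = l` makes `(l² - R²)xₙ` small. As `R ≥ 0`, the
factor `l + R` is bounded below by `l`, so `(l - R)xₙ` is small too, and a limit point is an
eigenvector. -/
theorem eigenKer_ne_bot (hP : ProperAt R l)
    (hsymm : ∀ x y, inner ℂ (R x) y = inner ℂ x (R y)) (hl : 0 < l) (hnorm : ‖R‖ = l)
    (hpos : ∀ x, 0 ≤ (inner ℂ (R x) x).re) : eigenKer R l ≠ ⊥ := by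
  have h1 : ∀ n : ℕ, ∃ x : X, ‖x‖ < 1 ∧ l - 1 / ((n : ℝ) + 1) < ‖R x‖ := fun n =>
    R.exists_lt_apply_of_lt_opNorm (by rw [hnorm]; simp; positivity)
  choose x hx1 hxR using h1
  have hRle : ∀ y, ‖R y‖ ≤ l * ‖y‖ := fun y => hnorm ▸ R.le_opNorm y
  have hlim : Tendsto (fun n => ‖R (x n)‖) atTop (𝓝 l) := by
    refine tendsto_of_tendsto_of_tendsto_of_le_of_le (g := fun n : ℕ => l - 1 / ((n : ℝ) + 1))
      (h := fun _ => l) ?_ tendsto_const_nhds (fun n => (hxR n).le) fun n => ?_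
    · simpa using tendsto_one_div_add_atTop_nhds_zero_nat.const_sub l
    · exact (hRle _).trans (by nlinarith [hx1 n])
  have hsq : ∀ n, ‖(l : ℂ) • x n - R (x n)‖ ^ 2 * l ^ 2 ≤ l ^ 4 - l ^ 2 * ‖R (x n)‖ ^ 2 := by
    intro n
    set y := (l : ℂ) • x n - R (x n) with hy
    have ha : ‖y‖ * l ≤ ‖(l : ℂ) • y + R y‖ := by
      refine le_of_sq_le_sq ?_ (norm_nonneg _)
      rw [norm_add_sq (𝕜 := ℂ), norm_smul, Complex.norm_real, Real.norm_of_nonneg hl.le,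
        inner_smul_left, Complex.conj_ofReal, RCLike.re_to_complex, Complex.re_ofReal_mul,
        ← inner_conj_symm, Complex.conj_re]
      nlinarith [hpos y, sq_nonneg ‖R y‖, mul_nonneg hl.le (hpos y)]
    have hb : (l : ℂ) • y + R y = ((l ^ 2 : ℝ) : ℂ) • x n - R (R (x n)) := by
      rw [hy, map_sub, map_smul, smul_sub, smul_smul, ← Complex.ofReal_mul, ← sq]
      abel
    have hc : ‖((l ^ 2 : ℝ) : ℂ) • x n - R (R (x n))‖ ^ 2 ≤ l ^ 4 - l ^ 2 * ‖R (x n)‖ ^ 2 := by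
      rw [norm_sub_sq (𝕜 := ℂ), norm_smul, Complex.norm_real, Real.norm_of_nonneg (by positivity),
        inner_smul_left, Complex.conj_ofReal, RCLike.re_to_complex, Complex.re_ofReal_mul,
        ← hsymm, inner_self_eq_norm_sq_to_K]
      have e : (((‖R (x n)‖ : ℝ) : ℂ) ^ 2).re = ‖R (x n)‖ ^ 2 := by
        rw [← Complex.ofReal_pow, Complex.ofReal_re]
      have h2 : ‖R (R (x n))‖ ^ 2 ≤ l ^ 2 * ‖R (x n)‖ ^ 2 := by
        rw [← mul_pow]; gcongr; exact hRle _
      have h3 : (l ^ 2 * ‖x n‖) ^ 2 ≤ l ^ 4 := by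
        have : ‖x n‖ ^ 2 ≤ 1 := by
          have := hx1 n
          have := norm_nonneg (x n)
          nlinarith
        calc (l ^ 2 * ‖x n‖) ^ 2 = l ^ 4 * ‖x n‖ ^ 2 := by ring
          _ ≤ l ^ 4 * 1 := by gcongr
          _ = l ^ 4 := mul_one _
      have e' : ((RCLike.ofReal (K := ℂ) ‖R (x n)‖) ^ 2).re = ‖R (x n)‖ ^ 2 := e
      rw [e']
      linarith
    rw [hb] at ha
    calc ‖y‖ ^ 2 * l ^ 2 = (‖y‖ * l) ^ 2 := by ring
      _ ≤ _ := by gcongr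
      _ ≤ _ := hc
  have hzero : Tendsto (fun n => (l : ℂ) • x n - R (x n)) atTop (𝓝 0) := by
    rw [tendsto_zero_iff_norm_tendsto_zero]
    have h2 : Tendsto (fun n => l ^ 4 - l ^ 2 * ‖R (x n)‖ ^ 2) atTop (𝓝 0) := by
      have := ((hlim.pow 2).const_mul (l ^ 2)).const_sub (l ^ 4)
      rwa [show l ^ 4 - l ^ 2 * l ^ 2 = 0 by ring] at this
    have h3 : Tendsto (fun n => ‖(l : ℂ) • x n - R (x n)‖ ^ 2) atTop (𝓝 0) := by
      have := h2.div_const (l ^ 2)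
      rw [zero_div] at this
      refine squeeze_zero (fun n => sq_nonneg _) (fun n => ?_) this
      rw [le_div_iff₀ (by positivity)]
      exact hsq n
    have h4 := (Real.continuous_sqrt.tendsto 0).comp h3
    simpa [Function.comp_def] using h4
  obtain ⟨φ, hφ, x₀, hx₀, hR⟩ := exists_tendsto_of_approx_eigen hP (fun n => (hx1 n).le) hzero
  intro hbot
  have h0 : x₀ = 0 := by
    have : x₀ ∈ eigenKer R l := mem_eigenKer.2 hR
    rwa [hbot, Submodule.mem_bot] at this
  have h5 : Tendsto (fun n => ‖R (x (φ n))‖) atTop (𝓝 ‖R x₀‖) :=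
    ((R.continuous.tendsto x₀).comp hx₀).norm
  have h6 := tendsto_nhds_unique h5 (hlim.comp hφ.tendsto_atTop)
  rw [h0, map_zero, norm_zero] at h6
  exact hl.ne h6

/-- This is `R² ≤ ‖R‖ R`, read off from positivity at `x - ‖R‖⁻¹ R x`. -/
theorem norm_sq_le_of_positive (hsymm : ∀ x y, inner ℂ (R x) y = inner ℂ x (R y))
    (hpos : ∀ x, 0 ≤ (inner ℂ (R x) x).re) (x : X) :
    ‖R x‖ ^ 2 ≤ ‖R‖ * (inner ℂ (R x) x).re := by
  rcases (norm_nonneg R).eq_or_lt with h0 | h0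
  · have : R = 0 := norm_eq_zero.1 h0.symm
    simp [this]
  · have h1 := hpos (x - ((‖R‖⁻¹ : ℝ) : ℂ) • R x)
    have h2 : (inner ℂ (R (R x)) (R x)).re ≤ ‖R‖ * ‖R x‖ ^ 2 := by
      refine (Complex.re_le_norm _).trans ((norm_inner_le_norm _ _).trans ?_)
      rw [sq, ← mul_assoc]
      gcongr
      exact R.le_opNorm _
    have h3 : (inner ℂ (R x) (R x)).re = ‖R x‖ ^ 2 := by
      rw [inner_self_eq_norm_sq_to_K]
      change (((‖R x‖ : ℝ) : ℂ) ^ 2).re = _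
      rw [← Complex.ofReal_pow, Complex.ofReal_re]
    rw [map_sub, map_smul, inner_sub_left, inner_sub_right, inner_sub_right, inner_smul_left,
      inner_smul_right, inner_smul_left, inner_smul_right, Complex.conj_ofReal, hsymm (R x) x] at h1
    simp only [Complex.sub_re, Complex.re_ofReal_mul, h3] at h1
    have h4 : ‖R‖⁻¹ * (‖R‖⁻¹ * (inner ℂ (R (R x)) (R x)).re) ≤ ‖R‖⁻¹ * ‖R x‖ ^ 2 := by
      gcongr
      rw [inv_mul_le_iff₀ h0]
      exact h2
    have h5 : ‖R‖⁻¹ * ‖R x‖ ^ 2 ≤ (inner ℂ (R x) x).re := by linarith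
    rwa [inv_mul_le_iff₀ h0] at h5

end Abstract


/-! ### Schrödinger operators with bounded potential and their resolvent. -/

section BoundedPotential

variable {E : Type*} [NormedAddCommGroup E] [InnerProductSpace ℝ E] [FiniteDimensional ℝ E]
  [MeasurableSpace E] [BorelSpace E]

/-- `U` is measurable with values in `[0, C]`. -/
structure BddPotential (U : E → ℝ) (C : ℝ) : Prop where
  meas : Measurable U
  nonneg : ∀ x, 0 ≤ U x
  le : ∀ x, U x ≤ C

variable {U : E → ℝ} {C : ℝ}

theorem BddPotential.const_nonneg (hU : BddPotential U C) : 0 ≤ C := (hU.nonneg 0).trans (hU.le 0)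

theorem BddPotential.norm_le (hU : BddPotential U C) (x : E) : ‖(U x : ℂ)‖ ≤ C := by
  rw [Complex.norm_real, Real.norm_of_nonneg (hU.nonneg x)]
  exact hU.le x

theorem BddPotential.indicator (hU : BddPotential U C) {D : Set E} (hD : MeasurableSet D) :
    BddPotential (D.indicator U) C where
  meas := hU.meas.indicator hD
  nonneg := fun x => Set.indicator_nonneg (fun x _ => hU.nonneg x) x
  le := fun x => Set.indicator_apply_le' (fun _ => hU.le x) fun _ => hU.const_nonneg

theorem BddPotential.memLp_mul (hU : BddPotential U C) {f : E → ℂ} (hf : MemLp f 2) :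
    MemLp (fun y => (U y : ℂ) * f y) 2 :=
  hf.of_le_mul (c := C) ((Complex.measurable_ofReal.comp hU.meas).aestronglyMeasurable.mul hf.1)
    (ae_of_all _ fun x => by
      rw [norm_mul]
      exact mul_le_mul_of_nonneg_right (hU.norm_le x) (norm_nonneg _))

/-- Multiplication by a bounded potential, as a bounded operator. -/
def mulCLM (hU : BddPotential U C) : L2 E →L[ℂ] L2 E :=
  LinearMap.mkContinuous
    { toFun := fun g => (hU.memLp_mul (Lp.memLp g)).toLp
      map_add' := fun f g => by
        rw [← MemLp.toLp_add]
        refine MemLp.toLp_congr _ _ ?_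
        filter_upwards [Lp.coeFn_add f g] with x hx
        simp only [hx, Pi.add_apply, mul_add]
      map_smul' := fun c f => by
        rw [RingHom.id_apply, ← MemLp.toLp_const_smul]
        refine MemLp.toLp_congr _ _ ?_
        filter_upwards [Lp.coeFn_smul c f] with x hx
        simp only [hx, Pi.smul_apply, smul_eq_mul]
        ring }
    C fun g => by
      refine Lp.norm_le_mul_norm_of_ae_le_mul ?_
      filter_upwards [(hU.memLp_mul (Lp.memLp g)).coeFn_toLp] with x hx
      simp only [LinearMap.coe_mk, AddHom.coe_mk]
      rw [hx, norm_mul]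
      exact mul_le_mul_of_nonneg_right (hU.norm_le x) (norm_nonneg _)

theorem coeFn_mulCLM (hU : BddPotential U C) (g : L2 E) :
    (mulCLM hU g : E → ℂ) =ᵐ[volume] fun y => (U y : ℂ) * g y :=
  (hU.memLp_mul (Lp.memLp g)).coeFn_toLp

theorem norm_mulCLM_le (hU : BddPotential U C) : ‖mulCLM hU‖ ≤ C :=
  LinearMap.mkContinuous_norm_le _ hU.const_nonneg _

theorem inner_mulCLM (hU : BddPotential U C) (f g : L2 E) :
    inner ℂ (mulCLM hU f) g = inner ℂ f (mulCLM hU g) := by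
  rw [L2.inner_def, L2.inner_def]
  refine integral_congr_ae ?_
  filter_upwards [coeFn_mulCLM hU f, coeFn_mulCLM hU g] with x hf hg
  rw [hf, hg, RCLike.inner_apply, RCLike.inner_apply, map_mul, Complex.conj_ofReal]
  ring

theorem re_inner_mulCLM_nonneg (hU : BddPotential U C) (f : L2 E) :
    0 ≤ (inner ℂ (mulCLM hU f) f).re := by
  rw [L2.inner_def, ← RCLike.re_to_complex, ← integral_re (L2.integrable_inner _ _)]
  refine integral_nonneg_of_ae ?_
  filter_upwards [coeFn_mulCLM hU f] with x hf
  simp only [Pi.zero_apply]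
  have e : inner ℂ ((U x : ℂ) * f x) (f x) = ((U x * Complex.normSq (f x) : ℝ) : ℂ) := by
    rw [RCLike.inner_apply, map_mul, Complex.conj_ofReal, mul_left_comm, Complex.mul_conj,
      Complex.ofReal_mul]
  rw [hf, e]
  exact mul_nonneg (hU.nonneg x) (Complex.normSq_nonneg _)

instance separableSpace_L2 : TopologicalSpace.SeparableSpace (L2 E) :=
  haveI : Fact ((2 : ℝ≥0∞) ≠ ∞) := ⟨ENNReal.ofNat_ne_top⟩
  haveI : SecondCountableTopology (L2 E) := Lp.SecondCountableTopology
  inferInstance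

variable {W : E → ℝ}

theorem mulDomain_eq_top (hU : BddPotential U C) (hWU : W =ᵐ[volume] U) : mulDomain W = ⊤ := by
  rw [eq_top_iff]
  intro f _
  refine (hU.memLp_mul (Lp.memLp f)).ae_eq ?_
  filter_upwards [hWU] with x hx
  rw [hx]

theorem mem_schrodinger_domain (hU : BddPotential U C) (hWU : W =ᵐ[volume] U) {f : L2 E} :
    f ∈ (schrodinger W).domain ↔ f ∈ sobolevH2 E := by
  change f ∈ sobolevH2 E ⊓ mulDomain W ↔ _
  rw [mulDomain_eq_top hU hWU, inf_top_eq]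

theorem schrodinger_apply (hU : BddPotential U C) (hWU : W =ᵐ[volume] U) {f : L2 E}
    (hf : f ∈ (schrodinger W).domain) (hf' : f ∈ sobolevH2 E) :
    schrodinger W ⟨f, hf⟩ = -laplacianL2 E ⟨f, hf'⟩ - mulCLM hU f := by
  change -laplacianL2 E ⟨f, _⟩ - mulOp W ⟨f, _⟩ = _
  congr 1
  have hm : f ∈ mulDomain W := by rw [mulDomain_eq_top hU hWU]; trivial
  refine MemLp.toLp_congr (memLp_of_mem_mulDomain ⟨f, hm⟩) (hU.memLp_mul (Lp.memLp f)) ?_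
  filter_upwards [hWU] with x hx
  rw [hx]

/-- The operator `-Δ - U` as a function on `H²`. -/
def hamil (hU : BddPotential U C) (f : sobolevH2 E) : L2 E :=
  -laplacianL2 E f - mulCLM hU (f : L2 E)

theorem inner_hamil (hU : BddPotential U C) (f g : sobolevH2 E) :
    inner ℂ (hamil hU f) (g : L2 E) = inner ℂ (f : L2 E) (hamil hU g) := by
  simp only [hamil, inner_sub_left, inner_sub_right, inner_neg_left, inner_neg_right,
    inner_laplacianL2, inner_mulCLM]

theorem neg_le_re_inner_hamil (hU : BddPotential U C) (f : sobolevH2 E) :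
    -C * ‖(f : L2 E)‖ ^ 2 ≤ (inner ℂ (hamil hU f) (f : L2 E)).re := by
  have h1 := re_inner_laplacianL2_nonpos f
  have h2 : (inner ℂ (mulCLM hU (f : L2 E)) (f : L2 E)).re ≤ C * ‖(f : L2 E)‖ ^ 2 := by
    refine (Complex.re_le_norm _).trans ((norm_inner_le_norm _ _).trans ?_)
    rw [sq, ← mul_assoc]
    gcongr
    exact (mulCLM hU).le_of_opNorm_le (norm_mulCLM_le hU) _
  simp only [hamil, inner_sub_left, inner_neg_left, Complex.sub_re, Complex.neg_re]
  linarith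

/-- The factorization `-Δ - U + c = (1 - U R₀)(-Δ + c)` with `R₀ = (-Δ + c)⁻¹` and `‖U R₀‖ ≤ C/c <
1` lets a Neumann series invert the first factor. Positivity comes from `H ≥ -C`. -/
theorem exists_resolvent (hU : BddPotential U C) {c : ℝ} (hc : C < c) :
    ∃ R : L2 E →L[ℂ] L2 E, ∃ hR : ∀ g, R g ∈ sobolevH2 E,
      (∀ g, hamil hU ⟨R g, hR g⟩ + (c : ℂ) • R g = g) ∧
      (∀ f : sobolevH2 E, R (hamil hU f + (c : ℂ) • (f : L2 E)) = f) ∧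
      (∀ f g, inner ℂ (R f) g = inner ℂ f (R g)) ∧
      ∀ f, 0 ≤ (inner ℂ (R f) f).re := by
  have hc0 : 0 < c := hU.const_nonneg.trans_lt hc
  have hs : 0 < √c := Real.sqrt_pos.2 hc0
  set R₀ : L2 E →L[ℂ] L2 E := freeRes (√c) hs with hR₀
  have hn : ‖mulCLM hU * R₀‖ < 1 := by
    refine (norm_mul_le _ _).trans_lt ?_
    calc ‖mulCLM hU‖ * ‖R₀‖ ≤ C * (1 / √c ^ 2) :=
          mul_le_mul (norm_mulCLM_le hU) (norm_freeRes_le hs) (norm_nonneg _) hU.const_nonneg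
      _ < 1 := by rw [Real.sq_sqrt hc0.le, mul_one_div, div_lt_one hc0]; exact hc
  obtain ⟨u, hu⟩ := isUnit_one_sub_of_norm_lt_one hn
  have hu1 : ∀ g : L2 E, (↑u⁻¹ : L2 E →L[ℂ] L2 E) g - mulCLM hU (R₀ ((↑u⁻¹ : L2 E →L[ℂ] L2 E) g))
      = g := by
    intro g
    have := congrArg (fun T : L2 E →L[ℂ] L2 E => T g) u.mul_inv
    rw [hu] at this
    simpa using this
  have hu2 : ∀ g : L2 E, (↑u⁻¹ : L2 E →L[ℂ] L2 E) (g - mulCLM hU (R₀ g)) = g := by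
    intro g
    have := congrArg (fun T : L2 E →L[ℂ] L2 E => T g) u.inv_mul
    rw [hu] at this
    simpa using this
  have hR : ∀ g, (R₀ * (↑u⁻¹ : L2 E →L[ℂ] L2 E)) g ∈ sobolevH2 E := fun g => freeRes_mem hs _
  have h1 : ∀ g, hamil hU ⟨(R₀ * (↑u⁻¹ : L2 E →L[ℂ] L2 E)) g, hR g⟩ +
      (c : ℂ) • (R₀ * (↑u⁻¹ : L2 E →L[ℂ] L2 E)) g = g := by
    intro g
    have h := laplacianL2_freeRes hs ((↑u⁻¹ : L2 E →L[ℂ] L2 E) g)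
    rw [Real.sq_sqrt hc0.le] at h
    have h' : laplacianL2 E ⟨(R₀ * (↑u⁻¹ : L2 E →L[ℂ] L2 E)) g, hR g⟩ =
      (c : ℂ) • R₀ ((↑u⁻¹ : L2 E →L[ℂ] L2 E) g) - (↑u⁻¹ : L2 E →L[ℂ] L2 E) g := h
    rw [hamil, h']
    change -_ - mulCLM hU (R₀ ((↑u⁻¹ : L2 E →L[ℂ] L2 E) g)) +
      (c : ℂ) • R₀ ((↑u⁻¹ : L2 E →L[ℂ] L2 E) g) = g
    conv_rhs => rw [← hu1 g]
    abel
  have hsymm : ∀ f g, inner ℂ ((R₀ * (↑u⁻¹ : L2 E →L[ℂ] L2 E)) f) g =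
      inner ℂ f ((R₀ * (↑u⁻¹ : L2 E →L[ℂ] L2 E)) g) := by
    intro f g
    have hf := h1 f
    have hg := h1 g
    have h := inner_hamil hU ⟨_, hR f⟩ ⟨_, hR g⟩
    calc inner ℂ ((R₀ * (↑u⁻¹ : L2 E →L[ℂ] L2 E)) f) g =
          inner ℂ ((R₀ * (↑u⁻¹ : L2 E →L[ℂ] L2 E)) f) (hamil hU ⟨_, hR g⟩ +
            (c : ℂ) • (R₀ * (↑u⁻¹ : L2 E →L[ℂ] L2 E)) g) := by rw [hg]
      _ = inner ℂ (hamil hU ⟨_, hR f⟩ +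
            (c : ℂ) • (R₀ * (↑u⁻¹ : L2 E →L[ℂ] L2 E)) f)
            ((R₀ * (↑u⁻¹ : L2 E →L[ℂ] L2 E)) g) := by
          rw [inner_add_left, inner_add_right, inner_smul_left, inner_smul_right,
            Complex.conj_ofReal, h]
      _ = _ := by rw [hf]
  refine ⟨R₀ * (↑u⁻¹ : L2 E →L[ℂ] L2 E), hR, h1, ?_, hsymm, ?_⟩
  · intro f
    have h := freeRes_helmholtz hs f
    rw [Real.sq_sqrt hc0.le] at h
    set k := (c : ℂ) • (f : L2 E) - laplacianL2 E f with hk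
    have e : hamil hU f + (c : ℂ) • (f : L2 E) = k - mulCLM hU (R₀ k) := by
      rw [hR₀, h, hk, hamil]; abel
    rw [e]
    change R₀ ((↑u⁻¹ : L2 E →L[ℂ] L2 E) (k - mulCLM hU (R₀ k))) = f
    rw [hu2]
    exact h
  · intro f
    have hf := h1 f
    have h := neg_le_re_inner_hamil hU ⟨_, hR f⟩
    rw [hsymm, show inner ℂ f ((R₀ * (↑u⁻¹ : L2 E →L[ℂ] L2 E)) f) =
      inner ℂ (hamil hU ⟨_, hR f⟩ + (c : ℂ) • (R₀ * (↑u⁻¹ : L2 E →L[ℂ] L2 E)) f)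
        ((R₀ * (↑u⁻¹ : L2 E →L[ℂ] L2 E)) f) by rw [hf],
      inner_add_left, inner_smul_left, Complex.conj_ofReal, Complex.add_re,
      Complex.re_ofReal_mul]
    simp only at h
    set a := (R₀ * (↑u⁻¹ : L2 E →L[ℂ] L2 E)) f with ha
    have e : (inner ℂ a a).re = ‖a‖ ^ 2 := by
      rw [inner_self_eq_norm_sq_to_K]
      change (((‖a‖ : ℝ) : ℂ) ^ 2).re = _
      rw [← Complex.ofReal_pow, Complex.ofReal_re]
    rw [e]
    nlinarith [sq_nonneg ‖a‖]

/-- If the resolvent `R = (H + c)⁻¹` is proper at its norm, then `H` has discrete spectrum. -/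
theorem discSpec_nonempty_of_resolvent (hU : BddPotential U C) (hWU : W =ᵐ[volume] U) {c : ℝ}
    {R : L2 E →L[ℂ] L2 E} (hR : ∀ g, R g ∈ sobolevH2 E)
    (hright : ∀ g, hamil hU ⟨R g, hR g⟩ + (c : ℂ) • R g = g)
    (hleft : ∀ f : sobolevH2 E, R (hamil hU f + (c : ℂ) • (f : L2 E)) = f)
    (hsymm : ∀ f g, inner ℂ (R f) g = inner ℂ f (R g))
    (hpos : ∀ f, 0 ≤ (inner ℂ (R f) f).re)
    (hn : 0 < ‖R‖) (hP : ProperAt R ‖R‖) : (discSpec (schrodinger W)).Nonempty := by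
  set l : ℝ := ‖R‖ with hl
  set z : ℝ := l⁻¹ - c with hz
  have hmem : ∀ f, f ∈ (schrodinger W).domain ↔ f ∈ sobolevH2 E := fun f =>
    mem_schrodinger_domain hU hWU
  have happ : ∀ (f : L2 E) (hf : f ∈ (schrodinger W).domain),
      schrodinger W ⟨f, hf⟩ = hamil hU ⟨f, (hmem f).1 hf⟩ := fun f hf =>
    schrodinger_apply hU hWU hf ((hmem f).1 hf)
  have hlC : (l : ℂ) ≠ 0 := by exact_mod_cast hn.ne'
  have heig : eigenspace (schrodinger W) z = eigenKer R l := by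
    ext x
    rw [mem_eigenKer]
    constructor
    · rintro ⟨f, hf, rfl⟩
      have h1 : schrodinger W f - (z : ℂ) • (f : L2 E) = 0 := by
        exact hf
      rw [happ _ f.2] at h1
      have h2 := hleft ⟨f, (hmem _).1 f.2⟩
      have h3 : hamil hU ⟨f, (hmem _).1 f.2⟩ = (z : ℂ) • (f : L2 E) := sub_eq_zero.1 h1
      rw [h3, ← add_smul, hz] at h2
      push_cast at h2
      rw [sub_add_cancel, map_smul] at h2
      change R (f : L2 E) = (l : ℂ) • (f : L2 E)
      conv_rhs => rw [← h2]
      rw [smul_smul, mul_inv_cancel₀ hlC, one_smul]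
    · intro hx
      have hxm : x ∈ sobolevH2 E := by
        have := (sobolevH2 E).smul_mem (l : ℂ)⁻¹ (hR x)
        rwa [hx, smul_smul, inv_mul_cancel₀ hlC, one_smul] at this
      refine ⟨⟨x, (hmem x).2 hxm⟩, ?_, rfl⟩
      have h1 := hright x
      have h2 : hamil hU ⟨R x, hR x⟩ = (l : ℂ) • hamil hU ⟨x, hxm⟩ := by
        have : (⟨R x, hR x⟩ : sobolevH2 E) = (l : ℂ) • ⟨x, hxm⟩ := Subtype.ext hx
        rw [this]
        simp only [hamil, map_smul, smul_sub, smul_neg, Submodule.coe_smul]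
      rw [h2, hx] at h1
      have h3 : hamil hU ⟨x, hxm⟩ = (z : ℂ) • x := by
        have h4 : (l : ℂ) • hamil hU ⟨x, hxm⟩ = x - (c : ℂ) • (l : ℂ) • x := by
          rw [eq_sub_iff_add_eq]; exact h1
        have h5 := congrArg (fun y => (l : ℂ)⁻¹ • y) h4
        simp only [smul_smul, inv_mul_cancel₀ hlC, one_smul, smul_sub] at h5
        rw [h5, hz]
        push_cast
        rw [sub_smul]
        congr 2
        rw [mul_comm (c : ℂ), ← mul_assoc, inv_mul_cancel₀ hlC, one_mul]
      change schrodinger W ⟨x, _⟩ - (z : ℂ) • x = 0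
      rw [happ, h3, sub_self]
  have hne : eigenspace (schrodinger W) z ≠ ⊥ := heig ▸ eigenKer_ne_bot hP hsymm hn rfl hpos
  refine ⟨z, ?_, ?_, hne, heig ▸ finiteDimensional_eigenKer hP⟩
  · rintro ⟨S, -, hS⟩
    refine hne ?_
    rw [Submodule.eq_bot_iff]
    rintro x ⟨f, hf, rfl⟩
    have h1 : schrodinger W f - (z : ℂ) • (f : L2 E) = 0 := by
      exact hf
    have h2 := hS f
    rw [h1, map_zero] at h2
    exact h2.symm
  · obtain ⟨ε, hε, hS⟩ := exists_inverse_near hP hsymm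
    have hcont : ContinuousAt (fun w : ℂ => (w + c)⁻¹) z := by
      refine ContinuousAt.inv₀ (by fun_prop) ?_
      rw [hz]; push_cast; rw [sub_add_cancel]; exact inv_ne_zero hlC
    have hval : ((z : ℂ) + c)⁻¹ = l := by
      rw [hz]; push_cast; rw [sub_add_cancel, inv_inv]
    -- `ε` keeps `ν` in the region where `ν - R` is invertible; `l` keeps `ν` away from zero and so
    -- excludes `w = -c`, where the inverse takes its default value.
    obtain ⟨δ, hδ, hclose⟩ := Metric.continuousAt_iff.1 hcont (min ε l) (lt_min hε hn)
    refine ⟨δ, hδ, fun w hw hwz => ?_⟩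
    by_contra hne'
    refine hw ?_
    have hc1 := hclose hwz
    simp only [hval, dist_eq_norm] at hc1
    set ν : ℂ := (w + c)⁻¹ with hν
    have hν0 : ν ≠ 0 := by
      intro h0
      rw [h0, zero_sub, norm_neg, Complex.norm_real, Real.norm_of_nonneg hn.le] at hc1
      exact absurd hc1 (not_lt.2 (min_le_right _ _))
    have hμν : (w + c) * ν = 1 := by
      rw [hν, mul_inv_cancel₀]
      intro h0
      rw [hν, h0, inv_zero] at hν0
      exact hν0 rfl
    have hνl : ν ≠ l := by
      intro h0
      rw [hν, ← hval] at h0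
      exact hne' (by simpa using inv_injective h0)
    obtain ⟨S, hS1, hS2⟩ := hS ν hνl (hc1.trans_le (min_le_left _ _))
    -- With `ν = (w + c)⁻¹` one has `(H - w)R = ν⁻¹(ν - R)`, hence `(H - w)⁻¹ = ν R (ν - R)⁻¹`.
    refine ⟨ν • (R.comp S), fun g => ?_, fun f => ?_⟩
    · have hd : (ν • (R.comp S)) g ∈ sobolevH2 E := (sobolevH2 E).smul_mem _ (hR _)
      refine ⟨(hmem _).2 hd, ?_⟩
      rw [happ]
      have e1 : hamil hU ⟨(ν • (R.comp S)) g, hd⟩ = ν • hamil hU ⟨R (S g), hR _⟩ := by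
        have : (⟨(ν • (R.comp S)) g, hd⟩ : sobolevH2 E) = ν • ⟨R (S g), hR _⟩ := rfl
        rw [this]
        simp only [hamil, map_smul, smul_sub, smul_neg, Submodule.coe_smul]
      have e2 : hamil hU ⟨R (S g), hR _⟩ = S g - (c : ℂ) • R (S g) :=
        eq_sub_iff_add_eq.2 (hright (S g))
      rw [e1, e2]
      change ν • (S g - (c : ℂ) • R (S g)) - w • ν • R (S g) = g
      have e3 := hS1 g
      have e4 : ν • (S g - (c : ℂ) • R (S g)) - w • ν • R (S g) =
          ν • S g - ((w + c) * ν) • R (S g) := by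
        simp only [smul_sub, smul_smul, add_mul, add_smul, mul_comm ν]
        abel
      rw [e4, hμν, one_smul, e3]
    · have h1 := hleft ⟨f, (hmem _).1 f.2⟩
      rw [happ _ f.2]
      set k := hamil hU ⟨f, (hmem _).1 f.2⟩ + (c : ℂ) • (f : L2 E) with hk
      have h2 : R k = (f : L2 E) := h1
      have e1 : hamil hU ⟨f, (hmem _).1 f.2⟩ - w • (f : L2 E) = (w + c) • (ν • k - R k) := by
        rw [smul_sub, smul_smul, hμν, one_smul, h2, hk, add_smul]
        abel
      rw [e1]
      change ν • R (S ((w + c) • (ν • k - R k))) = f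
      rw [map_smul, hS2, map_smul, smul_smul, mul_comm, hμν, one_smul, h2]

end BoundedPotential


/-! ### Local compactness and the Schur criterion for properness. -/

section Criteria

variable {E : Type*} [NormedAddCommGroup E] [InnerProductSpace ℝ E] [FiniteDimensional ℝ E]
  [MeasurableSpace E] [BorelSpace E] {U : E → ℝ} {C : ℝ}

theorem memLp_resG_sub (hd : Module.finrank ℝ E < 4) {κ : ℝ} (hκ : 0 < κ) (x : E) :
    MemLp (fun y : E => (resG κ (x - y) : ℂ)) 2 := by
  have hm : Measurable fun y : E => (resG κ (x - y) : ℂ) :=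
    Complex.measurable_ofReal.comp ((measurable_resG κ).comp (measurable_const.sub measurable_id))
  refine ⟨hm.aestronglyMeasurable, ?_⟩
  have h1 : eLpNorm (fun y : E => (resG κ (x - y) : ℂ)) 2 volume ^ 2 < ∞ := by
    rw [eLpNorm_two_sq]
    refine lt_of_le_of_lt (lintegral_mono fun y => pow_le_pow_left' (enorm_resG_le κ (x - y)) 2) ?_
    rw [lintegral_sub_left_eq_self (fun y => resK κ y ^ 2) x]
    exact lintegral_resK_sq_lt_top hd hκ
  exact (ENNReal.pow_lt_top_iff.1 h1).resolve_right (by norm_num)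

theorem resConv_eq_inner (hd : Module.finrank ℝ E < 4) {κ : ℝ} (hκ : 0 < κ) (x : E) (f : L2 E) :
    resConv κ f x = inner ℂ (memLp_resG_sub hd hκ x).toLp f := by
  rw [L2.inner_def, resConv]
  refine integral_congr_ae ?_
  filter_upwards [(memLp_resG_sub hd hκ x).coeFn_toLp] with y hy
  rw [hy, RCLike.inner_apply, Complex.conj_ofReal, mul_comm]

/-- The value at a point is an inner product with a square integrable kernel, whose norm does not
depend on the point by translation invariance. -/
theorem exists_enorm_resConv_le (hd : Module.finrank ℝ E < 4) {κ : ℝ} (hκ : 0 < κ) :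
    ∃ B : ℝ, 0 ≤ B ∧ ∀ (x : E) (f : L2 E), ‖resConv κ f x‖ ≤ B * ‖f‖ := by
  refine ⟨‖(memLp_resG_sub hd hκ (0 : E)).toLp‖, norm_nonneg _, fun x f => ?_⟩
  rw [resConv_eq_inner hd hκ]
  refine (norm_inner_le_norm _ _).trans_eq ?_
  congr 1
  rw [Lp.norm_toLp, Lp.norm_toLp]
  congr 1
  have h : eLpNorm (fun y : E => (resG κ (x - y) : ℂ)) 2 volume ^ 2 =
      eLpNorm (fun y : E => (resG κ (0 - y) : ℂ)) 2 volume ^ 2 := by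
    rw [eLpNorm_two_sq, eLpNorm_two_sq,
      lintegral_sub_left_eq_self (fun y : E => ‖(resG κ y : ℂ)‖ₑ ^ 2),
      lintegral_sub_left_eq_self (fun y : E => ‖(resG κ y : ℂ)‖ₑ ^ 2)]
  exact le_antisymm ((ENNReal.pow_le_pow_left_iff two_ne_zero).1 h.le)
    ((ENNReal.pow_le_pow_left_iff two_ne_zero).1 h.ge)

theorem enorm_L2_sq (f : L2 E) : ‖f‖ₑ ^ 2 = ∫⁻ x, ‖f x‖ₑ ^ 2 := by
  rw [← eLpNorm_two_sq, Lp.enorm_def]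

theorem tendsto_L2_zero_iff {f : ℕ → L2 E} :
    Tendsto f atTop (𝓝 0) ↔ Tendsto (fun n => ∫⁻ x, ‖f n x‖ₑ ^ 2) atTop (𝓝 0) := by
  simp_rw [← enorm_L2_sq]
  rw [tendsto_zero_iff_enorm_tendsto_zero]
  constructor
  · intro h
    simpa using ENNReal.Tendsto.pow (n := 2) h
  · intro h
    have := ((ENNReal.continuous_rpow_const (y := 1 / 2)).tendsto 0).comp h
    rw [ENNReal.zero_rpow_of_pos (by norm_num)] at this
    refine this.congr fun n => ?_
    rw [Function.comp_apply, ← ENNReal.rpow_natCast, ← ENNReal.rpow_mul]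
    norm_num

/-- Weak convergence gives pointwise convergence of the convolutions, and the uniform bound is
integrable on a set of finite measure. This plays the role of Rellich's theorem. -/
theorem tendsto_setLIntegral_resConv (hd : Module.finrank ℝ E < 4) {κ : ℝ} (hκ : 0 < κ)
    {D : Set E} (hD : volume D < ∞) {f : ℕ → L2 E} (hf : WeaklyNull f) {A : ℝ}
    (hA : ∀ n, ‖f n‖ ≤ A) :
    Tendsto (fun n => ∫⁻ x in D, ‖resConv κ (f n) x‖ₑ ^ 2) atTop (𝓝 0) := by
  obtain ⟨B, hB, hbound⟩ := exists_enorm_resConv_le (E := E) hd hκ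
  have h := tendsto_lintegral_of_dominated_convergence' (μ := volume.restrict D)
    (F := fun n x => ‖resConv κ (f n) x‖ₑ ^ 2) (f := fun _ => 0)
    (fun _ => ENNReal.ofReal (B * A) ^ 2)
    (fun n => ((aestronglyMeasurable_resG_mul κ (Lp.memLp (f n)).1).integral_prod_right'.enorm.pow_const
      2).restrict) (fun n => ae_of_all _ fun x => ?_) ?_ (ae_of_all _ fun x => ?_)
  · simpa using h
  · simp only
    rw [← ofReal_norm]
    gcongr
    exact (hbound x (f n)).trans (mul_le_mul_of_nonneg_left (hA n) hB)
  · rw [lintegral_const]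
    refine (ENNReal.mul_lt_top (ENNReal.pow_lt_top ENNReal.ofReal_lt_top) ?_).ne
    rwa [Measure.restrict_apply_univ]
  · simp_rw [resConv_eq_inner hd hκ]
    have h1 := (hf (memLp_resG_sub hd hκ x).toLp).enorm
    simpa using ENNReal.Tendsto.pow (n := 2) h1

theorem lintegral_withDensity_potential (hU : BddPotential U C) {F : E → ℝ≥0∞}
    (hF : AEMeasurable F) :
    ∫⁻ y, F y ∂(volume.withDensity fun y => ENNReal.ofReal (U y)) =
      ∫⁻ y, ENNReal.ofReal (U y) * F y :=
  lintegral_withDensity_eq_lintegral_mul₀ hU.meas.ennreal_ofReal.aemeasurable hF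

theorem enorm_potential (hU : BddPotential U C) (y : E) :
    ‖(U y : ℂ)‖ₑ = ENNReal.ofReal (U y) := by
  rw [← ofReal_norm, Complex.norm_real, Real.norm_of_nonneg (hU.nonneg y)]

theorem le_of_le_mul_add {x e : ℝ≥0∞} {q : ℝ≥0∞} (hq : q < 1) (hx : x ≠ ∞) (h : x ≤ q * x + e) :
    x ≤ (1 - q)⁻¹ * e := by
  have hq1 : 1 - q ≠ 0 := (tsub_pos_of_lt hq).ne'
  have hq2 : 1 - q ≠ ∞ := ne_top_of_le_ne_top ENNReal.one_ne_top tsub_le_self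
  rw [← ENNReal.mul_le_iff_le_inv hq1 hq2]
  have h1 : (1 - q) * x + q * x = x := by
    rw [← add_mul, tsub_add_cancel_of_le hq.le, one_mul]
  have h2 : q * x ≠ ∞ := ENNReal.mul_ne_top (ne_top_of_lt hq) hx
  refine (ENNReal.add_le_add_iff_right h2).1 ?_
  rw [h1, add_comm]
  exact h

/-- The Schur-type criterion for the convergence of weakly null approximate solutions. -/
theorem tendsto_zero_of_schur (hd : Module.finrank ℝ E < 4) (hU : BddPotential U C) {κ : ℝ}
    (hκ : 0 < κ) {D : Set E} (hD : MeasurableSet D) (hDv : volume D < ∞) {w : E → ℝ≥0∞}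
    (hw : Measurable w) (hw0 : ∀ y, w y ≠ 0) (hwt : ∀ y, w y ≠ ∞) {q : ℝ≥0∞} (hq : q < 1)
    (hschur : ∀ᵐ y ∂(volume.withDensity fun y => ENNReal.ofReal (Dᶜ.indicator U y)),
      ∫⁻ y', resK κ (y - y') * w y'
        ∂(volume.withDensity fun y => ENNReal.ofReal (Dᶜ.indicator U y)) ≤ q * w y)
    {v g : ℕ → L2 E} (hv : WeaklyNull v) {A : ℝ} (hA : ∀ n, ‖v n‖ ≤ A)
    (hg : Tendsto g atTop (𝓝 0)) (heq : ∀ n, v n = freeRes κ hκ (mulCLM hU (v n) + g n)) :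
    Tendsto v atTop (𝓝 0) := by
  have hU1 := hU.indicator hD
  have hU2 := hU.indicator hD.compl
  set μ := (volume : Measure E).withDensity fun y => ENNReal.ofReal (Dᶜ.indicator U y) with hμ
  have hsplit : ∀ f : L2 E, mulCLM hU f = mulCLM hU1 f + mulCLM hU2 f := by
    intro f
    apply Lp.ext
    filter_upwards [coeFn_mulCLM hU f, coeFn_mulCLM hU1 f, coeFn_mulCLM hU2 f,
      Lp.coeFn_add (mulCLM hU1 f) (mulCLM hU2 f)] with x h0 h1 h2 h3
    rw [h0, h3, Pi.add_apply, h1, h2, ← add_mul, ← Complex.ofReal_add,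
      ← Pi.add_apply (D.indicator U), Set.indicator_self_add_compl]
  -- the part in `D`
  have hstep1 : Tendsto (fun n => mulCLM hU1 (v n)) atTop (𝓝 0) := by
    have h1 : ∀ n, mulCLM hU1 (v n) = mulCLM hU1 (freeRes κ hκ (mulCLM hU (v n))) +
        mulCLM hU1 (freeRes κ hκ (g n)) := fun n => by
      rw [← map_add, ← map_add, ← heq]
    have h2 : Tendsto (fun n => mulCLM hU1 (freeRes κ hκ (g n))) atTop (𝓝 0) := by
      have := (((mulCLM hU1).comp (freeRes κ hκ)).continuous.tendsto 0).comp hg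
      simpa [Function.comp_def] using this
    have h3 : Tendsto (fun n => mulCLM hU1 (freeRes κ hκ (mulCLM hU (v n)))) atTop (𝓝 0) := by
      rw [tendsto_L2_zero_iff]
      have h4 := tendsto_setLIntegral_resConv hd hκ hDv (hv.map (mulCLM hU)) (A := C * A)
        (fun n => ((mulCLM hU).le_of_opNorm_le (norm_mulCLM_le hU) _).trans
          (mul_le_mul_of_nonneg_left (hA n) hU.const_nonneg))
      have h5 := ENNReal.Tendsto.const_mul (a := ENNReal.ofReal C ^ 2) h4
        (Or.inr (ENNReal.pow_ne_top ENNReal.ofReal_ne_top))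
      rw [mul_zero] at h5
      refine tendsto_of_tendsto_of_tendsto_of_le_of_le tendsto_const_nhds h5
        (fun n => zero_le) fun n => ?_
      rw [← lintegral_const_mul' _ _ (ENNReal.pow_ne_top ENNReal.ofReal_ne_top),
        ← lintegral_indicator hD]
      refine lintegral_mono_ae ?_
      filter_upwards [coeFn_mulCLM hU1 (freeRes κ hκ (mulCLM hU (v n))),
        coeFn_freeRes hκ (mulCLM hU (v n))] with x hx1 hx2
      rw [hx1, hx2]
      by_cases hx : x ∈ D
      · rw [Set.indicator_of_mem hx, Set.indicator_of_mem hx, enorm_mul, mul_pow]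
        gcongr
        rw [enorm_potential hU]
        exact ENNReal.ofReal_le_ofReal (hU.le x)
      · rw [Set.indicator_of_notMem hx]
        simp
    simp_rw [h1]
    simpa using h3.add h2
  set g' : ℕ → L2 E := fun n => mulCLM hU1 (v n) + g n with hg'
  have hg'0 : Tendsto g' atTop (𝓝 0) := by simpa using hstep1.add hg
  have heq' : ∀ n, v n = freeRes κ hκ (mulCLM hU2 (v n)) + freeRes κ hκ (g' n) := fun n => by
    conv_lhs => rw [heq n, hsplit]
    rw [← map_add]
    exact congrArg _ (by simp only [hg']; abel)
  have hRg : Tendsto (fun n => freeRes κ hκ (g' n)) atTop (𝓝 0) := by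
    simpa [Function.comp_def] using ((freeRes κ hκ).continuous.tendsto 0).comp hg'0
  have hmv : ∀ f : L2 E, AEMeasurable (fun y => ‖f y‖ₑ) := fun f => (Lp.memLp f).1.enorm
  have hac : μ ≪ volume := withDensity_absolutelyContinuous _ _
  have hden : ∀ F : E → ℝ≥0∞, ∫⁻ y, F y ∂μ ≤ ENNReal.ofReal C * ∫⁻ y, F y := by
    intro F
    have : μ ≤ ENNReal.ofReal C • (volume : Measure E) := by
      rw [← withDensity_const]
      exact withDensity_mono (ae_of_all _ fun y => ENNReal.ofReal_le_ofReal (hU2.le y))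
    refine (lintegral_mono' this le_rfl).trans_eq ?_
    rw [lintegral_smul_measure, smul_eq_mul]
  -- the estimate in `L²(μ)`
  set N : ℕ → ℝ≥0∞ := fun n => (∫⁻ y, ‖v n y‖ₑ ^ (2 : ℝ) ∂μ) ^ (1 / 2 : ℝ) with hN
  set e : ℕ → ℝ≥0∞ := fun n => (∫⁻ y, ‖freeRes κ hκ (g' n) y‖ₑ ^ (2 : ℝ) ∂μ) ^ (1 / 2 : ℝ) with he
  -- Minkowski in `L²(μ)`: the Schur test bounds the convolution part by the factor `q`, and `e n`
  -- is the norm of the vanishing remainder.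
  have hNe : ∀ n, N n ≤ q * N n + e n := by
    intro n
    have hm1 : AEMeasurable (fun y : E => ∫⁻ y', resK κ (y - y') * ‖v n y'‖ₑ ∂μ) μ := by
      refine AEMeasurable.mono_ac ?_ hac
      refine AEMeasurable.lintegral_prod_right'
        (f := fun p : E × E => resK κ (p.1 - p.2) * ‖v n p.2‖ₑ) ?_
      refine ((measurable_resK κ).comp (measurable_fst.sub measurable_snd)).aemeasurable.mul ?_
      exact ((hmv (v n)).mono_ac hac).comp_quasiMeasurePreserving
        Measure.quasiMeasurePreserving_snd
    have hm2 : AEMeasurable (fun y : E => ‖freeRes κ hκ (g' n) y‖ₑ) μ := (hmv _).mono_ac hac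
    have h1 : ∀ᵐ y ∂μ, ‖v n y‖ₑ ≤ (∫⁻ y', resK κ (y - y') * ‖v n y'‖ₑ ∂μ) +
        ‖freeRes κ hκ (g' n) y‖ₑ := by
      refine hac.ae_le ?_
      filter_upwards [Lp.coeFn_add (freeRes κ hκ (mulCLM hU2 (v n))) (freeRes κ hκ (g' n)),
        coeFn_freeRes hκ (mulCLM hU2 (v n))] with y hy1 hy2
      have hy3 : v n y = resConv κ (mulCLM hU2 (v n)) y + freeRes κ hκ (g' n) y := by
        conv_lhs => rw [heq' n]
        rw [hy1, Pi.add_apply, hy2]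
      rw [hy3]
      refine (enorm_add_le _ _).trans (add_le_add ?_ le_rfl)
      refine (enorm_resConv_le κ _ y).trans_eq ?_
      have hmk : AEMeasurable (fun y' : E => resK κ (y - y') * ‖v n y'‖ₑ) :=
        ((measurable_resK κ).comp (measurable_const.sub measurable_id)).aemeasurable.mul (hmv _)
      rw [hμ, lintegral_withDensity_potential hU2 hmk]
      refine lintegral_congr_ae ?_
      filter_upwards [coeFn_mulCLM hU2 (v n)] with y' hy'
      rw [hy', enorm_mul, enorm_potential hU2]
      ring
    have h2 : N n ≤ (∫⁻ y, ((∫⁻ y', resK κ (y - y') * ‖v n y'‖ₑ ∂μ) +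
        ‖freeRes κ hκ (g' n) y‖ₑ) ^ (2 : ℝ) ∂μ) ^ (1 / 2 : ℝ) := by
      refine ENNReal.rpow_le_rpow (lintegral_mono_ae ?_) (by norm_num)
      filter_upwards [h1] with y hy
      exact ENNReal.rpow_le_rpow hy (by norm_num)
    refine h2.trans ((ENNReal.lintegral_Lp_add_le hm1 hm2 (by norm_num)).trans ?_)
    refine add_le_add ?_ le_rfl
    have h3 := lintegral_sq_lintegral_le_of_schur (μ := μ) (k := fun x y => resK κ (x - y))
      ((measurable_resK κ).comp (measurable_fst.sub measurable_snd)) (resK_sub_comm κ)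
      hw (ae_of_all _ hw0) (ae_of_all _ hwt) hschur ((hmv (v n)).mono_ac hac)
    have h4 := ENNReal.rpow_le_rpow h3 (show (0 : ℝ) ≤ 1 / 2 by norm_num)
    rw [ENNReal.mul_rpow_of_nonneg _ _ (by norm_num), ← ENNReal.rpow_natCast,
      ← ENNReal.rpow_mul] at h4
    simp only [← ENNReal.rpow_natCast] at h4
    norm_num at h4
    simpa [hN] using h4
  -- Finiteness is what allows `q * N n` to be absorbed on the left.
  have hNfin : ∀ n, N n ≠ ∞ := by
    intro n
    refine ENNReal.rpow_ne_top_of_nonneg (by norm_num) ?_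
    refine ((hden _).trans_lt (ENNReal.mul_lt_top ENNReal.ofReal_lt_top ?_)).ne
    simpa using lintegral_enorm_sq_lt_top (Lp.memLp (v n))
  have he0 : Tendsto (fun n => ∫⁻ y, ‖freeRes κ hκ (g' n) y‖ₑ ^ (2 : ℝ) ∂μ) atTop (𝓝 0) := by
    have h1 := tendsto_L2_zero_iff.1 hRg
    have h2 := ENNReal.Tendsto.const_mul (a := ENNReal.ofReal C) h1 (Or.inr ENNReal.ofReal_ne_top)
    rw [mul_zero] at h2
    refine tendsto_of_tendsto_of_tendsto_of_le_of_le tendsto_const_nhds h2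
      (fun n => zero_le) fun n => ?_
    simpa using hden fun y => ‖freeRes κ hκ (g' n) y‖ₑ ^ (2 : ℝ)
  have hN0 : Tendsto (fun n => ∫⁻ y, ‖v n y‖ₑ ^ (2 : ℝ) ∂μ) atTop (𝓝 0) := by
    have hq1 : 1 - q ≠ 0 := (tsub_pos_of_lt hq).ne'
    have h1 := ENNReal.Tendsto.const_mul (a := ((1 - q)⁻¹) ^ (2 : ℝ)) he0
      (Or.inr (ENNReal.rpow_ne_top_of_nonneg (by norm_num) (ENNReal.inv_ne_top.2 hq1)))
    rw [mul_zero] at h1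
    refine tendsto_of_tendsto_of_tendsto_of_le_of_le tendsto_const_nhds h1
      (fun n => zero_le) fun n => ?_
    have h2 := ENNReal.rpow_le_rpow (le_of_le_mul_add hq (hNfin n) (hNe n))
      (show (0 : ℝ) ≤ 2 by norm_num)
    rw [ENNReal.mul_rpow_of_nonneg _ _ (by norm_num), hN, he, ← ENNReal.rpow_mul,
      ← ENNReal.rpow_mul] at h2
    norm_num at h2
    simpa using h2
  have hstep2 : Tendsto (fun n => mulCLM hU2 (v n)) atTop (𝓝 0) := by
    rw [tendsto_L2_zero_iff]
    have h1 := ENNReal.Tendsto.const_mul (a := ENNReal.ofReal C) hN0 (Or.inr ENNReal.ofReal_ne_top)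
    rw [mul_zero] at h1
    refine tendsto_of_tendsto_of_tendsto_of_le_of_le tendsto_const_nhds h1
      (fun n => zero_le) fun n => ?_
    have hmk : AEMeasurable (fun y : E => ‖v n y‖ₑ ^ (2 : ℝ)) := (hmv _).pow_const _
    simp only
    rw [hμ, lintegral_withDensity_potential hU2 hmk,
      ← lintegral_const_mul' _ _ ENNReal.ofReal_ne_top]
    refine lintegral_mono_ae ?_
    filter_upwards [coeFn_mulCLM hU2 (v n)] with y hy
    rw [hy, enorm_mul, mul_pow, enorm_potential hU2, sq, mul_assoc, ENNReal.rpow_ofNat]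
    gcongr
    exact hU2.le y
  have h := (((freeRes κ hκ).continuous.tendsto 0).comp hstep2).add hRg
  rw [map_zero, add_zero] at h
  refine h.congr fun n => ?_
  exact (heq' n).symm

end Criteria


/-! ### Spectrum below the threshold from a trial function. -/

section Existence

variable {E : Type*} [NormedAddCommGroup E] [InnerProductSpace ℝ E] [FiniteDimensional ℝ E]
  [MeasurableSpace E] [BorelSpace E] {U : E → ℝ} {C : ℝ}

theorem ofReal_re_inner_le {κ : ℝ} (hκ : 0 < κ) {F : E → ℝ} (hF : Measurable F)
    (hF0 : ∀ y, 0 ≤ F y) {f : L2 E} (hf : (f : E → ℂ) =ᵐ[volume] fun y => (F y : ℂ)) :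
    ENNReal.ofReal (inner ℂ f (freeRes κ hκ f)).re =
      ∫⁻ y, ∫⁻ y', ENNReal.ofReal (F y) * (resK κ (y - y') * ENNReal.ofReal (F y')) := by
  have hFm : MemLp (fun y => (F y : ℂ)) 2 (volume : Measure E) := (Lp.memLp f).ae_eq hf
  have hI := integrable_prod_resG hκ hFm hFm
  have h1 : inner ℂ f (freeRes κ hκ f) =
      ∫ p : E × E, (F p.1 : ℂ) * ((resG κ (p.1 - p.2) : ℂ) * (F p.2 : ℂ)) := by
    rw [Measure.volume_eq_prod, integral_prod _ hI, L2.inner_def]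
    refine integral_congr_ae ?_
    filter_upwards [hf, coeFn_freeRes hκ f] with y hy1 hy2
    rw [hy1, hy2, resConv_congr κ hf, RCLike.inner_apply, Complex.conj_ofReal, resConv,
      integral_const_mul, mul_comm]
  have h2 : (inner ℂ f (freeRes κ hκ f)).re =
      ∫ p : E × E, F p.1 * (resG κ (p.1 - p.2) * F p.2) := by
    rw [h1]
    simp only [← Complex.ofReal_mul]
    rw [integral_complex_ofReal, Complex.ofReal_re]
  have hm : Measurable fun p : E × E => F p.1 * (resG κ (p.1 - p.2) * F p.2) :=
    (hF.comp measurable_fst).mul (((measurable_resG κ).comp (measurable_fst.sub measurable_snd)).mul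
      (hF.comp measurable_snd))
  have hI' : Integrable fun p : E × E => F p.1 * (resG κ (p.1 - p.2) * F p.2) := by
    have := hI.re
    rw [← Measure.volume_eq_prod] at this
    refine this.congr (ae_of_all _ fun p => ?_)
    simp only [← Complex.ofReal_mul]
    rfl
  rw [h2, ofReal_integral_eq_lintegral_ofReal hI' (ae_of_all _ fun p =>
    mul_nonneg (hF0 _) (mul_nonneg (resG_nonneg _ _) (hF0 _))), Measure.volume_eq_prod,
    lintegral_prod _ hm.ennreal_ofReal.aemeasurable]
  refine lintegral_congr fun y => lintegral_congr_ae ?_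
  have hfin : ∀ᵐ y' : E, resK κ (y - y') < ∞ := by
    have := (Measure.measurePreserving_sub_left (volume : Measure E) y).quasiMeasurePreserving.ae
      (ae_resK_lt_top (E := E) hκ)
    exact this
  filter_upwards [hfin] with y' hy'
  rw [ENNReal.ofReal_mul (hF0 y), ENNReal.ofReal_mul (resG_nonneg _ _), ofReal_resG hy']

/-- For `ψ = G_κ Uη` one has `(ψ, (H + κ²)ψ) = (ψ, Uη) - (Uψ, ψ)`, and expanding `(U(ψ - η), ψ - η)
≥ 0` bounds this by `(Uη, η) - (Uη, ψ)`, which is negative. -/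
theorem exists_hamil_lt (hU : BddPotential U C) {κ : ℝ} (hκ : 0 < κ) {η : E → ℝ}
    (hη : Measurable η) (hη0 : ∀ y, 0 ≤ η y) (hη2 : MemLp (fun y => (η y : ℂ)) 2 volume)
    (h : ∫⁻ y, ENNReal.ofReal (U y * η y ^ 2) < ∫⁻ y, ∫⁻ y', ENNReal.ofReal (U y * η y) *
      (resK κ (y - y') * ENNReal.ofReal (U y' * η y'))) :
    ∃ f : sobolevH2 E, (inner ℂ (hamil hU f) (f : L2 E)).re < -κ ^ 2 * ‖(f : L2 E)‖ ^ 2 := by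
  set e : L2 E := hη2.toLp with he
  set g : L2 E := mulCLM hU e with hg
  have hgF : (g : E → ℂ) =ᵐ[volume] fun y => ((U y * η y : ℝ) : ℂ) := by
    filter_upwards [coeFn_mulCLM hU e, hη2.coeFn_toLp] with y h1 h2
    rw [hg, h1, he, h2, Complex.ofReal_mul]
  have hB := ofReal_re_inner_le hκ (F := fun y => U y * η y) (hU.meas.mul hη)
    (fun y => mul_nonneg (hU.nonneg y) (hη0 y)) hgF
  rw [← hB] at h
  set ψ : L2 E := freeRes κ hκ g with hψ
  have hA : ENNReal.ofReal (inner ℂ e g).re = ∫⁻ y, ENNReal.ofReal (U y * η y ^ 2) := by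
    have h1 : (inner ℂ e g).re = ∫ y, U y * η y ^ 2 := by
      rw [L2.inner_def]
      have : ∫ y, inner ℂ (e y) (g y) = ∫ y, ((U y * η y ^ 2 : ℝ) : ℂ) := by
        refine integral_congr_ae ?_
        filter_upwards [hgF, hη2.coeFn_toLp] with y h1 h2
        rw [h1, he, h2, RCLike.inner_apply, Complex.conj_ofReal]
        push_cast
        ring
      rw [this, integral_complex_ofReal, Complex.ofReal_re]
    rw [h1, ofReal_integral_eq_lintegral_ofReal]
    · have h2 := (L2.integrable_inner (𝕜 := ℂ) e g).re
      refine h2.congr ?_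
      filter_upwards [hgF, hη2.coeFn_toLp] with y h1 h2
      rw [h1, he, h2, RCLike.inner_apply, Complex.conj_ofReal, ← Complex.ofReal_mul]
      change U y * η y * η y = _
      ring
    · exact ae_of_all _ fun y => mul_nonneg (hU.nonneg y) (sq_nonneg _)
  rw [← hA] at h
  have hlt : (inner ℂ e g).re < (inner ℂ g ψ).re := (ENNReal.ofReal_lt_ofReal_iff'.1 h).1
  refine ⟨⟨ψ, freeRes_mem hκ g⟩, ?_⟩
  have hlap := laplacianL2_freeRes hκ g
  have hpos := re_inner_mulCLM_nonneg hU (ψ - e)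
  have h1 : inner ℂ (mulCLM hU (ψ - e)) (ψ - e) =
      inner ℂ (mulCLM hU ψ) ψ - inner ℂ ψ g - inner ℂ g ψ + inner ℂ e g := by
    rw [map_sub, inner_sub_left, inner_sub_right, inner_sub_right, inner_mulCLM hU ψ e, ← hg,
      hg, inner_mulCLM hU e e]
    ring
  have h2 : (inner ℂ ψ g).re = (inner ℂ g ψ).re := by rw [← inner_conj_symm, Complex.conj_re]
  rw [h1] at hpos
  simp only [Complex.add_re, Complex.sub_re, h2] at hpos
  have h3 : hamil hU ⟨ψ, freeRes_mem hκ g⟩ = g - mulCLM hU ψ - ((κ ^ 2 : ℝ) : ℂ) • ψ := by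
    rw [hamil, hlap]; abel
  have h4 : (inner ℂ ψ ψ).re = ‖ψ‖ ^ 2 := by
    rw [inner_self_eq_norm_sq_to_K]
    change (((‖ψ‖ : ℝ) : ℂ) ^ 2).re = _
    rw [← Complex.ofReal_pow, Complex.ofReal_re]
  rw [h3, inner_sub_left, inner_sub_left, inner_smul_left, Complex.conj_ofReal, Complex.sub_re,
    Complex.sub_re, Complex.re_ofReal_mul, h4]
  simp only
  linarith

/-- A criterion for the existence of discrete spectrum below `-κ₀²`. -/
theorem discSpec_nonempty_of_schur (hd : Module.finrank ℝ E < 4) (hU : BddPotential U C)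
    {W : E → ℝ} (hWU : W =ᵐ[volume] U) {κ₀ : ℝ} (hκ₀ : 0 < κ₀)
    {η : E → ℝ} (hη : Measurable η) (hη0 : ∀ y, 0 ≤ η y)
    (hη2 : MemLp (fun y => (η y : ℂ)) 2 volume)
    (hlt : ∫⁻ y, ENNReal.ofReal (U y * η y ^ 2) < ∫⁻ y, ∫⁻ y', ENNReal.ofReal (U y * η y) *
      (resK κ₀ (y - y') * ENNReal.ofReal (U y' * η y')))
    (hschur : ∀ κ, κ₀ < κ → ∃ D : Set E, MeasurableSet D ∧ volume D < ∞ ∧ ∃ w : E → ℝ≥0∞,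
      Measurable w ∧ (∀ y, w y ≠ 0) ∧ (∀ y, w y ≠ ∞) ∧ ∃ q < 1,
      ∀ᵐ y ∂(volume.withDensity fun y => ENNReal.ofReal (Dᶜ.indicator U y)),
        ∫⁻ y', resK κ (y - y') * w y'
          ∂(volume.withDensity fun y => ENNReal.ofReal (Dᶜ.indicator U y)) ≤ q * w y) :
    (discSpec (schrodinger W)).Nonempty := by
  -- The shift must exceed `C` for the resolvent to exist and `κ₀²` for `(c - κ₀²)⁻¹` to be
  -- positive.
  set c : ℝ := C + 1 + κ₀ ^ 2 with hc
  have hcC : C < c := by have := sq_nonneg κ₀; linarith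
  obtain ⟨R, hR, hright, hleft, hsymm, hpos⟩ := exists_resolvent hU hcC
  have hC := hU.const_nonneg
  have ha : 0 < c - κ₀ ^ 2 := by rw [hc]; linarith
  -- With `R h = f` the test vector gives `(Rh, h) < (c - κ₀²)‖Rh‖²`; combined with `‖Rh‖² ≤ ‖R‖
  -- (Rh, h)` this bounds the norm from below.
  have hnorm : (c - κ₀ ^ 2)⁻¹ < ‖R‖ := by
    obtain ⟨f, hf⟩ := exists_hamil_lt hU hκ₀ hη hη0 hη2 hlt
    set h := hamil hU f + (c : ℂ) • (f : L2 E) with hh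
    have h1 : R h = f := hleft f
    have h2 := norm_sq_le_of_positive hsymm hpos h
    have h4 : (inner ℂ (f : L2 E) (f : L2 E)).re = ‖(f : L2 E)‖ ^ 2 := by
      rw [inner_self_eq_norm_sq_to_K]
      change (((‖(f : L2 E)‖ : ℝ) : ℂ) ^ 2).re = _
      rw [← Complex.ofReal_pow, Complex.ofReal_re]
    have h3 : (inner ℂ (R h) h).re < (c - κ₀ ^ 2) * ‖R h‖ ^ 2 := by
      rw [hsymm, h1, hh, inner_add_left, inner_smul_left, Complex.conj_ofReal, Complex.add_re,
        Complex.re_ofReal_mul, h4]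
      linarith
    have h5 : 0 < ‖R h‖ ^ 2 := by
      by_contra hcon
      have : ‖R h‖ ^ 2 = 0 := le_antisymm (not_lt.1 hcon) (sq_nonneg _)
      rw [this, mul_zero] at h3
      exact absurd h3 (not_lt.2 (hpos h))
    rw [inv_lt_iff_one_lt_mul₀ ha]
    by_contra hcon
    push Not at hcon
    have h6 : ‖R‖ * (inner ℂ (R h) h).re ≤ ‖R‖ * ((c - κ₀ ^ 2) * ‖R h‖ ^ 2) := by gcongr
    rcases (norm_nonneg R).eq_or_lt with h0 | h0
    · rw [← h0, zero_mul] at h2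
      linarith
    · have h7 : ‖R‖ * (inner ℂ (R h) h).re < ‖R‖ * ((c - κ₀ ^ 2) * ‖R h‖ ^ 2) := by gcongr
      nlinarith
  have hn : 0 < ‖R‖ := (inv_pos.2 ha).trans hnorm
  refine discSpec_nonempty_of_resolvent hU hWU hR hright hleft hsymm hpos hn ?_
  rintro x hx ⟨A, hA⟩ hlim
  set l := ‖R‖ with hl
  have hlC : (l : ℂ) ≠ 0 := by exact_mod_cast hn.ne'
  have hκ2 : κ₀ ^ 2 < c - l⁻¹ := by
    have := (inv_lt_comm₀ ha hn).1 hnorm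
    linarith
  -- `-κ² = l⁻¹ - c` is the candidate eigenvalue of `H`; the norm bound puts it strictly below
  -- `-κ₀²`.
  set κ := √(c - l⁻¹) with hκdef
  have hκ2' : κ ^ 2 = c - l⁻¹ := Real.sq_sqrt ((sq_nonneg _).trans hκ2.le)
  have hκκ : κ₀ < κ := Real.lt_sqrt_of_sq_lt hκ2
  have hκ : 0 < κ := hκ₀.trans hκκ
  obtain ⟨D, hD, hDv, w, hw, hw0, hwt, q, hq, hs⟩ := hschur κ hκκ
  -- For `v = R x` the equation `(H + c)v = x` reads `(-Δ + κ²)v = Uv + l⁻¹(l x - R x)`, the form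
  -- required by the Schur criterion. Afterwards `x` itself is recovered from `l x - R x` and `R x`.
  have hv : Tendsto (fun n => R (x n)) atTop (𝓝 0) := by
    refine tendsto_zero_of_schur hd hU hκ hD hDv hw hw0 hwt hq hs (hx.map R) (A := l * A)
      (g := fun n => (l : ℂ)⁻¹ • ((l : ℂ) • x n - R (x n)))
      (fun n => (R.le_opNorm _).trans (by gcongr; exact hA n)) ?_ fun n => ?_
    · simpa using hlim.const_smul (l : ℂ)⁻¹
    · have h1 := freeRes_helmholtz hκ ⟨R (x n), hR _⟩
      have h2 := hright (x n)
      rw [hamil] at h2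
      conv_lhs => rw [← show freeRes κ hκ _ = R (x n) from h1]
      congr 1
      simp only at h2 ⊢
      rw [smul_sub, smul_smul, inv_mul_cancel₀ hlC, one_smul, hκ2']
      push_cast
      rw [sub_smul]
      refine sub_eq_zero.1 (Eq.trans ?_ (sub_eq_zero.2 h2))
      abel
  have h := (hlim.add hv).const_smul (l : ℂ)⁻¹
  simp only [sub_add_cancel, smul_smul, inv_mul_cancel₀ hlC, one_smul, add_zero, smul_zero] at h
  exact h

end Existence


/-! ### The transverse ground state. -/

section GroundState

variable {E : Type*} [NormedAddCommGroup E] [InnerProductSpace ℝ E] [FiniteDimensional ℝ E]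
  [MeasurableSpace E] [BorelSpace E] {U : E → ℝ} {C : ℝ}

theorem ae_ofReal_re_resConv {κ : ℝ} (hκ : 0 < κ) {F : E → ℝ} (hF0 : ∀ y, 0 ≤ F y)
    (hF : MemLp (fun y => (F y : ℂ)) 2 volume) :
    ∀ᵐ x, ENNReal.ofReal (resConv κ (fun y => (F y : ℂ)) x).re =
      ∫⁻ y, resK κ (x - y) * ENNReal.ofReal (F y) := by
  filter_upwards [ae_integrable_resG_mul hκ hF] with x hx
  have h1 : (resConv κ (fun y => (F y : ℂ)) x).re = ∫ y, resG κ (x - y) * F y := by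
    rw [resConv]
    simp only [← Complex.ofReal_mul]
    rw [integral_complex_ofReal, Complex.ofReal_re]
  have h2 : Integrable fun y => resG κ (x - y) * F y := by
    refine hx.re.congr (ae_of_all _ fun y => ?_)
    simp only [← Complex.ofReal_mul]
    rfl
  rw [h1, ofReal_integral_eq_lintegral_ofReal h2
    (ae_of_all _ fun y => mul_nonneg (resG_nonneg _ _) (hF0 y))]
  have hfin : ∀ᵐ y : E, resK κ (x - y) < ∞ := by
    have := (Measure.measurePreserving_sub_left (volume : Measure E) x).quasiMeasurePreserving.ae
      (ae_resK_lt_top (E := E) hκ)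
    exact this
  refine lintegral_congr_ae ?_
  filter_upwards [hfin] with y hy
  rw [ENNReal.ofReal_mul (resG_nonneg _ _), ofReal_resG hy]

theorem ae_eq_lintegral_resK_of_helmholtz {κ : ℝ} (hκ : 0 < κ) {φ F : E → ℝ}
    (hF0 : ∀ y, 0 ≤ F y) {f g : L2 E} (hf : (f : E → ℂ) =ᵐ[volume] fun y => (φ y : ℂ))
    (hg : (g : E → ℂ) =ᵐ[volume] fun y => (F y : ℂ)) (hfg : freeRes κ hκ g = f) :
    ∀ᵐ x, ENNReal.ofReal (φ x) = ∫⁻ y, resK κ (x - y) * ENNReal.ofReal (F y) := by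
  have h5 := coeFn_freeRes hκ g
  rw [hfg] at h5
  have h6 := ae_ofReal_re_resConv hκ hF0 ((Lp.memLp g).ae_eq hg)
  filter_upwards [h5, h6, hf] with x a1 a2 a3
  rw [← a2, ← resConv_congr κ hg, ← a1, a3, Complex.ofReal_re]

/-- An eigenfunction of `-Δ - U` solves the integral equation of the free resolvent. -/
theorem ae_eq_lintegral_resK_of_eigen (hU : BddPotential U C) {W : E → ℝ}
    (hWU : W =ᵐ[volume] U) {φ : E → ℝ} (hφ0 : ∀ y, 0 ≤ φ y)
    {f : (schrodinger W).domain} (hf : ((f : L2 E) : E → ℂ) =ᵐ[volume] fun y => (φ y : ℂ))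
    {ε : ℝ} (heig : schrodinger W f = (ε : ℂ) • (f : L2 E)) {κ : ℝ} (hκ : 0 < κ)
    (hε : 0 ≤ ε + κ ^ 2) :
    ∀ᵐ x, ENNReal.ofReal (φ x) =
      ∫⁻ y, resK κ (x - y) * ENNReal.ofReal ((U y + (ε + κ ^ 2)) * φ y) := by
  obtain ⟨f, hfd⟩ := f
  have hfm : f ∈ sobolevH2 E := (mem_schrodinger_domain hU hWU).1 hfd
  have h1 := schrodinger_apply hU hWU hfd hfm
  rw [heig] at h1
  have h2 := freeRes_helmholtz hκ ⟨f, hfm⟩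
  generalize laplacianL2 E ⟨f, hfm⟩ = l at h1 h2
  refine ae_eq_lintegral_resK_of_helmholtz hκ
    (fun y => mul_nonneg (add_nonneg (hU.nonneg y) hε) (hφ0 y)) hf
    (g := mulCLM hU f + ((ε + κ ^ 2 : ℝ) : ℂ) • f) ?_ ?_
  · filter_upwards [Lp.coeFn_add (mulCLM hU f) (((ε + κ ^ 2 : ℝ) : ℂ) • f),
      coeFn_mulCLM hU f, Lp.coeFn_smul ((ε + κ ^ 2 : ℝ) : ℂ) f, hf]
      with y a1 a2 a3 a4
    rw [a1, Pi.add_apply, a2, a3, Pi.smul_apply, a4, smul_eq_mul]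
    push_cast
    ring
  · refine Eq.trans (congrArg _ ?_) h2
    push_cast
    rw [add_smul, h1]
    abel

/-- As `κ → 0` the Laplace integral increases to `∫ heat dt`, which diverges at infinity because
`t^{-d/2}` is not integrable there for `d ≤ 2`. -/
theorem iSup_resK_eq_top (hd : Module.finrank ℝ E ≤ 2) (x : E) :
    ⨆ n : ℕ, resK (1 / ((n : ℝ) + 1)) x = ∞ := by
  unfold resK
  have hmh : Measurable fun t : ℝ => heat t x :=
    measurable_heat.comp (measurable_const.prodMk measurable_id)
  have hmono : ∀ t : ℝ, 0 < t → Monotone fun n : ℕ => ENNReal.ofReal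
      (Real.exp (-(1 / ((n : ℝ) + 1)) ^ 2 * t) * heat t x) := by
    intro t ht m n hmn
    have := heat_nonneg ht x
    have h1 : (1 / ((n : ℝ) + 1)) ≤ 1 / ((m : ℝ) + 1) := Nat.one_div_le_one_div hmn
    have h2 : (1 / ((n : ℝ) + 1)) ^ 2 ≤ (1 / ((m : ℝ) + 1)) ^ 2 := by gcongr
    refine ENNReal.ofReal_le_ofReal (mul_le_mul_of_nonneg_right (Real.exp_le_exp.2 ?_) this)
    nlinarith
  rw [← lintegral_iSup' (fun n => Measurable.aemeasurable (by fun_prop))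
    ((ae_restrict_mem measurableSet_Ioi).mono fun t ht => hmono t ht)]
  have hsup : ∀ t ∈ Set.Ioi (0 : ℝ), ⨆ n : ℕ, ENNReal.ofReal
      (Real.exp (-(1 / ((n : ℝ) + 1)) ^ 2 * t) * heat t x) = ENNReal.ofReal (heat t x) := by
    intro t ht
    refine iSup_eq_of_tendsto (hmono t ht) (ENNReal.tendsto_ofReal ?_)
    have h1 : Tendsto (fun n : ℕ => -(1 / ((n : ℝ) + 1)) ^ 2 * t) atTop (𝓝 0) := by
      have := ((tendsto_one_div_add_atTop_nhds_zero_nat (𝕜 := ℝ)).pow 2).neg.mul_const t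
      simpa using this
    have h2 := ((Real.continuous_exp.tendsto 0).comp h1).mul_const (heat t x)
    simpa using h2
  rw [setLIntegral_congr_fun measurableSet_Ioi hsup]
  by_contra hfin
  have hfinite : IntegrableOn (fun t : ℝ => heat t x) (Set.Ioi 0) := by
    refine ⟨hmh.aestronglyMeasurable, ?_⟩
    rw [hasFiniteIntegral_iff_ofReal]
    · exact lt_top_iff_ne_top.2 hfin
    · exact (ae_restrict_mem measurableSet_Ioi).mono fun t ht => heat_nonneg ht x
  refine not_integrableOn_Ioi_inv (a := 1) ?_
  have h3 := (hfinite.mono_set (Set.Ioi_subset_Ioi zero_le_one)).const_mul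
    (4 * Real.pi * Real.exp (‖x‖ ^ 2 / 4))
  refine Integrable.mono h3 measurable_inv.aestronglyMeasurable ?_
  filter_upwards [ae_restrict_mem measurableSet_Ioi] with t ht
  have ht1 : 1 < t := ht
  have ht0 : 0 < t := by linarith
  have hh := heat_nonneg ht0 x
  rw [Real.norm_of_nonneg (by positivity), Real.norm_of_nonneg (by positivity)]
  have hpow : (4 * Real.pi * t) ^ (-1 : ℝ) ≤
      (4 * Real.pi * t) ^ (-(Module.finrank ℝ E : ℝ) / 2) := by
    apply Real.rpow_le_rpow_of_exponent_le
    · have := Real.pi_gt_three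
      nlinarith
    · have : (Module.finrank ℝ E : ℝ) ≤ 2 := by exact_mod_cast hd
      linarith
  have hexp : Real.exp (-(‖x‖ ^ 2 / 4)) ≤ Real.exp (-‖x‖ ^ 2 / (4 * t)) := by
    apply Real.exp_le_exp.2
    rw [neg_div, neg_le_neg_iff]
    gcongr
    linarith
  have hheat : (4 * Real.pi * t)⁻¹ * Real.exp (-(‖x‖ ^ 2 / 4)) ≤ heat t x := by
    rw [Real.rpow_neg_one] at hpow
    exact mul_le_mul hpow hexp (Real.exp_pos _).le (by positivity)
  calc t⁻¹ = 4 * Real.pi * Real.exp (‖x‖ ^ 2 / 4) *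
        ((4 * Real.pi * t)⁻¹ * Real.exp (-(‖x‖ ^ 2 / 4))) := by
        rw [Real.exp_neg]
        have := Real.exp_pos (‖x‖ ^ 2 / 4)
        field_simp
    _ ≤ _ := by gcongr

/-- A positive eigenfunction in dimension at most two belongs to a negative eigenvalue. -/
theorem eigenvalue_neg (hd : Module.finrank ℝ E ≤ 2) (hU : BddPotential U C) {W : E → ℝ}
    (hWU : W =ᵐ[volume] U) (hU0 : ¬ U =ᵐ[volume] 0) {φ : E → ℝ} (hφm : Measurable φ)
    (hφ0 : ∀ y, 0 < φ y)
    {f : (schrodinger W).domain} (hf : ((f : L2 E) : E → ℂ) =ᵐ[volume] fun y => (φ y : ℂ))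
    {ε : ℝ} (heig : schrodinger W f = (ε : ℂ) • (f : L2 E)) : ε < 0 := by
  by_contra hε
  push Not at hε
  -- If `ε ≥ 0`, the integral equation holds for every `κ > 0`, and dropping the nonnegative term
  -- `(ε + κ²)φ` leaves this bound. At a single good point `x` the kernels increase to infinity,
  -- which forces `Uφ = 0`.
  have h1 : ∀ᵐ x, ∀ n : ℕ, ∫⁻ y, resK (1 / ((n : ℝ) + 1)) (x - y) * ENNReal.ofReal (U y * φ y) ≤
      ENNReal.ofReal (φ x) := by
    rw [ae_all_iff]
    intro n
    filter_upwards [ae_eq_lintegral_resK_of_eigen hU hWU (fun y => (hφ0 y).le) hf heig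
      (κ := 1 / ((n : ℝ) + 1)) (by positivity) (by positivity)] with x hx
    rw [hx]
    refine lintegral_mono fun y => ?_
    gcongr
    · exact (hφ0 y).le
    · have : 0 ≤ ε + (1 / ((n : ℝ) + 1)) ^ 2 := by positivity
      linarith
  obtain ⟨x, hx⟩ := h1.exists
  have hUm := hU.meas
  have h2 : ∫⁻ y, ⨆ n : ℕ, resK (1 / ((n : ℝ) + 1)) (x - y) * ENNReal.ofReal (U y * φ y) ≤
      ENNReal.ofReal (φ x) := by
    rw [lintegral_iSup]
    · exact iSup_le hx
    · intro n
      exact ((measurable_resK _).comp (measurable_const.sub measurable_id)).mul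
        (hUm.mul hφm).ennreal_ofReal
    · intro m n hmn y
      dsimp only
      gcongr
      exact resK_anti (by positivity) (Nat.one_div_le_one_div hmn) _
  simp_rw [← ENNReal.iSup_mul, iSup_resK_eq_top hd] at h2
  have h3 := ae_lt_top' (((hUm.mul hφm).ennreal_ofReal).const_mul ∞).aemeasurable
    (h2.trans_lt ENNReal.ofReal_lt_top).ne
  refine hU0 ?_
  filter_upwards [h3] with y hy
  by_contra hne
  have : 0 < U y * φ y := mul_pos (lt_of_le_of_ne (hU.nonneg y) (Ne.symm hne)) (hφ0 y)
  simp only [Pi.mul_apply] at hy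
  rw [ENNReal.top_mul (ENNReal.ofReal_pos.2 this).ne'] at hy
  exact lt_irrefl _ hy

end GroundState

/-- The transverse potential and its ground state, with regular representatives. -/
structure TransverseState (M : Set E2) (V φ : E2 → ℝ) (κ C B : ℝ) : Prop where
  pot : BddPotential V C
  supp : ∀ u, u ∉ M → V u = 0
  meas : Measurable φ
  pos : ∀ u, 0 < φ u
  le : ∀ u, φ u ≤ B
  eqn : ∀ u, ENNReal.ofReal (φ u) = ∫⁻ u', resK κ (u - u') * ENNReal.ofReal (V u' * φ u')
  ne_zero : ∫⁻ u, ENNReal.ofReal (V u * φ u) ≠ 0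
  memLp : MemLp (fun u => (φ u : ℂ)) 2 volume

/-- Almost everywhere facts are turned into pointwise ones. The potential is truncated and cut off
to `M`; the ground state is redefined as the convolution given by its own integral equation. The
equation then holds at every point, and Cauchy–Schwarz with the square integrable kernel bounds the
new representative. Negativity of the eigenvalue is special to dimension two. -/
theorem exists_transverseState {M : Set E2} {V φ₀ : E2 → ℝ} (hMo : IsOpen M)
    (hMb : Bornology.IsBounded M)
    (hV : MemLp V ∞ volume) (hVpos : ∀ᵐ u, 0 ≤ V u) (hVne : ¬ V =ᵐ[volume] 0)
    (hVsupp : Function.support V ⊆ M) (hφ : IsGroundState V φ₀) :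
    0 < √(-specBottom V) ∧ ∃ V₁ φ₁ : E2 → ℝ, ∃ C B : ℝ, V =ᵐ[volume] V₁ ∧ φ₀ =ᵐ[volume] φ₁ ∧
      TransverseState M V₁ φ₁ (√(-specBottom V)) C B := by
  obtain ⟨hφpos, f, hf, heig⟩ := hφ
  -- the representative of the potential
  set V' : E2 → ℝ := hV.1.mk V with hV'
  have hV'm : Measurable V' := hV.1.stronglyMeasurable_mk.measurable
  set C : ℝ := (eLpNorm V ∞ volume).toReal with hC
  set V₁ : E2 → ℝ := M.indicator fun u => max 0 (min C (V' u)) with hV₁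
  have hC0 : 0 ≤ C := ENNReal.toReal_nonneg
  have hbound : ∀ᵐ u, V u ≤ C := by
    have := ae_le_eLpNormEssSup (f := V) (μ := volume)
    filter_upwards [this] with u hu
    have h2 := ENNReal.toReal_mono (by rw [← eLpNorm_exponent_top]; exact hV.2.ne) hu
    rw [toReal_enorm] at h2
    exact (le_abs_self _).trans h2
  have hVV : V =ᵐ[volume] V₁ := by
    filter_upwards [hV.1.ae_eq_mk, hVpos, hbound] with u h1 h2 h3
    by_cases hu : u ∈ M
    · rw [hV₁, Set.indicator_of_mem hu, hV', ← h1, min_eq_right h3, max_eq_right h2]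
    · rw [hV₁, Set.indicator_of_notMem hu]
      by_contra hne
      exact hu (hVsupp hne)
  have hpot : BddPotential V₁ C := by
    refine ⟨(measurable_const.max (measurable_const.min hV'm)).indicator hMo.measurableSet,
      fun u => Set.indicator_nonneg (fun _ _ => le_max_left _ _) u, fun u => ?_⟩
    exact Set.indicator_apply_le' (fun _ => max_le hC0 (min_le_left _ _)) fun _ => hC0
  have hsupp : ∀ u, u ∉ M → V₁ u = 0 := fun u hu => Set.indicator_of_notMem hu _
  have hV₁ne : ¬ V₁ =ᵐ[volume] 0 := fun h => hVne (hVV.trans h)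
  -- the first representative of the ground state
  have hφae : AEStronglyMeasurable φ₀ volume := by
    have h1 : AEStronglyMeasurable (fun y => (φ₀ y : ℂ)) volume := (Lp.memLp (f : L2 E2)).1.congr hf
    exact h1.re
  set ψ : E2 → ℝ := fun u => if 0 < hφae.mk φ₀ u then hφae.mk φ₀ u else 1 with hψ
  have hmk : Measurable (hφae.mk φ₀) := hφae.stronglyMeasurable_mk.measurable
  have hψm : Measurable ψ := Measurable.ite (measurableSet_lt measurable_const hmk) hmk
    measurable_const
  have hψpos : ∀ u, 0 < ψ u := by
    intro u
    simp only [hψ]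
    split_ifs with h
    · exact h
    · exact one_pos
  have hφψ : φ₀ =ᵐ[volume] ψ := by
    filter_upwards [hφpos, hφae.ae_eq_mk] with u h1 h2
    simp only [hψ, ← h2, if_pos h1]
  have hfψ : ((f : L2 E2) : E2 → ℂ) =ᵐ[volume] fun y => (ψ y : ℂ) := by
    filter_upwards [hf, hφψ] with u h1 h2
    rw [h1, h2]
  have hε : specBottom V < 0 :=
    eigenvalue_neg (by simp) hpot hVV hV₁ne hψm hψpos hfψ heig
  have hκ : 0 < √(-specBottom V) := Real.sqrt_pos.2 (by linarith)
  refine ⟨hκ, ?_⟩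
  set κ := √(-specBottom V) with hκdef
  have hκ2 : specBottom V + κ ^ 2 = 0 := by
    rw [hκdef, Real.sq_sqrt (by linarith)]; ring
  have hae := ae_eq_lintegral_resK_of_eigen hpot hVV (fun y => (hψpos y).le) hfψ heig hκ hκ2.ge
  simp only [hκ2, add_zero] at hae
  -- the second representative
  have hψL : MemLp (fun u => (ψ u : ℂ)) 2 (volume : Measure E2) := (Lp.memLp (f : L2 E2)).ae_eq hfψ
  set g : E2 → ℝ≥0∞ := fun u => ENNReal.ofReal (V₁ u * ψ u) with hg
  have hgm : Measurable g := (hpot.meas.mul hψm).ennreal_ofReal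
  have hg2 : ∫⁻ u, g u ^ 2 < ∞ := by
    have h1 := lintegral_enorm_sq_lt_top (hpot.memLp_mul hψL)
    refine lt_of_le_of_lt (lintegral_mono fun u => ?_) h1
    rw [hg, ← Complex.ofReal_mul, ← ofReal_norm, Complex.norm_real,
      Real.norm_of_nonneg (mul_nonneg (hpot.nonneg u) (hψpos u).le)]
  set K2 : ℝ≥0∞ := (∫⁻ u : E2, resK κ u ^ 2) * ∫⁻ u, g u ^ 2 with hK2
  have hK2fin : K2 < ∞ := ENNReal.mul_lt_top (lintegral_resK_sq_lt_top (by simp) hκ) hg2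
  set Φ : E2 → ℝ≥0∞ := fun u => ∫⁻ u', resK κ (u - u') * g u' with hΦ
  have hΦ2 : ∀ u, Φ u ^ 2 ≤ K2 := by
    intro u
    have hm : Measurable fun u' : E2 => resK κ (u - u') :=
      (measurable_resK κ).comp (measurable_const.sub measurable_id)
    refine (lintegral_mul_sq_le hm.aemeasurable hgm.aemeasurable).trans_eq ?_
    rw [hK2]
    rw [lintegral_sub_left_eq_self (fun y => resK κ y ^ 2) u]
  have hΦle : ∀ u, Φ u ≤ K2 ^ (1 / 2 : ℝ) := by
    intro u
    have h1 := ENNReal.rpow_le_rpow (hΦ2 u) (show (0 : ℝ) ≤ 1 / 2 by norm_num)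
    rw [← ENNReal.rpow_natCast, ← ENNReal.rpow_mul] at h1
    norm_num at h1
    simpa using h1
  have hKfin : K2 ^ (1 / 2 : ℝ) ≠ ∞ := ENNReal.rpow_ne_top_of_nonneg (by norm_num) hK2fin.ne
  have hΦfin : ∀ u, Φ u ≠ ∞ := fun u => ne_top_of_le_ne_top hKfin (hΦle u)
  have hΦm : Measurable Φ := by
    refine Measurable.lintegral_prod_right' (f := fun p : E2 × E2 => resK κ (p.1 - p.2) * g p.2) ?_
    exact ((measurable_resK κ).comp (measurable_fst.sub measurable_snd)).mul
      (hgm.comp measurable_snd)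
  have hψΦ : ψ =ᵐ[volume] fun u => (Φ u).toReal := by
    filter_upwards [hae] with u hu
    rw [hΦ, hg]
    simp only
    rw [← hu, ENNReal.toReal_ofReal (hψpos u).le]
  have hgne : ∫⁻ u, g u ≠ 0 := by
    rw [Ne, lintegral_eq_zero_iff hgm]
    intro h
    refine hV₁ne ?_
    filter_upwards [h] with u hu
    simp only [hg, Pi.zero_apply, ENNReal.ofReal_eq_zero] at hu
    have := hpot.nonneg u
    by_contra hne
    have hlt : 0 < V₁ u := lt_of_le_of_ne this (Ne.symm hne)
    exact absurd hu (not_le.2 (mul_pos hlt (hψpos u)))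
  -- The kernel at `κ` exceeds the one at `κ + 1` by a constant on bounded sets, hence is bounded
  -- below there, and `V₁ψ` has positive mass in the bounded set `M`.
  have hΦpos : ∀ u, Φ u ≠ 0 := by
    intro u
    obtain ⟨ρ, hρ⟩ := hMb.exists_norm_le
    obtain ⟨c, hc, hcle⟩ := exists_add_le_resK (E := E2) hκ (lt_add_one κ) (‖u‖ + ρ)
    have h1 : ∫⁻ u', c * g u' ≤ Φ u := by
      refine lintegral_mono fun u' => ?_
      by_cases hu' : u' ∈ M
      · gcongr
        refine le_trans le_add_self (hcle (u - u') ?_)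
        exact (norm_sub_le _ _).trans (add_le_add_right (hρ u' hu') _)
      · simp [hg, hsupp u' hu']
    rw [lintegral_const_mul _ hgm] at h1
    intro h0
    rw [h0] at h1
    exact mul_ne_zero hc hgne (le_antisymm h1 zero_le)
  have hcongr : ∀ᵐ u, g u = ENNReal.ofReal (V₁ u * (Φ u).toReal) := by
    filter_upwards [hψΦ] with u hu
    rw [hg, ← hu]
  refine ⟨V₁, fun u => (Φ u).toReal, C, (K2 ^ (1 / 2 : ℝ)).toReal, hVV, hφψ.trans hψΦ, hpot, hsupp,
    hΦm.ennreal_toReal, fun u => ENNReal.toReal_pos (hΦpos u) (hΦfin u),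
    fun u => ENNReal.toReal_mono hKfin (hΦle u), fun u => ?_, ?_, ?_⟩
  · rw [ENNReal.ofReal_toReal (hΦfin u)]
    refine lintegral_congr_ae ?_
    filter_upwards [hcongr] with u' hu'
    rw [hu']
  · rw [← lintegral_congr_ae hcongr]
    exact hgne
  · refine hψL.ae_eq ?_
    filter_upwards [hψΦ] with u hu
    rw [hu]


/-! ### The rotation-minimizing frame of a curve -/

/-- A rotation-minimizing orthonormal frame `(t, e₁, e₂)` along the curve `Γ`, with continuous
curvatures `k₁, k₂` that vanish at infinity. -/
structure IsBishopFrame (Γ t e₁ e₂ : ℝ → E3) (k₁ k₂ : ℝ → ℝ) : Prop where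
  orthonormal : ∀ s, Orthonormal ℝ ![t s, e₁ s, e₂ s]
  deriv_curve : ∀ s, HasDerivAt Γ (t s) s
  deriv_t : ∀ s, HasDerivAt t (k₁ s • e₁ s + k₂ s • e₂ s) s
  deriv_fst : ∀ s, HasDerivAt e₁ (-(k₁ s • t s)) s
  deriv_snd : ∀ s, HasDerivAt e₂ (-(k₂ s • t s)) s
  cont_fst : Continuous k₁
  cont_snd : Continuous k₂
  lim_fst : Tendsto k₁ (cocompact ℝ) (𝓝 0)
  lim_snd : Tendsto k₂ (cocompact ℝ) (𝓝 0)

theorem orthonormal_three_iff {x y z : E3} : Orthonormal ℝ ![x, y, z] ↔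
    (‖x‖ = 1 ∧ ‖y‖ = 1 ∧ ‖z‖ = 1) ∧ inner ℝ x y = 0 ∧ inner ℝ x z = 0 ∧ inner ℝ y z = 0 := by
  constructor
  · intro h
    refine ⟨⟨h.1 0, h.1 1, h.1 2⟩, h.2 (i := 0) (j := 1) (by decide),
      h.2 (i := 0) (j := 2) (by decide), h.2 (i := 1) (j := 2) (by decide)⟩
  · rintro ⟨⟨hx, hy, hz⟩, hxy, hxz, hyz⟩
    refine ⟨fun i => by fin_cases i <;> assumption, fun i j hij => ?_⟩
    have hyx := (real_inner_comm x y).trans hxy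
    have hzx := (real_inner_comm x z).trans hxz
    have hzy := (real_inner_comm y z).trans hyz
    fin_cases i <;> fin_cases j <;> first | exact absurd rfl hij | assumption

theorem tendsto_curvature {Γ : ℝ → E3} {γ τ : ℝ → ℝ} (h : IsAsymptoticallyStraight Γ γ τ) :
    Tendsto γ (cocompact ℝ) (𝓝 0) := by
  rcases h with ⟨s₀, -, hs⟩ | ⟨-, -, h, -⟩
  · refine tendsto_const_nhds.congr' ?_
    have : ∀ᶠ s : ℝ in cocompact ℝ, s₀ < ‖s‖ :=
      (tendsto_norm_cocompact_atTop (E := ℝ)).eventually_gt_atTop s₀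
    filter_upwards [this] with s h
    exact (hs s h).1.symm
  · exact h

/-- Rotating the normals by `α` with `α' = τ` cancels the torsion terms, so that the derivatives of
the new normals are tangential; where `γ = 0` the gluing condition supplies the derivative. -/
theorem IsFrenetTriad.isBishopFrame {Γ n b : ℝ → E3} {γ τ α : ℝ → ℝ} (hΓ : ContDiff ℝ 2 Γ)
    (hf : IsFrenetTriad Γ n b γ τ) (ha : IsAsymptoticallyStraight Γ γ τ)
    (ht : IsTangAngle n b γ τ α) :
    IsBishopFrame Γ (deriv Γ) (fun s => Real.cos (α s) • n s - Real.sin (α s) • b s)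
      (fun s => Real.sin (α s) • n s + Real.cos (α s) • b s)
      (fun s => γ s * Real.cos (α s)) (fun s => γ s * Real.sin (α s)) := by
  have hon : ∀ s, Orthonormal ℝ ![deriv Γ s, Real.cos (α s) • n s - Real.sin (α s) • b s,
      Real.sin (α s) • n s + Real.cos (α s) • b s] := by
    intro s
    obtain ⟨⟨h1, h2, h3⟩, h4, h5, h6⟩ := orthonormal_three_iff.1 (hf.orthonormal s)
    have h7 : inner ℝ (b s) (n s) = (0 : ℝ) := (real_inner_comm _ _).trans h6
    have hc := Real.cos_sq_add_sin_sq (α s)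
    refine orthonormal_three_iff.2 ⟨⟨h1, ?_, ?_⟩, ?_, ?_, ?_⟩
    · rw [← sq_eq_sq₀ (norm_nonneg _) zero_le_one, ← real_inner_self_eq_norm_sq]
      simp only [inner_sub_left, inner_sub_right, inner_smul_left, inner_smul_right, h6, h7,
        real_inner_self_eq_norm_sq, h2, h3]
      simp
      linarith
    · rw [← sq_eq_sq₀ (norm_nonneg _) zero_le_one, ← real_inner_self_eq_norm_sq]
      simp only [inner_add_left, inner_add_right, inner_smul_left, inner_smul_right, h6, h7,
        real_inner_self_eq_norm_sq, h2, h3]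
      simp
      linarith
    · simp [inner_sub_right, inner_smul_right, h4, h5]
    · simp [inner_add_right, inner_smul_right, h4, h5]
    · simp only [inner_sub_left, inner_add_right, inner_smul_left, inner_smul_right, h6, h7,
        real_inner_self_eq_norm_sq, h2, h3]
      simp
      ring
  have hdt : ∀ s, HasDerivAt (deriv Γ)
      ((γ s * Real.cos (α s)) • (Real.cos (α s) • n s - Real.sin (α s) • b s) +
        (γ s * Real.sin (α s)) • (Real.sin (α s) • n s + Real.cos (α s) • b s)) s := by
    intro s
    convert! hf.deriv_t s using 1
    have hc := Real.cos_sq_add_sin_sq (α s)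
    have : γ s = γ s * (Real.cos (α s) ^ 2 + Real.sin (α s) ^ 2) := by rw [hc, mul_one]
    conv_rhs => rw [this]
    module
  have hd1 : ∀ s, HasDerivAt (fun s => Real.cos (α s) • n s - Real.sin (α s) • b s)
      (-((γ s * Real.cos (α s)) • deriv Γ s)) s := by
    intro s
    by_cases h : γ s = 0
    -- The angle `0` gives the first normal; the angle `π/2` gives the second one below.
    · have := ht.glue s h 0
      simp only [zero_sub, Real.cos_neg, Real.sin_neg, neg_smul, ← sub_eq_add_neg] at this
      simpa [h] using this
    · have h1 := ht.deriv_angle s h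
      have := (h1.cos.smul (hf.deriv_n s h)).sub (h1.sin.smul (hf.deriv_b s h))
      convert! this using 1
      module
  have hd2 : ∀ s, HasDerivAt (fun s => Real.sin (α s) • n s + Real.cos (α s) • b s)
      (-((γ s * Real.sin (α s)) • deriv Γ s)) s := by
    intro s
    by_cases h : γ s = 0
    · have := ht.glue s h (Real.pi / 2)
      simp only [Real.cos_pi_div_two_sub, Real.sin_pi_div_two_sub] at this
      simpa [h] using this
    · have h1 := ht.deriv_angle s h
      have := (h1.sin.smul (hf.deriv_n s h)).add (h1.cos.smul (hf.deriv_b s h))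
      convert! this using 1
      module
  have hc2 : Continuous (deriv (deriv Γ)) := by
    have h1 : ContDiff ℝ 1 (deriv Γ) := by
      have : ContDiff ℝ (1 + 1) Γ := by simpa [one_add_one_eq_two] using hΓ
      exact (contDiff_succ_iff_deriv.1 this).2.2
    exact h1.continuous_deriv le_rfl
  have hk : ∀ s, deriv (deriv Γ) s = _ := fun s => (hdt s).deriv
  have hc : ∀ e : ℝ → E3, (∀ s, DifferentiableAt ℝ e s) →
      Continuous fun s => inner ℝ (deriv (deriv Γ) s) (e s) := fun e he =>
    hc2.inner (continuous_iff_continuousAt.2 fun s => (he s).continuousAt)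
  have hγ := tendsto_curvature ha
  have hlim : ∀ f : ℝ → ℝ, (∀ s, |f s| ≤ 1) →
      Tendsto (fun s => γ s * f s) (cocompact ℝ) (𝓝 0) := by
    intro f hfb
    refine squeeze_zero_norm (a := fun s => ‖γ s‖) (fun s => ?_) (by simpa using hγ.norm)
    rw [norm_mul]
    exact mul_le_of_le_one_right (norm_nonneg _) (hfb s)
  refine ⟨hon, fun s => ?_, hdt, hd1, hd2, ?_, ?_, hlim _ fun s => Real.abs_cos_le_one _,
    hlim _ fun s => Real.abs_sin_le_one _⟩
  · exact (hΓ.differentiable (by norm_num) s).hasDerivAt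
  -- The curvatures are `⟨Γ'', eᵢ⟩`, continuous because `Γ` is `C²`, although `γ` and `α` separately
  -- are not assumed continuous.
  · refine (hc _ fun s => (hd1 s).differentiableAt).congr fun s => ?_
    obtain ⟨⟨h1, h2, h3⟩, h4, h5, h6⟩ := orthonormal_three_iff.1 (hon s)
    rw [hk s, inner_add_left, real_inner_smul_left, real_inner_smul_left, real_inner_self_eq_norm_sq,
      h2, real_inner_comm, h6]
    ring
  · refine (hc _ fun s => (hd2 s).differentiableAt).congr fun s => ?_
    obtain ⟨⟨h1, h2, h3⟩, h4, h5, h6⟩ := orthonormal_three_iff.1 (hon s)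
    rw [hk s, inner_add_left, real_inner_smul_left, real_inner_smul_left, real_inner_self_eq_norm_sq,
      h3, h6]
    ring

/-- The map of the tube in terms of a rotation-minimizing frame. -/
def frameMap (Γ e₁ e₂ : ℝ → E3) (s : ℝ) (u : E2) : E3 := Γ s - (u 0 • e₁ s + u 1 • e₂ s)

/-- The Jacobian of `frameMap`. -/
def frameJac (k₁ k₂ : ℝ → ℝ) (s : ℝ) (u : E2) : ℝ := 1 + (u 0 * k₁ s + u 1 * k₂ s)

theorem tubeMap_eq_frameMap (Γ n b : ℝ → E3) (α : ℝ → ℝ) :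
    tubeMap Γ n b α = frameMap Γ (fun s => Real.cos (α s) • n s - Real.sin (α s) • b s)
      (fun s => Real.sin (α s) • n s + Real.cos (α s) • b s) := by
  ext1 s
  ext1 u
  simp only [tubeMap, frameMap, rotCos, rotSin]
  module

theorem jac_eq_frameJac (γ α : ℝ → ℝ) : jac γ α = frameJac (fun s => γ s * Real.cos (α s))
    (fun s => γ s * Real.sin (α s)) := by
  ext s u
  simp only [jac, frameJac, rotCos]
  ring

theorem abs_linear_le {k₁ k₂ : ℝ → ℝ} {ε s : ℝ} (h1 : |k₁ s| ≤ ε)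
    (h2 : |k₂ s| ≤ ε) (u : E2) : |u 0 * k₁ s + u 1 * k₂ s| ≤ 2 * ‖u‖ * ε := by
  have a0 : |u 0| ≤ ‖u‖ := by simpa using PiLp.norm_apply_le u 0
  have a1 : |u 1| ≤ ‖u‖ := by simpa using PiLp.norm_apply_le u 1
  calc |u 0 * k₁ s + u 1 * k₂ s| ≤ |u 0 * k₁ s| + |u 1 * k₂ s| := abs_add_le _ _
    _ = |u 0| * |k₁ s| + |u 1| * |k₂ s| := by rw [abs_mul, abs_mul]
    _ ≤ ‖u‖ * ε + ‖u‖ * ε := by gcongr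
    _ = _ := by ring

namespace IsBishopFrame

variable {Γ t e₁ e₂ : ℝ → E3} {k₁ k₂ : ℝ → ℝ} {M : Set E2}

theorem continuous_curve (h : IsBishopFrame Γ t e₁ e₂ k₁ k₂) : Continuous Γ :=
  continuous_iff_continuousAt.2 fun s => (h.deriv_curve s).continuousAt

theorem continuous_fst (h : IsBishopFrame Γ t e₁ e₂ k₁ k₂) : Continuous e₁ :=
  continuous_iff_continuousAt.2 fun s => (h.deriv_fst s).continuousAt

theorem continuous_snd (h : IsBishopFrame Γ t e₁ e₂ k₁ k₂) : Continuous e₂ :=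
  continuous_iff_continuousAt.2 fun s => (h.deriv_snd s).continuousAt

theorem continuous_frameMap (h : IsBishopFrame Γ t e₁ e₂ k₁ k₂) :
    Continuous fun p : ℝ × E2 => frameMap Γ e₁ e₂ p.1 p.2 := by
  have := h.continuous_curve
  have := h.continuous_fst
  have := h.continuous_snd
  unfold frameMap
  fun_prop

theorem continuous_frameJac (h : IsBishopFrame Γ t e₁ e₂ k₁ k₂) :
    Continuous fun p : ℝ × E2 => frameJac k₁ k₂ p.1 p.2 := by
  have := h.cont_fst
  have := h.cont_snd
  unfold frameJac
  fun_prop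

theorem hasDerivAt_frameMap (h : IsBishopFrame Γ t e₁ e₂ k₁ k₂) (s : ℝ) (u : E2) :
    HasDerivAt (fun s => frameMap Γ e₁ e₂ s u) (frameJac k₁ k₂ s u • t s) s := by
  have := (h.deriv_curve s).sub (((h.deriv_fst s).const_smul (u 0)).add
    ((h.deriv_snd s).const_smul (u 1)))
  convert! this using 1
  simp only [frameJac]
  module

theorem norm_combination (h : IsBishopFrame Γ t e₁ e₂ k₁ k₂) (s : ℝ) (a : ℝ) (u : E2) :
    ‖a • t s - (u 0 • e₁ s + u 1 • e₂ s)‖ = ‖straightMap a u‖ := by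
  obtain ⟨⟨h1, h2, h3⟩, h4, h5, h6⟩ := orthonormal_three_iff.1 (h.orthonormal s)
  rw [← sq_eq_sq₀ (norm_nonneg _) (norm_nonneg _), norm_straightMap_sq,
    ← real_inner_self_eq_norm_sq]
  simp only [inner_add_left, inner_add_right, inner_sub_left, inner_sub_right, real_inner_smul_left,
    real_inner_smul_right, h4, h5, h6, real_inner_comm (t s) (e₁ s), real_inner_comm (t s) (e₂ s),
    real_inner_comm (e₁ s) (e₂ s)]
  simp only [real_inner_self_eq_norm_sq, h1, h2, h3]
  rw [EuclideanSpace.norm_sq_eq u]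
  simp only [Fin.sum_univ_two, Real.norm_eq_abs, sq_abs]
  ring

theorem norm_transverse (h : IsBishopFrame Γ t e₁ e₂ k₁ k₂) (s : ℝ) (u : E2) :
    ‖u 0 • e₁ s + u 1 • e₂ s‖ = ‖u‖ := by
  have h1 := h.norm_combination s 0 u
  have h2 := norm_straightMap_sq 0 u
  rw [zero_smul, zero_sub, norm_neg] at h1
  rw [← sq_eq_sq₀ (norm_nonneg _) (norm_nonneg _), h1, h2]
  ring

/-- Far out the map of the tube is nearly isometric at bounded longitudinal distances. -/
theorem norm_frameMap_sub_ge (h : IsBishopFrame Γ t e₁ e₂ k₁ k₂) {ε ρ T s s' : ℝ}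
    (h1 : ∀ σ ∈ Set.uIcc s' s, |k₁ σ| ≤ ε) (h2 : ∀ σ ∈ Set.uIcc s' s, |k₂ σ| ≤ ε)
    (hT : |s - s'| ≤ T) {u u' : E2} (hu : ‖u‖ ≤ ρ) :
    (1 - 2 * ε * (T + ρ)) * ‖straightMap s u - straightMap s' u'‖ ≤
      ‖frameMap Γ e₁ e₂ s u - frameMap Γ e₁ e₂ s' u'‖ := by
  have hε : 0 ≤ ε := (abs_nonneg _).trans (h1 s' Set.left_mem_uIcc)
  have hρ : 0 ≤ ρ := (norm_nonneg u).trans hu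
  have hT0 : 0 ≤ T := (abs_nonneg _).trans hT
  have hconv : Convex ℝ (Set.uIcc s' s) := convex_uIcc _ _
  have ht : ∀ σ ∈ Set.uIcc s' s, ‖t σ - t s'‖ ≤ 2 * ε * T := by
    intro σ hσ
    have hd : |σ - s'| ≤ T := (Set.abs_sub_left_of_mem_uIcc hσ).trans hT
    have := hconv.norm_image_sub_le_of_norm_hasDerivWithin_le
      (fun x _ => (h.deriv_t x).hasDerivWithinAt) (C := 2 * ε) (fun x hx => ?_)
      Set.left_mem_uIcc hσ
    · refine this.trans ?_
      rw [Real.norm_eq_abs]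
      gcongr
    · obtain ⟨⟨-, a2, a3⟩, -⟩ := orthonormal_three_iff.1 (h.orthonormal x)
      refine (norm_add_le _ _).trans ?_
      rw [norm_smul, norm_smul, a2, a3, Real.norm_eq_abs, Real.norm_eq_abs]
      linarith [h1 x hx, h2 x hx]
  -- Subtracting uniform motion along `t s'` leaves the derivative `J t - t s'`: the turning of the
  -- tangent contributes at most `2εT` and the deviation of the Jacobian from one at most `2ερ`.
  set f : ℝ → E3 := fun σ => frameMap Γ e₁ e₂ σ u - σ • t s' with hf
  have hfd : ∀ σ, HasDerivAt f (frameJac k₁ k₂ σ u • t σ - t s') σ := by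
    intro σ
    have := (h.hasDerivAt_frameMap σ u).sub ((hasDerivAt_id σ).smul_const (t s'))
    rw [one_smul] at this
    exact this
  have hmain : ‖f s - f s'‖ ≤ 2 * ε * (T + ρ) * |s - s'| := by
    refine hconv.norm_image_sub_le_of_norm_hasDerivWithin_le
      (fun x _ => (hfd x).hasDerivWithinAt) (fun x hx => ?_) Set.left_mem_uIcc Set.right_mem_uIcc
    obtain ⟨⟨a1, -, -⟩, -⟩ := orthonormal_three_iff.1 (h.orthonormal x)
    have e : frameJac k₁ k₂ x u • t x - t s' = (t x - t s') + (u 0 * k₁ x + u 1 * k₂ x) • t x := by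
      simp only [frameJac]; module
    rw [e]
    refine (norm_add_le _ _).trans ?_
    rw [norm_smul, a1, Real.norm_eq_abs, mul_one]
    have b1 := ht x hx
    have b2 := abs_linear_le (h1 x hx) (h2 x hx) u
    have b3 : 2 * ‖u‖ * ε ≤ 2 * ρ * ε := by gcongr
    linarith
  have hz := h.norm_combination s' (s - s') (u - u')
  rw [← straightMap_sub] at hz
  have hle : |s - s'| ≤ ‖straightMap s u - straightMap s' u'‖ := by
    rw [straightMap_sub]
    refine abs_le_of_sq_le_sq ?_ (norm_nonneg _)
    rw [norm_straightMap_sq]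
    nlinarith [sq_nonneg ‖u - u'‖]
  -- The first summand is the exactly isometric image of the straight difference in the frame at
  -- `s'`; the second is the small error.
  have hsplit : frameMap Γ e₁ e₂ s u - frameMap Γ e₁ e₂ s' u' =
      ((s - s') • t s' - ((u - u') 0 • e₁ s' + (u - u') 1 • e₂ s')) + (f s - f s') := by
    simp only [hf, frameMap, PiLp.sub_apply]
    module
  rw [hsplit]
  have h5 := norm_sub_le_norm_add ((s - s') • t s' - ((u - u') 0 • e₁ s' + (u - u') 1 • e₂ s'))
    (f s - f s')
  rw [hz] at h5
  have h6 : 2 * ε * (T + ρ) * |s - s'| ≤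
      2 * ε * (T + ρ) * ‖straightMap s u - straightMap s' u'‖ := by gcongr
  linarith

end IsBishopFrame


/-! ### The tube as a coordinate chart -/

/-- The coordinates of the straight tube, as an equivalence with the ambient space. -/
def straightEquiv : ℝ × E2 ≃ᵐ E3 where
  toFun p := straightMap p.1 p.2
  invFun y := (y 0, !₂[y 1, y 2])
  left_inv := by
    rintro ⟨s, u⟩
    refine Prod.ext ?_ ?_
    · simp [straightMap]
    · ext i
      fin_cases i <;> simp [straightMap]
  right_inv := by
    intro y
    ext i
    fin_cases i <;> simp [straightMap]
  measurable_toFun := by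
    have : Continuous fun p : ℝ × E2 => straightMap p.1 p.2 := by unfold straightMap; fun_prop
    exact this.measurable
  measurable_invFun := by
    have : Continuous fun y : E3 => ((y 0, !₂[y 1, y 2]) : ℝ × E2) := by fun_prop
    exact this.measurable

theorem straightEquiv_apply (p : ℝ × E2) : straightEquiv p = straightMap p.1 p.2 := rfl

theorem measurePreserving_straightEquiv : MeasurePreserving straightEquiv := by
  have h1 : MeasurePreserving (Prod.map id (WithLp.ofLp : E2 → Fin 2 → ℝ))
      (volume : Measure (ℝ × E2)) volume :=
    (MeasurePreserving.id volume).prod (PiLp.volume_preserving_ofLp (Fin 2))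
  have h2 := (volume_preserving_piFinSuccAbove (fun _ : Fin 3 => ℝ) 0).symm
  have h3 := PiLp.volume_preserving_toLp (Fin 3)
  convert! (h3.comp h2).comp h1 using 1
  ext p i
  fin_cases i <;> simp [straightEquiv_apply, straightMap, MeasurableEquiv.piFinSuccAbove]
  rfl

namespace IsBishopFrame

variable {Γ t e₁ e₂ : ℝ → E3} {k₁ k₂ : ℝ → ℝ} {M : Set E2}

theorem exists_orthonormalBasis (h : IsBishopFrame Γ t e₁ e₂ k₁ k₂) (s : ℝ) :
    ∃ b : OrthonormalBasis (Fin 3) ℝ E3, ⇑b = ![t s, e₁ s, e₂ s] := by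
  have := ((h.orthonormal s).linearIndependent.span_eq_top_of_card_eq_finrank' (by simp)).ge
  exact ⟨OrthonormalBasis.mk (h.orthonormal s) this, OrthonormalBasis.coe_mk _ _⟩

theorem eq_frameMap_of_inner_eq_zero (h : IsBishopFrame Γ t e₁ e₂ k₁ k₂) {s : ℝ} {y : E3}
    (hy : inner ℝ (y - Γ s) (t s) = 0) :
    frameMap Γ e₁ e₂ s !₂[-inner ℝ (y - Γ s) (e₁ s), -inner ℝ (y - Γ s) (e₂ s)] = y := by
  obtain ⟨b, hb⟩ := h.exists_orthonormalBasis s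
  have := b.sum_repr' (y - Γ s)
  rw [hb, Fin.sum_univ_three] at this
  simp only [Matrix.cons_val_zero, Matrix.cons_val_one, Matrix.cons_val] at this
  rw [real_inner_comm, hy, zero_smul, zero_add, real_inner_comm (y - Γ s),
    real_inner_comm (y - Γ s)] at this
  simp only [frameMap]
  have e : y = (y - Γ s) + Γ s := by abel
  conv_rhs => rw [e, ← this]
  simp
  module

theorem frameJac_smul (s c : ℝ) (u : E2) :
    frameJac k₁ k₂ s (c • u) = 1 + c * (frameJac k₁ k₂ s u - 1) := by
  simp [frameJac]
  ring

/-- Injectivity of the map of the tube forces the Jacobian not to vanish. -/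
theorem frameJac_ne_zero (h : IsBishopFrame Γ t e₁ e₂ k₁ k₂) (hMo : IsOpen M)
    (hinj : Set.InjOn (fun p : ℝ × E2 => frameMap Γ e₁ e₂ p.1 p.2) (Set.univ ×ˢ M))
    (s₀ : ℝ) {u₀ : E2} (hu₀ : u₀ ∈ M) : frameJac k₁ k₂ s₀ u₀ ≠ 0 := by
  intro hJ
  obtain ⟨r, hr, hball⟩ := Metric.isOpen_iff.1 hMo u₀ hu₀
  -- Half of the radius is kept for `c • u₀ - u₀`, the other half for `w - c • u₀`.
  obtain ⟨δ, hδ, hδr⟩ : ∃ δ > 0, δ * ‖u₀‖ < r / 2 := by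
    refine ⟨r / (2 * (‖u₀‖ + 1)), by positivity, ?_⟩
    rw [div_mul_eq_mul_div, div_lt_div_iff₀ (by positivity) two_pos]
    nlinarith [norm_nonneg u₀]
  -- The signed distance to the normal plane at `s₀`. When the Jacobian vanishes at `u₀`, its
  -- derivative at `s₀` is `1 - c`: for `c < 1` the point moves ahead of the plane, for `c > 1`
  -- behind it.
  set g : ℝ → ℝ → ℝ := fun c s => inner ℝ (frameMap Γ e₁ e₂ s (c • u₀) - Γ s₀) (t s₀) with hg
  obtain ⟨⟨a1, a2, a3⟩, a4, a5, a6⟩ := orthonormal_three_iff.1 (h.orthonormal s₀)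
  have hg0 : ∀ c, g c s₀ = 0 := by
    intro c
    simp only [hg, frameMap]
    rw [sub_sub_cancel_left, inner_neg_left, inner_add_left, real_inner_smul_left,
      real_inner_smul_left, real_inner_comm, a4, real_inner_comm, a5]
    simp
  have hgd : ∀ c, HasDerivAt (g c) (1 - c) s₀ := by
    intro c
    have h1 := ((h.hasDerivAt_frameMap s₀ (c • u₀)).sub_const (Γ s₀)).inner ℝ
      (hasDerivAt_const s₀ (t s₀))
    convert! h1 using 1
    rw [inner_zero_right, zero_add, real_inner_smul_left, real_inner_self_eq_norm_sq, a1,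
      frameJac_smul, hJ]
    ring
  have hslope : ∀ c, Tendsto (fun s => (s - s₀)⁻¹ * g c s) (𝓝[>] s₀) (𝓝 (1 - c)) := by
    intro c
    have h1 := (hasDerivAt_iff_tendsto_slope.1 (hgd c)).mono_left
      (nhdsWithin_mono s₀ (fun x (hx : s₀ < x) => hx.ne'))
    refine h1.congr fun s => ?_
    rw [slope_def_field, hg0, sub_zero, div_eq_inv_mul]
  have hpos : ∀ᶠ s in 𝓝[>] s₀, 0 < g (1 - δ) s := by
    filter_upwards [(hslope (1 - δ)).eventually_const_lt (show 0 < 1 - (1 - δ) by linarith),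
      self_mem_nhdsWithin] with s hs hs'
    exact (pos_iff_pos_of_mul_pos hs).1 (inv_pos.2 (sub_pos.2 hs'))
  have hneg : ∀ᶠ s in 𝓝[>] s₀, g (1 + δ) s < 0 := by
    filter_upwards [(hslope (1 + δ)).eventually_lt_const (show 1 - (1 + δ) < 0 by linarith),
      self_mem_nhdsWithin] with s hs hs'
    by_contra! hcon
    exact absurd hs (not_lt.2 (mul_nonneg (inv_pos.2 (sub_pos.2 hs')).le hcon))
  have hclose : ∀ᶠ s in 𝓝[>] s₀, ‖Γ s - Γ s₀‖ +
      (1 + δ) * ‖u₀‖ * (‖e₁ s - e₁ s₀‖ + ‖e₂ s - e₂ s₀‖) < r / 2 := by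
    have c1 := h.continuous_curve
    have c2 := h.continuous_fst
    have c3 := h.continuous_snd
    have : Tendsto (fun s => ‖Γ s - Γ s₀‖ +
      (1 + δ) * ‖u₀‖ * (‖e₁ s - e₁ s₀‖ + ‖e₂ s - e₂ s₀‖)) (𝓝 s₀) (𝓝 (‖Γ s₀ - Γ s₀‖ +
      (1 + δ) * ‖u₀‖ * (‖e₁ s₀ - e₁ s₀‖ + ‖e₂ s₀ - e₂ s₀‖))) :=
      Continuous.tendsto (by fun_prop) s₀
    simp only [sub_self, norm_zero, add_zero, mul_zero] at this
    exact (this.eventually_lt_const (by positivity)).filter_mono nhdsWithin_le_nhds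
  obtain ⟨s, hs1, hs2, hs3, hs4⟩ := (hpos.and (hneg.and (hclose.and self_mem_nhdsWithin))).exists
  have hcont : ContinuousOn (fun c => g c s) (Set.Icc (1 - δ) (1 + δ)) := by
    have : Continuous fun c : ℝ => g c s := by
      simp only [hg, frameMap]
      fun_prop
    exact this.continuousOn
  -- For `s` slightly beyond `s₀` some `c` close to one lands back in the normal plane at `s₀`, at
  -- coordinates `w` near `u₀`; two cross sections then meet, contradicting injectivity.
  obtain ⟨c, ⟨hc1, hc2⟩, hc0⟩ := intermediate_value_Icc' (by linarith) hcont
    ⟨hs2.le, hs1.le⟩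
  have hw := h.eq_frameMap_of_inner_eq_zero (y := frameMap Γ e₁ e₂ s (c • u₀)) hc0
  set w : E2 := !₂[-inner ℝ (frameMap Γ e₁ e₂ s (c • u₀) - Γ s₀) (e₁ s₀),
    -inner ℝ (frameMap Γ e₁ e₂ s (c • u₀) - Γ s₀) (e₂ s₀)] with hwdef
  have hd : ‖w - c • u₀‖ < r / 2 := by
    rw [← h.norm_transverse s₀, ← norm_neg]
    have e : -((w - c • u₀) 0 • e₁ s₀ + (w - c • u₀) 1 • e₂ s₀) =
        (Γ s - Γ s₀) - ((c * u₀ 0) • (e₁ s - e₁ s₀) + (c * u₀ 1) • (e₂ s - e₂ s₀)) := by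
      have e1 : -((w - c • u₀) 0 • e₁ s₀ + (w - c • u₀) 1 • e₂ s₀) =
          frameMap Γ e₁ e₂ s₀ w - frameMap Γ e₁ e₂ s₀ (c • u₀) := by
        simp only [frameMap, PiLp.sub_apply]
        module
      rw [e1, hw]
      simp only [frameMap, PiLp.smul_apply, smul_eq_mul]
      module
    have b0 : |u₀ 0| ≤ ‖u₀‖ := by simpa using PiLp.norm_apply_le u₀ 0
    have b1 : |u₀ 1| ≤ ‖u₀‖ := by simpa using PiLp.norm_apply_le u₀ 1
    have b2 : |c| ≤ 1 + δ := abs_le.2 ⟨by linarith, hc2⟩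
    rw [e]
    refine lt_of_le_of_lt (norm_sub_le _ _) (lt_of_le_of_lt ?_ hs3)
    refine add_le_add le_rfl ((norm_add_le _ _).trans ?_)
    rw [norm_smul, norm_smul, mul_add, norm_mul, norm_mul, Real.norm_eq_abs, Real.norm_eq_abs,
      Real.norm_eq_abs]
    gcongr
  have hcu : ‖c • u₀ - u₀‖ ≤ δ * ‖u₀‖ := by
    have : c • u₀ - u₀ = (c - 1) • u₀ := by module
    rw [this, norm_smul, Real.norm_eq_abs]
    gcongr
    exact abs_le.2 ⟨by linarith, by linarith⟩
  have hm1 : c • u₀ ∈ M := hball (mem_ball_iff_norm.2 (by linarith))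
  have hm2 : w ∈ M := by
    refine hball (mem_ball_iff_norm.2 ?_)
    have := norm_sub_le_norm_sub_add_norm_sub w (c • u₀) u₀
    linarith
  have := hinj (x₁ := (s₀, w)) (x₂ := (s, c • u₀)) ⟨trivial, hm2⟩ ⟨trivial, hm1⟩ hw
  exact absurd (congrArg Prod.fst this) (ne_of_lt hs4)

/-- For fixed `u` the Jacobian is continuous in `s`, never zero, and tends to one at infinity. -/
theorem frameJac_pos (h : IsBishopFrame Γ t e₁ e₂ k₁ k₂) (hMo : IsOpen M)
    (hinj : Set.InjOn (fun p : ℝ × E2 => frameMap Γ e₁ e₂ p.1 p.2) (Set.univ ×ˢ M))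
    (s : ℝ) {u : E2} (hu : u ∈ M) : 0 < frameJac k₁ k₂ s u := by
  by_contra! hle
  have hc : Continuous fun s => frameJac k₁ k₂ s u :=
    h.continuous_frameJac.comp (Continuous.prodMk_left u)
  have hlim : Tendsto (fun s => frameJac k₁ k₂ s u) (cocompact ℝ) (𝓝 1) := by
    have := ((h.lim_fst.const_mul (u 0)).add (h.lim_snd.const_mul (u 1))).const_add 1
    simpa [frameJac] using this
  obtain ⟨s', hs'⟩ := (hlim.eventually_const_lt one_pos).exists
  obtain ⟨σ, hσ⟩ := mem_range_of_exists_le_of_exists_ge hc ⟨s, hle⟩ ⟨s', hs'.le⟩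
  exact h.frameJac_ne_zero hMo hinj σ hu hσ

/-- The derivative of the map of the tube in the coordinates of the straight tube. -/
def frameDeriv (t e₁ e₂ : ℝ → E3) (k₁ k₂ : ℝ → ℝ) (y : E3) : E3 →L[ℝ] E3 :=
  (EuclideanSpace.proj 0 : E3 →L[ℝ] ℝ).smulRight (frameJac k₁ k₂ (y 0) !₂[y 1, y 2] • t (y 0)) -
    ((EuclideanSpace.proj 1 : E3 →L[ℝ] ℝ).smulRight (e₁ (y 0)) +
      (EuclideanSpace.proj 2 : E3 →L[ℝ] ℝ).smulRight (e₂ (y 0)))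

theorem hasFDerivAt_frameMap (h : IsBishopFrame Γ t e₁ e₂ k₁ k₂) (y : E3) :
    HasFDerivAt (fun y : E3 => frameMap Γ e₁ e₂ (y 0) !₂[y 1, y 2])
      (frameDeriv t e₁ e₂ k₁ k₂ y) y := by
  have p : ∀ i : Fin 3, HasFDerivAt (fun y : E3 => y i) (EuclideanSpace.proj i : E3 →L[ℝ] ℝ) y :=
    fun i => (EuclideanSpace.proj i : E3 →L[ℝ] ℝ).hasFDerivAt
  have h1 := (h.deriv_curve (y 0)).hasFDerivAt.comp y (p 0)
  have h2 := (p 1).smul ((h.deriv_fst (y 0)).hasFDerivAt.comp y (p 0))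
  have h3 := (p 2).smul ((h.deriv_snd (y 0)).hasFDerivAt.comp y (p 0))
  have := h1.sub (h2.add h3)
  convert! this using 1
  ext1 v
  simp [frameDeriv, frameJac]
  module

/-- The standard basis is mapped to `J t, -e₁, -e₂`, a diagonal rescaling of an orthonormal basis.
-/
theorem abs_det_frameDeriv (h : IsBishopFrame Γ t e₁ e₂ k₁ k₂) (y : E3) :
    |(frameDeriv t e₁ e₂ k₁ k₂ y).det| = |frameJac k₁ k₂ (y 0) !₂[y 1, y 2]| := by
  obtain ⟨b, hb⟩ := h.exists_orthonormalBasis (y 0)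
  set a := EuclideanSpace.basisFun (Fin 3) ℝ with ha
  have h1 := a.toBasis.det_comp (frameDeriv t e₁ e₂ k₁ k₂ y : E3 →ₗ[ℝ] E3) a
  have h2 : a.toBasis.det a = 1 := by
    have := a.toBasis.det_self
    rwa [OrthonormalBasis.coe_toBasis] at this
  set c : Fin 3 → ℝ := ![frameJac k₁ k₂ (y 0) !₂[y 1, y 2], -1, -1] with hc
  have h3 : (frameDeriv t e₁ e₂ k₁ k₂ y : E3 →ₗ[ℝ] E3) ∘ a = fun i => c i • b i := by
    ext1 i
    rw [hb]
    fin_cases i <;> simp [frameDeriv, hc, ha]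
  have h4 := a.toBasis.det.toMultilinearMap.map_smul_univ c b
  rw [h2, mul_one, h3] at h1
  rw [ContinuousLinearMap.det, ← h1]
  refine (congrArg abs h4).trans ?_
  rw [smul_eq_mul, abs_mul]
  have h5 : |a.toBasis.det b| = 1 := by
    rcases a.det_to_matrix_orthonormalBasis_real b with h | h <;> rw [h] <;> simp
  refine (congrArg _ h5).trans ?_
  simp [hc, Fin.prod_univ_three]

end IsBishopFrame


/-- The properties of the map `X` of a tube with cross section `M` and of its Jacobian `J`, in
coordinates `(s, u)`, on which the analysis of the operator rests. -/
structure IsTubeChart (X : ℝ × E2 → E3) (J : ℝ × E2 → ℝ) (M : Set E2) : Prop where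
  isOpen : IsOpen M
  bounded : Bornology.IsBounded M
  cont : Continuous X
  cont_jac : Continuous J
  injOn : Set.InjOn X (Set.univ ×ˢ M)
  pos : ∀ s, ∀ u ∈ M, 0 < J (s, u)
  lintegral_image : ∀ F : E3 → ℝ≥0∞, ∫⁻ y in X '' (Set.univ ×ˢ M), F y =
    ∫⁻ p in Set.univ ×ˢ M, ENNReal.ofReal (J p) * F (X p)
  null_image : ∀ N : Set (ℝ × E2), volume N = 0 → volume (X '' N) = 0
  jac_le : ∀ δ > 0, ∃ S, ∀ s, S < |s| → ∀ u ∈ M, J (s, u) ≤ 1 + δ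
  near : ∀ δ > 0, ∀ T, ∃ S, ∀ s s', S < |s| → S < |s'| → |s - s'| ≤ T → ∀ u ∈ M, ∀ u' ∈ M,
    (1 - δ) * ‖straightMap s u - straightMap s' u'‖ ≤ ‖X (s, u) - X (s', u')‖
  far : ∀ R, ∃ T, ∀ s s', T ≤ |s - s'| → ∀ u ∈ M, ∀ u' ∈ M, R ≤ ‖X (s, u) - X (s', u')‖

theorem exists_bound_of_tendsto_zero {k : ℝ → ℝ} (h : Tendsto k (cocompact ℝ) (𝓝 0)) {ε : ℝ}
    (hε : 0 < ε) : ∃ S, ∀ s, S < |s| → |k s| ≤ ε := by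
  have h1 : ∀ᶠ s in cocompact ℝ, |k s| ≤ ε := by
    filter_upwards [(tendsto_zero_iff_norm_tendsto_zero.1 h).eventually_lt_const hε] with s hs
    exact hs.le
  rw [← Metric.cobounded_eq_cocompact, ← comap_norm_atTop, eventually_comap] at h1
  obtain ⟨S, hS⟩ := eventually_atTop.1 h1
  exact ⟨S, fun s hs => hS |s| hs.le s rfl⟩

/-- Two points farther than `S` from the origin and at most `T ≤ S` apart lie on the same side, so
the segment between them stays outside `[-S, S]`. -/
theorem lt_abs_of_mem_uIcc {S T s s' σ : ℝ} (hTS : T ≤ S) (hT : 0 ≤ T) (hs : S < |s|)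
    (hs' : S < |s'|) (hd : |s - s'| ≤ T) (hσ : σ ∈ Set.uIcc s' s) : S < |σ| := by
  have h1 := (abs_le.1 hd).1
  have h2 := (abs_le.1 hd).2
  rcases Set.mem_uIcc.1 hσ with ⟨a, b⟩ | ⟨a, b⟩ <;> rcases lt_abs.1 hs with c | c <;>
    rcases lt_abs.1 hs' with d | d <;> first
      | exact lt_abs.2 (Or.inl (by linarith))
      | exact lt_abs.2 (Or.inr (by linarith))

theorem IsBishopFrame.isTubeChart {Γ t e₁ e₂ : ℝ → E3} {k₁ k₂ : ℝ → ℝ} {M : Set E2}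
    (h : IsBishopFrame Γ t e₁ e₂ k₁ k₂)
    (hends : Tendsto (fun p : ℝ × ℝ => ‖Γ p.1 - Γ p.2‖)
      (comap (fun p : ℝ × ℝ => |p.1 - p.2|) atTop) atTop)
    (hMo : IsOpen M) (hMb : Bornology.IsBounded M)
    (hinj : Set.InjOn (fun p : ℝ × E2 => frameMap Γ e₁ e₂ p.1 p.2) (Set.univ ×ˢ M)) :
    IsTubeChart (fun p => frameMap Γ e₁ e₂ p.1 p.2) (fun p => frameJac k₁ k₂ p.1 p.2) M := by
  obtain ⟨ρ, hρ⟩ := hMb.exists_pos_norm_le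
  obtain ⟨hρ0, hρ⟩ := hρ
  set Y : E3 → E3 := fun y => frameMap Γ e₁ e₂ (y 0) !₂[y 1, y 2] with hY
  have hYX : ∀ p : ℝ × E2, Y (straightEquiv p) = frameMap Γ e₁ e₂ p.1 p.2 := by
    intro p
    have := straightEquiv.left_inv p
    conv_rhs => rw [← this]
    rfl
  have hJp : ∀ p : ℝ × E2, frameJac k₁ k₂ ((straightEquiv p) 0)
      !₂[(straightEquiv p) 1, (straightEquiv p) 2] = frameJac k₁ k₂ p.1 p.2 := by
    intro p
    have := straightEquiv.left_inv p
    conv_rhs => rw [← this]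
    rfl
  have himage : ∀ N : Set (ℝ × E2), (fun p : ℝ × E2 => frameMap Γ e₁ e₂ p.1 p.2) '' N =
      Y '' (straightEquiv '' N) := by
    intro N
    rw [Set.image_image]
    simp only [hYX]
  have hkey : ∀ ε > 0, ∃ S, ∀ s, S < |s| → |k₁ s| ≤ ε ∧ |k₂ s| ≤ ε := by
    intro ε hε
    obtain ⟨S₁, h₁⟩ := exists_bound_of_tendsto_zero h.lim_fst hε
    obtain ⟨S₂, h₂⟩ := exists_bound_of_tendsto_zero h.lim_snd hε
    exact ⟨max S₁ S₂, fun s hs => ⟨h₁ s (lt_of_le_of_lt (le_max_left _ _) hs),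
      h₂ s (lt_of_le_of_lt (le_max_right _ _) hs)⟩⟩
  refine ⟨hMo, hMb, h.continuous_frameMap, h.continuous_frameJac, hinj,
    fun s u hu => h.frameJac_pos hMo hinj s hu, fun F => ?_, fun N hN => ?_, fun δ hδ => ?_,
    fun δ hδ T => ?_, fun R => ?_⟩
  · have hTm : MeasurableSet (straightEquiv '' (Set.univ ×ˢ M)) :=
      straightEquiv.measurableEmbedding.measurableSet_image.2
        (MeasurableSet.univ.prod hMo.measurableSet)
    have hYinj : Set.InjOn Y (straightEquiv '' (Set.univ ×ˢ M)) := by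
      rintro _ ⟨p, hp, rfl⟩ _ ⟨q, hq, rfl⟩ hpq
      rw [hYX, hYX] at hpq
      rw [hinj hp hq hpq]
    rw [himage, lintegral_image_eq_lintegral_abs_det_fderiv_mul volume hTm
      (fun y _ => (h.hasFDerivAt_frameMap y).hasFDerivWithinAt) hYinj]
    have hpre : Set.univ ×ˢ M = straightEquiv ⁻¹' (straightEquiv '' (Set.univ ×ˢ M)) :=
      (Set.preimage_image_eq _ straightEquiv.injective).symm
    conv_rhs => rw [hpre]
    rw [← measurePreserving_straightEquiv.setLIntegral_comp_preimage_emb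
      straightEquiv.measurableEmbedding, ← hpre]
    refine setLIntegral_congr_fun (MeasurableSet.univ.prod hMo.measurableSet) ?_
    rintro p ⟨-, hp⟩
    dsimp only
    have hYp := hYX p
    simp only [hY] at hYp
    rw [h.abs_det_frameDeriv, hYp, hJp, abs_of_pos (h.frameJac_pos hMo hinj _ hp)]
  · rw [himage]
    refine addHaar_image_eq_zero_of_differentiableOn_of_addHaar_eq_zero volume
      (fun y _ => (h.hasFDerivAt_frameMap y).differentiableAt.differentiableWithinAt) ?_
    rw [straightEquiv.image_eq_preimage_symm]
    rw [(measurePreserving_straightEquiv.symm straightEquiv).measure_preimage_equiv]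
    exact hN
  · obtain ⟨S, hS⟩ := hkey (δ / (2 * ρ)) (by positivity)
    refine ⟨S, fun s hs u hu => ?_⟩
    have := abs_linear_le (hS s hs).1 (hS s hs).2 u
    have h2 : 2 * ‖u‖ * (δ / (2 * ρ)) ≤ 2 * ρ * (δ / (2 * ρ)) := by
      gcongr
      exact hρ u hu
    have h3 : 2 * ρ * (δ / (2 * ρ)) = δ := by field_simp
    simp only [frameJac]
    linarith [le_abs_self (u 0 * k₁ s + u 1 * k₂ s)]
  · rcases lt_or_ge T 0 with hT | hT
    · exact ⟨0, fun s s' _ _ hd => absurd hd (not_le.2 (hT.trans_le (abs_nonneg _)))⟩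
    obtain ⟨S, hS⟩ := hkey (δ / (2 * (T + ρ))) (by positivity)
    refine ⟨max S T, fun s s' hs hs' hd u hu u' hu' => ?_⟩
    have hseg : ∀ σ ∈ Set.uIcc s' s, S < |σ| := fun σ hσ => lt_of_le_of_lt (le_max_left _ _)
      (lt_abs_of_mem_uIcc (le_max_right _ _) hT hs hs' hd hσ)
    have := h.norm_frameMap_sub_ge (fun σ hσ => (hS σ (hseg σ hσ)).1)
      (fun σ hσ => (hS σ (hseg σ hσ)).2) hd (hρ u hu) (u' := u')
    have h3 : 2 * (δ / (2 * (T + ρ))) * (T + ρ) = δ := by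
      have : T + ρ ≠ 0 := by positivity
      field_simp
    rwa [h3] at this
  · have h1 := hends.eventually_ge_atTop (R + 2 * ρ)
    rw [eventually_comap] at h1
    obtain ⟨T, hT⟩ := eventually_atTop.1 h1
    refine ⟨T, fun s s' hd u hu u' hu' => ?_⟩
    have h2 := hT _ hd (s, s') rfl
    have h3 : Γ s - Γ s' = (frameMap Γ e₁ e₂ s u - frameMap Γ e₁ e₂ s' u') +
        (u 0 • e₁ s + u 1 • e₂ s) - (u' 0 • e₁ s' + u' 1 • e₂ s') := by
      simp only [frameMap]
      abel
    have h4 := norm_sub_le ((frameMap Γ e₁ e₂ s u - frameMap Γ e₁ e₂ s' u') +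
        (u 0 • e₁ s + u 1 • e₂ s)) (u' 0 • e₁ s' + u' 1 • e₂ s')
    have h5 := norm_add_le (frameMap Γ e₁ e₂ s u - frameMap Γ e₁ e₂ s' u')
      (u 0 • e₁ s + u 1 • e₂ s)
    rw [← h3, h.norm_transverse] at h4
    rw [h.norm_transverse] at h5
    have := hρ u hu
    have := hρ u' hu'
    dsimp only at h2 ⊢
    linarith

namespace IsTubeChart

variable {X : ℝ × E2 → E3} {J : ℝ × E2 → ℝ} {M : Set E2}

theorem measurableSet_strip (h : IsTubeChart X J M) :
    MeasurableSet ((Set.univ : Set ℝ) ×ˢ M) := MeasurableSet.univ.prod h.isOpen.measurableSet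

/-- Lusin–Souslin: an injective continuous image of a Borel set is Borel. It gives the measurability
of functions defined through the tube coordinates. -/
theorem measurableSet_image (h : IsTubeChart X J M) {A : Set (ℝ × E2)} (hA : MeasurableSet A)
    (hAM : A ⊆ Set.univ ×ˢ M) : MeasurableSet (X '' A) :=
  hA.image_of_continuousOn_injOn h.cont.continuousOn (h.injOn.mono hAM)

theorem measurable_of_comp {β : Type*} [MeasurableSpace β] (h : IsTubeChart X J M) {F : E3 → β}
    {g : ℝ × E2 → β} (hg : Measurable g) {c : β} (hF : ∀ p ∈ Set.univ ×ˢ M, F (X p) = g p)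
    (hc : ∀ y ∉ X '' (Set.univ ×ˢ M), F y = c) : Measurable F := by
  have hΩ := h.measurableSet_image h.measurableSet_strip subset_rfl
  intro A hA
  have h1 := h.measurableSet_image (h.measurableSet_strip.inter (hg hA)) Set.inter_subset_left
  have h2 : MeasurableSet {y : E3 | c ∈ A} := MeasurableSet.const _
  convert! h1.union (hΩ.compl.inter h2) using 1
  ext y
  by_cases hy : y ∈ X '' (Set.univ ×ˢ M)
  · constructor
    · intro hyA
      obtain ⟨p, hp, rfl⟩ := hy
      rw [Set.mem_preimage, hF p hp] at hyA
      exact Or.inl ⟨p, ⟨hp, hyA⟩, rfl⟩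
    · rintro (⟨p, ⟨hp, hpA⟩, rfl⟩ | ⟨hn, -⟩)
      · rwa [Set.mem_preimage, hF p hp]
      · exact absurd hy hn
  · constructor
    · intro hyA
      rw [Set.mem_preimage, hc y hy] at hyA
      exact Or.inr ⟨hy, hyA⟩
    · rintro (⟨p, ⟨hp, hpA⟩, rfl⟩ | ⟨-, hn⟩)
      · exact absurd ⟨p, hp, rfl⟩ hy
      · rw [Set.mem_preimage, hc y hy]
        exact hn

theorem exists_extension {β : Type*} [MeasurableSpace β] (h : IsTubeChart X J M)
    {g : ℝ × E2 → β} (hg : Measurable g) (c : β) : ∃ F : E3 → β, Measurable F ∧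
      (∀ p ∈ Set.univ ×ˢ M, F (X p) = g p) ∧ ∀ y ∉ X '' (Set.univ ×ˢ M), F y = c := by
  classical
  refine ⟨fun y => if y ∈ X '' (Set.univ ×ˢ M) then g (Function.invFunOn X (Set.univ ×ˢ M) y)
    else c, ?_⟩
  have h1 : ∀ p ∈ Set.univ ×ˢ M, (if X p ∈ X '' (Set.univ ×ˢ M) then
      g (Function.invFunOn X (Set.univ ×ˢ M) (X p)) else c) = g p := by
    intro p hp
    rw [if_pos ⟨p, hp, rfl⟩, h.injOn (Function.invFunOn_mem ⟨p, hp, rfl⟩) hp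
      (Function.invFunOn_eq ⟨p, hp, rfl⟩)]
  have h2 : ∀ y ∉ X '' (Set.univ ×ˢ M), (if y ∈ X '' (Set.univ ×ˢ M) then
      g (Function.invFunOn X (Set.univ ×ˢ M) y) else c) = c := fun y hy => if_neg hy
  exact ⟨h.measurable_of_comp hg h1 h2, h1, h2⟩

/-- Integrals against a function supported in the tube, in the coordinates of the tube. -/
theorem lintegral_eq (h : IsTubeChart X J M) {F : E3 → ℝ≥0∞} (hF : Measurable F)
    (hF0 : ∀ y ∉ X '' (Set.univ ×ˢ M), F y = 0) {G : ℝ → E2 → ℝ≥0∞}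
    (hG0 : ∀ s, ∀ u ∉ M, G s u = 0)
    (hG : ∀ s, ∀ u ∈ M, ENNReal.ofReal (J (s, u)) * F (X (s, u)) = G s u) :
    ∫⁻ y, F y = ∫⁻ s, ∫⁻ u, G s u := by
  have hΩ := h.measurableSet_image h.measurableSet_strip subset_rfl
  have hGe : (fun p : ℝ × E2 => G p.1 p.2) = (Set.univ ×ˢ M).indicator
      fun p => ENNReal.ofReal (J p) * F (X p) := by
    ext ⟨s, u⟩
    by_cases hu : u ∈ M
    · rw [Set.indicator_of_mem (show (s, u) ∈ Set.univ ×ˢ M from ⟨trivial, hu⟩), hG s u hu]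
    · rw [Set.indicator_of_notMem (fun hm => hu hm.2), hG0 s u hu]
  have hGm : Measurable fun p : ℝ × E2 => G p.1 p.2 := by
    rw [hGe]
    exact (h.cont_jac.measurable.ennreal_ofReal.mul (hF.comp h.cont.measurable)).indicator
      h.measurableSet_strip
  have h1 : ∫⁻ y, F y = ∫⁻ y in X '' (Set.univ ×ˢ M), F y := by
    rw [← lintegral_indicator hΩ]
    congr 1
    ext y
    by_cases hy : y ∈ X '' (Set.univ ×ˢ M)
    · rw [Set.indicator_of_mem hy]
    · rw [Set.indicator_of_notMem hy, hF0 y hy]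
  rw [h1, h.lintegral_image, ← lintegral_indicator h.measurableSet_strip, ← hGe]
  exact lintegral_prod (fun p : ℝ × E2 => G p.1 p.2) hGm.aemeasurable

end IsTubeChart


/-! ### The Schur bound far out in the tube -/

theorem exists_tail_resK {E : Type*} [NormedAddCommGroup E] [InnerProductSpace ℝ E]
    [FiniteDimensional ℝ E] [MeasurableSpace E] [BorelSpace E] {κ : ℝ} (hκ : 0 < κ) {ε : ℝ≥0∞}
    (hε : ε ≠ 0) : ∃ R : ℝ, ∫⁻ z : E, {z : E | R ≤ ‖z‖}.indicator (resK κ) z ≤ ε := by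
  have hm : ∀ n : ℕ, MeasurableSet {z : E | (n : ℝ) ≤ ‖z‖} := fun n =>
    measurableSet_le measurable_const measurable_norm
  have h1 := tendsto_lintegral_of_dominated_convergence (μ := (volume : Measure E))
    (F := fun (n : ℕ) z => {z : E | (n : ℝ) ≤ ‖z‖}.indicator (resK κ) z) (f := 0) (resK κ)
    (fun n => (measurable_resK κ).indicator (hm n))
    (fun n => ae_of_all _ fun z => Set.indicator_le_self _ _ z)
    (by rw [lintegral_resK hκ]; exact ENNReal.ofReal_ne_top) (ae_of_all _ fun z => ?_)
  · simp only [Pi.zero_apply, lintegral_zero] at h1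
    obtain ⟨n, hn⟩ := (h1.eventually_lt_const (pos_iff_ne_zero.2 hε)).exists
    exact ⟨n, hn.le⟩
  · refine tendsto_const_nhds.congr' ?_
    obtain ⟨m, hm⟩ := exists_nat_gt ‖z‖
    filter_upwards [eventually_ge_atTop m] with n hn
    rw [Set.indicator_of_notMem, Pi.zero_apply]
    simp only [Set.mem_ofPred_eq, not_le]
    exact hm.trans_le (by exact_mod_cast hn)

/-- Shrinking distances by `1 - δ` costs the factor `(1 - δ)⁻¹` and lowers `κ` to `κ(1 - δ)`, which
still dominates `κ₁`. -/
theorem resK_le_of_mul_norm_le {κ κ₁ δ : ℝ} (hκ₁ : 0 < κ₁) (hδ : δ < 1) (hκ : 0 < κ)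
    (hle : κ₁ ≤ κ * (1 - δ)) {z z₀ : E3} (hz₀ : z₀ ≠ 0) (hz : (1 - δ) * ‖z₀‖ ≤ ‖z‖) :
    resK κ z ≤ ENNReal.ofReal (1 - δ)⁻¹ * resK κ₁ z₀ := by
  have hq : 0 < 1 - δ := by linarith
  have hr : 0 < ‖z₀‖ := norm_pos_iff.2 hz₀
  have hz' : z ≠ 0 := norm_pos_iff.1 (lt_of_lt_of_le (mul_pos hq hr) hz)
  calc resK κ z = ENNReal.ofReal (yukawa κ ‖z‖) := resK_three hκ hz'
    _ ≤ ENNReal.ofReal (yukawa κ ((1 - δ) * ‖z₀‖)) :=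
      ENNReal.ofReal_le_ofReal (yukawa_anti hκ.le (mul_pos hq hr) hz)
    _ = ENNReal.ofReal (1 - δ)⁻¹ * resK (κ * (1 - δ)) z₀ := by
      rw [yukawa_mul hq, ENNReal.ofReal_mul (inv_nonneg.2 hq.le), resK_three (mul_pos hκ hq) hz₀]
    _ ≤ _ := by
      gcongr
      exact resK_anti hκ₁.le hle _

namespace TransverseState

variable {M : Set E2} {V φ : E2 → ℝ} {κ₀ C B : ℝ}

/-- Raising `κ₀` to `κ₁` lowers the kernel on `M - M` by a fixed amount, and this is integrated
against the nonzero mass of `Vφ`. The minimum with one only keeps the constant finite. -/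
theorem exists_gap (st : TransverseState M V φ κ₀ C B) (hM : Bornology.IsBounded M)
    (hκ₀ : 0 < κ₀) {κ₁ : ℝ} (h : κ₀ < κ₁) : ∃ c : ℝ, 0 < c ∧ ∀ u ∈ M,
      (∫⁻ u', resK κ₁ (u - u') * ENNReal.ofReal (V u' * φ u')) + ENNReal.ofReal c ≤
        ENNReal.ofReal (φ u) := by
  obtain ⟨ρ, hρ⟩ := hM.exists_norm_le
  obtain ⟨c, hc, hcle⟩ := exists_add_le_resK (E := E2) hκ₀ h (ρ + ρ)
  set m : ℝ≥0∞ := ∫⁻ u, ENNReal.ofReal (V u * φ u) with hm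
  have hgm : Measurable fun u => ENNReal.ofReal (V u * φ u) :=
    (st.pot.meas.mul st.meas).ennreal_ofReal
  have hfin : min (c * m) 1 ≠ ∞ := ne_top_of_le_ne_top ENNReal.one_ne_top (min_le_right _ _)
  have hne : min (c * m) 1 ≠ 0 := by
    rw [Ne, ← nonpos_iff_eq_zero, min_le_iff, not_or]
    exact ⟨by simpa using ⟨hc, st.ne_zero⟩, by simp⟩
  refine ⟨(min (c * m) 1).toReal, ENNReal.toReal_pos hne hfin, fun u hu => ?_⟩
  rw [ENNReal.ofReal_toReal hfin, st.eqn u]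
  refine (add_le_add_right (min_le_left (c * m) 1) _).trans ?_
  rw [hm, ← lintegral_const_mul _ hgm, ← lintegral_add_right _ (hgm.const_mul c)]
  refine lintegral_mono fun u' => ?_
  dsimp only
  rw [← add_mul]
  by_cases hu' : u' ∈ M
  · gcongr
    exact hcle _ ((norm_sub_le _ _).trans (add_le_add (hρ u hu) (hρ u' hu')))
  · simp [st.supp u' hu']

end TransverseState

namespace IsTubeChart

variable {X : ℝ × E2 → E3} {J : ℝ × E2 → ℝ} {M : Set E2} {V φ : E2 → ℝ} {κ₀ C B : ℝ} {U : E3 → ℝ}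

theorem bddPotential (h : IsTubeChart X J M) (hV : BddPotential V C)
    (hUX : ∀ s, ∀ u ∈ M, U (X (s, u)) = V u) (hU0 : ∀ y ∉ X '' (Set.univ ×ˢ M), U y = 0) :
    BddPotential U C := by
  refine ⟨h.measurable_of_comp (hV.meas.comp measurable_snd)
    (fun p hp => hUX p.1 p.2 hp.2) hU0, fun y => ?_, fun y => ?_⟩
  · by_cases hy : y ∈ X '' (Set.univ ×ˢ M)
    · obtain ⟨⟨s, u⟩, hp, rfl⟩ := hy
      rw [hUX s u hp.2]
      exact hV.nonneg u
    · exact (hU0 y hy).ge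
  · by_cases hy : y ∈ X '' (Set.univ ×ˢ M)
    · obtain ⟨⟨s, u⟩, hp, rfl⟩ := hy
      rw [hUX s u hp.2]
      exact hV.le u
    · exact (hU0 y hy).trans_le hV.const_nonneg

theorem volume_image_Icc_lt_top (h : IsTubeChart X J M) (S : ℝ) :
    volume (X '' ({s | |s| ≤ S} ×ˢ M)) < ∞ := by
  have hc : IsCompact (X '' (Set.Icc (-S) S ×ˢ closure M)) :=
    (isCompact_Icc.prod h.bounded.isCompact_closure).image h.cont
  refine lt_of_le_of_lt (measure_mono (Set.image_mono (Set.prod_mono ?_ subset_closure)))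
    hc.measure_lt_top
  exact fun s hs => abs_le.1 hs

/-- The part of the Schur integral near the diagonal is controlled by the transverse kernel. -/
theorem lintegral_near_le (h : IsTubeChart X J M) (st : TransverseState M V φ κ₀ C B)
    {κ κ₁ δ S R T : ℝ} (hκ : 0 < κ) (hκ₁ : 0 < κ₁) (hδ0 : 0 < δ) (hδ1 : δ < 1)
    (hle : κ₁ ≤ κ * (1 - δ)) (hJ : ∀ s, S < |s| → ∀ u ∈ M, J (s, u) ≤ 1 + δ)
    (hnear : ∀ s s', S < |s| → S < |s'| → |s - s'| ≤ T → ∀ u ∈ M, ∀ u' ∈ M,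
      (1 - δ) * ‖straightMap s u - straightMap s' u'‖ ≤ ‖X (s, u) - X (s', u')‖)
    (hfar : ∀ s s', T ≤ |s - s'| → ∀ u ∈ M, ∀ u' ∈ M, R ≤ ‖X (s, u) - X (s', u')‖)
    {F : E3 → ℝ≥0∞} (hF : Measurable F) (hF0 : ∀ y ∉ X '' (Set.univ ×ˢ M), F y = 0)
    {s : ℝ} (hs : S < |s|) {u : E2} (hu : u ∈ M)
    (hFle : ∀ s', ∀ u' ∈ M, F (X (s', u')) ≤
      resK κ (X (s, u) - X (s', u')) * ENNReal.ofReal (V u' * φ u'))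
    (hFS : ∀ s', |s'| ≤ S → ∀ u' ∈ M, F (X (s', u')) = 0)
    (hFR : ∀ s', ∀ u' ∈ M, R ≤ ‖X (s, u) - X (s', u')‖ → F (X (s', u')) = 0) :
    ∫⁻ y, F y ≤ ENNReal.ofReal ((1 + δ) * (1 - δ)⁻¹) *
      ∫⁻ u', resK κ₁ (u - u') * ENNReal.ofReal (V u' * φ u') := by
  classical
  have hgm : Measurable fun u => ENNReal.ofReal (V u * φ u) :=
    (st.pot.meas.mul st.meas).ennreal_ofReal
  have hKm : Measurable fun p : ℝ × E2 => resK κ₁ (straightMap (s - p.1) (u - p.2)) := by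
    refine (measurable_resK κ₁).comp (Continuous.measurable ?_)
    unfold straightMap
    fun_prop
  rw [h.lintegral_eq hF hF0
    (G := fun s' u' => if u' ∈ M then ENNReal.ofReal (J (s', u')) * F (X (s', u')) else 0)
    (fun s' u' hu' => if_neg hu') (fun s' u' hu' => (if_pos hu').symm)]
  calc _ ≤ ∫⁻ s', ∫⁻ u', ENNReal.ofReal ((1 + δ) * (1 - δ)⁻¹) *
        (resK κ₁ (straightMap (s - s') (u - u')) * ENNReal.ofReal (V u' * φ u')) := by
        refine lintegral_mono_ae ?_
        -- The section `s' = s` is null; off it the straight points differ, as the explicit kernel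
        -- requires.
        filter_upwards [compl_mem_ae_iff.2 (measure_singleton s)] with s' hs'
        refine lintegral_mono fun u' => ?_
        by_cases hu' : u' ∈ M
        swap
        · simp [hu']
        rw [if_pos hu']
        by_cases h1 : |s'| ≤ S
        · simp [hFS s' h1 u' hu']
        by_cases h2 : R ≤ ‖X (s, u) - X (s', u')‖
        · simp [hFR s' u' hu' h2]
        push Not at h1 h2
        have h3 : |s - s'| ≤ T := by
          by_contra! hcon
          exact absurd (hfar s s' hcon.le u hu u' hu') (not_le.2 h2)
        have hne : straightMap s u - straightMap s' u' ≠ 0 := by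
          intro h0
          have := congrArg (fun y : E3 => y 0) h0
          simp [straightMap, sub_eq_zero] at this
          exact hs' this.symm
        have h4 := resK_le_of_mul_norm_le hκ₁ hδ1 hκ hle hne (hnear s s' hs h1 h3 u hu u' hu')
        rw [straightMap_sub] at h4
        calc ENNReal.ofReal (J (s', u')) * F (X (s', u'))
            ≤ ENNReal.ofReal (1 + δ) * ((ENNReal.ofReal (1 - δ)⁻¹ *
              resK κ₁ (straightMap (s - s') (u - u'))) * ENNReal.ofReal (V u' * φ u')) := by
              gcongr
              · exact hJ s' h1 u' hu'
              · exact (hFle s' u' hu').trans (by gcongr)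
          _ = _ := by
              rw [ENNReal.ofReal_mul (show 0 ≤ 1 + δ by linarith)]
              simp only [mul_assoc]
    _ = ENNReal.ofReal ((1 + δ) * (1 - δ)⁻¹) * ∫⁻ u', ∫⁻ s',
        resK κ₁ (straightMap (s - s') (u - u')) * ENNReal.ofReal (V u' * φ u') := by
        rw [lintegral_lintegral_swap ((hKm.mul (hgm.comp measurable_snd)).const_mul _).aemeasurable]
        rw [← lintegral_const_mul' _ _ ENNReal.ofReal_ne_top]
        refine lintegral_congr fun u' => ?_
        rw [← lintegral_const_mul' _ _ ENNReal.ofReal_ne_top]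
    _ = _ := by
        congr 1
        refine lintegral_congr fun u' => ?_
        rw [lintegral_mul_const' _ _ ENNReal.ofReal_ne_top,
          lintegral_sub_left_eq_self (fun σ => resK κ₁ (straightMap σ (u - u'))) s,
          lintegral_resK_straightMap]

/-- The Schur condition outside a bounded part of the tube, above the transverse threshold. -/
theorem exists_schur (h : IsTubeChart X J M) (st : TransverseState M V φ κ₀ C B) (hκ₀ : 0 < κ₀)
    (hUX : ∀ s, ∀ u ∈ M, U (X (s, u)) = V u) (hU0 : ∀ y ∉ X '' (Set.univ ×ˢ M), U y = 0)
    {κ : ℝ} (hκ : κ₀ < κ) :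
    ∃ D, MeasurableSet D ∧ volume D < ∞ ∧ ∃ w : E3 → ℝ≥0∞, Measurable w ∧ (∀ y, w y ≠ 0) ∧
      (∀ y, w y ≠ ∞) ∧ ∃ q < 1,
      ∀ᵐ y ∂(volume.withDensity fun y => ENNReal.ofReal (Dᶜ.indicator U y)),
        ∫⁻ y', resK κ (y - y') * w y'
          ∂(volume.withDensity fun y => ENNReal.ofReal (Dᶜ.indicator U y)) ≤ q * w y := by
  have hU := h.bddPotential st.pot hUX hU0
  have hB : 0 < B := (st.pos 0).trans_le (st.le 0)
  have hC := st.pot.const_nonneg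
  have hκ0 : 0 < κ := hκ₀.trans hκ
  obtain ⟨c, hc, hgap⟩ := st.exists_gap h.bounded hκ₀ (κ₁ := (κ₀ + κ) / 2) (by linarith)
  set κ₁ := (κ₀ + κ) / 2 with hκ₁def
  have hκ₁ : 0 < κ₁ := by positivity
  -- the near-isometry constant
  obtain ⟨δ, hδ0, hδ1, hδκ, hδB⟩ : ∃ δ : ℝ, 0 < δ ∧ δ < 1 ∧ κ₁ ≤ κ * (1 - δ) ∧
      ((1 + δ) * (1 - δ)⁻¹ - 1) * B ≤ c / 4 := by
    have e1 : ∀ᶠ δ : ℝ in 𝓝[>] 0, δ < 1 :=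
      (eventually_lt_nhds one_pos).filter_mono nhdsWithin_le_nhds
    have e2 : ∀ᶠ δ : ℝ in 𝓝[>] 0, κ₁ < κ * (1 - δ) := by
      have : Tendsto (fun δ : ℝ => κ * (1 - δ)) (𝓝 0) (𝓝 (κ * (1 - 0))) :=
        Continuous.tendsto (by fun_prop) 0
      exact (this.eventually_const_lt (by rw [sub_zero, mul_one]; linarith)).filter_mono
        nhdsWithin_le_nhds
    have e3 : ∀ᶠ δ : ℝ in 𝓝[>] 0, ((1 + δ) * (1 - δ)⁻¹ - 1) * B < c / 4 := by
      have : Tendsto (fun δ : ℝ => ((1 + δ) * (1 - δ)⁻¹ - 1) * B) (𝓝 0)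
          (𝓝 (((1 + 0) * (1 - 0)⁻¹ - 1) * B)) :=
        ContinuousAt.tendsto (by fun_prop (disch := norm_num))
      exact (this.eventually_lt_const (by simp; positivity)).filter_mono nhdsWithin_le_nhds
    obtain ⟨δ, h1, h2, h3, h4⟩ := (e1.and (e2.and (e3.and self_mem_nhdsWithin))).exists
    exact ⟨δ, h4, h1, h2.le, h3.le⟩
  -- Since `U w ≤ C B` on the tube, points beyond distance `R` contribute at most `c/4`; the `+ 1`
  -- covers `C B = 0`. Then `R` determines `T`, and `δ` and `T` determine `S`.
  obtain ⟨R, hR⟩ := exists_tail_resK (E := E3) hκ0 (ε := ENNReal.ofReal (c / (4 * (C * B + 1))))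
    (ENNReal.ofReal_pos.2 (by positivity)).ne'
  obtain ⟨T, hT⟩ := h.far R
  obtain ⟨S₁, hS₁⟩ := h.near δ hδ0 T
  obtain ⟨S₂, hS₂⟩ := h.jac_le δ hδ0
  set S := max S₁ S₂ with hSdef
  have hl : S₁ ≤ S := le_max_left _ _
  have hr : S₂ ≤ S := le_max_right _ _
  set D := X '' ({s | |s| ≤ S} ×ˢ M) with hDdef
  have hDm : MeasurableSet D := by
    refine h.measurableSet_image (MeasurableSet.prod ?_ h.isOpen.measurableSet)
      (Set.prod_mono (Set.subset_univ _) subset_rfl)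
    exact measurableSet_le measurable_abs measurable_const
  -- The weight is the ground state transported along the tube; its value one elsewhere only keeps
  -- it nonzero.
  obtain ⟨w, hwm, hwX, hw1⟩ := h.exists_extension
    (g := fun p : ℝ × E2 => ENNReal.ofReal (φ p.2)) (st.meas.comp measurable_snd).ennreal_ofReal 1
  have hwX' : ∀ s, ∀ u ∈ M, w (X (s, u)) = ENNReal.ofReal (φ u) :=
    fun s u hu => hwX (s, u) ⟨trivial, hu⟩
  -- The near-isometry error and the tail each use `c/4` of the gap `c`. The remaining `c/2` is at
  -- least `(c/(2B))φ` because `φ ≤ B`, whence `q`.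
  refine ⟨D, hDm, h.volume_image_Icc_lt_top S, w, hwm, fun y => ?_, fun y => ?_,
    ENNReal.ofReal (1 - c / (2 * B)), ?_, ?_⟩
  · by_cases hy : y ∈ X '' (Set.univ ×ˢ M)
    · obtain ⟨⟨s, u⟩, hp, rfl⟩ := hy
      rw [hwX' s u hp.2]
      exact (ENNReal.ofReal_pos.2 (st.pos u)).ne'
    · rw [hw1 y hy]
      exact one_ne_zero
  · by_cases hy : y ∈ X '' (Set.univ ×ˢ M)
    · obtain ⟨⟨s, u⟩, hp, rfl⟩ := hy
      rw [hwX' s u hp.2]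
      exact ENNReal.ofReal_ne_top
    · rw [hw1 y hy]
      exact ENNReal.one_ne_top
  · rw [ENNReal.ofReal_lt_one]
    have : 0 < c / (2 * B) := by positivity
    linarith
  have hUD := hU.indicator hDm.compl
  rw [ae_withDensity_iff hUD.meas.ennreal_ofReal]
  refine ae_of_all _ fun y hy => ?_
  have hyD : y ∈ Dᶜ := by
    by_contra hcon
    rw [Set.indicator_of_notMem hcon] at hy
    simp at hy
  rw [Set.indicator_of_mem hyD] at hy
  obtain ⟨⟨s, u⟩, ⟨-, hu⟩, rfl⟩ : y ∈ X '' (Set.univ ×ˢ M) := by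
    by_contra hcon
    rw [hU0 y hcon] at hy
    simp at hy
  replace hu : u ∈ M := hu
  have hs : S < |s| := by
    by_contra! hcon
    exact hyD ⟨(s, u), ⟨hcon, hu⟩, rfl⟩
  have hDS : ∀ s', |s'| ≤ S → ∀ u' ∈ M, X (s', u') ∈ D := fun s' hs' u' hu' =>
    ⟨(s', u'), ⟨hs', hu'⟩, rfl⟩
  have hKm : Measurable fun y' => resK κ (X (s, u) - y') :=
    (measurable_resK κ).comp (measurable_const.sub measurable_id)
  rw [lintegral_withDensity_potential hUD (F := fun y' => resK κ (X (s, u) - y') * w y')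
    (hKm.mul hwm).aemeasurable]
  -- Points of `A` go into the tail. The complement meets the tube only at longitudinal distance at
  -- most `T`, where the near-isometry applies.
  set A : Set E3 := {y' | R ≤ ‖X (s, u) - y'‖} with hA
  have hAm : MeasurableSet A :=
    measurableSet_le measurable_const (measurable_const.sub measurable_id).norm
  set F : E3 → ℝ≥0∞ := Aᶜ.indicator fun y' =>
    ENNReal.ofReal (Dᶜ.indicator U y') * (resK κ (X (s, u) - y') * w y') with hF
  have hFm : Measurable F :=
    (hUD.meas.ennreal_ofReal.mul (hKm.mul hwm)).indicator hAm.compl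
  have hsplit : ∀ y', ENNReal.ofReal (Dᶜ.indicator U y') * (resK κ (X (s, u) - y') * w y') ≤
      F y' + ENNReal.ofReal (C * B) *
        {z : E3 | R ≤ ‖z‖}.indicator (resK κ) (X (s, u) - y') := by
    intro y'
    by_cases hyA : y' ∈ A
    · refine le_add_left ?_
      rw [Set.indicator_of_mem (show X (s, u) - y' ∈ {z : E3 | R ≤ ‖z‖} from hyA)]
      by_cases hy' : y' ∈ X '' (Set.univ ×ˢ M)
      · obtain ⟨⟨s', u'⟩, ⟨-, hu'⟩, rfl⟩ := hy'
        rw [hwX' s' u' hu', ENNReal.ofReal_mul hC, mul_comm (resK _ _), ← mul_assoc]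
        gcongr
        · exact hUD.le _
        · exact st.le u'
      · have : Dᶜ.indicator U y' = 0 := by
          rw [Set.indicator_apply_eq_zero]
          exact fun _ => hU0 y' hy'
        simp [this]
    · refine le_add_right ?_
      rw [hF, Set.indicator_of_mem (show y' ∈ Aᶜ from hyA)]
  have hF0 : ∀ y ∉ X '' (Set.univ ×ˢ M), F y = 0 := by
    intro y' hy'
    have : Dᶜ.indicator U y' = 0 := by
      rw [Set.indicator_apply_eq_zero]
      exact fun _ => hU0 y' hy'
    rw [hF, Set.indicator_apply_eq_zero]
    intro _
    simp [this]
  have hnear := h.lintegral_near_le st hκ0 hκ₁ hδ0 hδ1 hδκ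
    (fun s hs => hS₂ s (lt_of_le_of_lt hr hs))
    (fun s s' hs hs' => hS₁ s s' (lt_of_le_of_lt hl hs) (lt_of_le_of_lt hl hs')) hT hFm hF0 hs hu
    (fun s' u' hu' => by
      refine (Set.indicator_le_self _ _ _).trans ?_
      rw [hwX' s' u' hu', ENNReal.ofReal_mul (st.pot.nonneg u'), mul_left_comm, ← hUX s' u' hu']
      gcongr
      exact Set.indicator_le_self' (fun _ _ => hU.nonneg _) _)
    (fun s' hs' u' hu' => by
      rw [hF, Set.indicator_apply_eq_zero]
      intro _
      rw [Set.indicator_of_notMem (Set.notMem_compl_iff.2 (hDS s' hs' u' hu'))]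
      simp)
    (fun s' u' hu' hle => by
      rw [hF, Set.indicator_of_notMem (Set.notMem_compl_iff.2 (show X (s', u') ∈ A from hle))])
  set a := ∫⁻ u', resK κ₁ (u - u') * ENNReal.ofReal (V u' * φ u') with ha
  have hga : a + ENNReal.ofReal c ≤ ENNReal.ofReal (φ u) := hgap u hu
  have hafin : a ≠ ∞ := ne_top_of_le_ne_top ENNReal.ofReal_ne_top (le_self_add.trans hga)
  have har : a.toReal + c ≤ φ u := by
    rw [← ENNReal.ofReal_toReal hafin, ← ENNReal.ofReal_add ENNReal.toReal_nonneg hc.le] at hga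
    exact (ENNReal.ofReal_le_ofReal_iff (st.pos u).le).1 hga
  have htail : ∫⁻ y', ENNReal.ofReal (C * B) *
      {z : E3 | R ≤ ‖z‖}.indicator (resK κ) (X (s, u) - y') ≤ ENNReal.ofReal (c / 4) := by
    rw [lintegral_const_mul' _ _ ENNReal.ofReal_ne_top,
      lintegral_sub_left_eq_self ({z : E3 | R ≤ ‖z‖}.indicator (resK κ)) (X (s, u))]
    refine (mul_le_mul_right hR _).trans ?_
    rw [← ENNReal.ofReal_mul (by positivity)]
    refine ENNReal.ofReal_le_ofReal ?_
    rw [mul_div_assoc', div_le_div_iff₀ (by positivity) (by positivity)]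
    nlinarith
  rw [hwX' s u hu]
  calc ∫⁻ y', ENNReal.ofReal (Dᶜ.indicator U y') * (resK κ (X (s, u) - y') * w y')
      ≤ ∫⁻ y', F y' + ENNReal.ofReal (C * B) *
        {z : E3 | R ≤ ‖z‖}.indicator (resK κ) (X (s, u) - y') := lintegral_mono hsplit
    _ = (∫⁻ y', F y') + ∫⁻ y', ENNReal.ofReal (C * B) *
        {z : E3 | R ≤ ‖z‖}.indicator (resK κ) (X (s, u) - y') := lintegral_add_left hFm _
    _ ≤ ENNReal.ofReal ((1 + δ) * (1 - δ)⁻¹) * ENNReal.ofReal a.toReal +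
        ENNReal.ofReal (c / 4) := by
        rw [ENNReal.ofReal_toReal hafin]
        exact add_le_add hnear htail
    _ = ENNReal.ofReal ((1 + δ) * (1 - δ)⁻¹ * a.toReal + c / 4) := by
        have : 0 < 1 - δ := by linarith
        rw [← ENNReal.ofReal_mul (by positivity), ← ENNReal.ofReal_add (by positivity)
          (by positivity)]
    _ ≤ ENNReal.ofReal ((1 - c / (2 * B)) * φ u) := by
        refine ENNReal.ofReal_le_ofReal ?_
        have hφB := st.le u
        have ha0 : 0 ≤ a.toReal := ENNReal.toReal_nonneg
        have h1 : 1 ≤ (1 + δ) * (1 - δ)⁻¹ := by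
          have : 0 < 1 - δ := by linarith
          rw [← div_eq_mul_inv, one_le_div this]
          linarith
        have h2 : ((1 + δ) * (1 - δ)⁻¹ - 1) * a.toReal ≤ ((1 + δ) * (1 - δ)⁻¹ - 1) * B := by
          gcongr
          linarith
        have h3 : c / (2 * B) * φ u ≤ c / (2 * B) * B := by gcongr
        have h4 : c / (2 * B) * B = c / 2 := by field_simp
        nlinarith
    _ = _ := by
        refine ENNReal.ofReal_mul ?_
        have : c ≤ B := by linarith [st.le u, ENNReal.toReal_nonneg (a := a)]
        rw [sub_nonneg, div_le_one (by positivity)]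
        linarith

end IsTubeChart


/-! ### Longitudinal cut-off functions -/

/-- The tent function of half-width `n + 1`. -/
def tent (n : ℕ) (s : ℝ) : ℝ := max 0 (1 - |s| / (n + 1))

theorem tent_nonneg (n : ℕ) (s : ℝ) : 0 ≤ tent n s := le_max_left _ _

theorem tent_le_one (n : ℕ) (s : ℝ) : tent n s ≤ 1 :=
  max_le zero_le_one (by have : 0 ≤ |s| / ((n : ℝ) + 1) := by positivity
                         linarith)

theorem continuous_tent (n : ℕ) : Continuous (tent n) := by
  unfold tent
  fun_prop

theorem tent_eq_zero {n : ℕ} {s : ℝ} (h : (n : ℝ) + 1 ≤ |s|) : tent n s = 0 := by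
  refine max_eq_left ?_
  have : 1 ≤ |s| / ((n : ℝ) + 1) := (one_le_div (by positivity)).2 h
  linarith

theorem tent_mono (s : ℝ) : Monotone fun n => tent n s := by
  intro m n hmn
  have : (m : ℝ) ≤ n := by exact_mod_cast hmn
  refine max_le_max le_rfl (sub_le_sub_left ?_ 1)
  gcongr

theorem tendsto_tent (s : ℝ) : Tendsto (fun n => tent n s) atTop (𝓝 1) := by
  have h1 : Tendsto (fun n : ℕ => |s| * (1 / ((n : ℝ) + 1))) atTop (𝓝 0) := by
    simpa using tendsto_one_div_add_atTop_nhds_zero_nat.const_mul |s|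
  have h2 := (tendsto_const_nhds (x := (0 : ℝ))).max (h1.const_sub 1)
  simpa [tent, div_eq_mul_inv] using h2

theorem abs_tent_sub_le (n : ℕ) (s s' : ℝ) : |tent n s - tent n s'| ≤ |s - s'| / (n + 1) := by
  unfold tent
  refine (abs_max_sub_max_le_max _ _ _ _).trans ?_
  rw [sub_self, abs_zero, max_eq_right (abs_nonneg _), sub_sub_sub_cancel_left, ← sub_div, abs_div,
    abs_of_pos (show (0 : ℝ) < n + 1 by positivity)]
  refine div_le_div_of_nonneg_right ?_ (by positivity)
  rw [abs_sub_comm s s']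
  exact abs_abs_sub_abs_le_abs_sub s' s

/-- The tent has slope `1/(n+1)`, and the difference vanishes unless one point lies in the support.
Integration gives length of order `n` times slope squared `n⁻²`: an error `O(1/n)`. -/
theorem sq_tent_sub_le (n : ℕ) (s s' : ℝ) :
    ENNReal.ofReal ((tent n s - tent n s') ^ 2) ≤
      ENNReal.ofReal (((n : ℝ) + 1) ^ 2)⁻¹ * ((Set.Icc (-((n : ℝ) + 1)) (n + 1)).indicator 1 s +
        (Set.Icc (-((n : ℝ) + 1)) (n + 1)).indicator 1 s') * ENNReal.ofReal ((s - s') ^ 2) := by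
  by_cases h : (n : ℝ) + 1 ≤ |s| ∧ (n : ℝ) + 1 ≤ |s'|
  · rw [tent_eq_zero h.1, tent_eq_zero h.2]
    simp
  have h1 : (1 : ℝ≥0∞) ≤ (Set.Icc (-((n : ℝ) + 1)) (n + 1)).indicator 1 s +
      (Set.Icc (-((n : ℝ) + 1)) (n + 1)).indicator 1 s' := by
    rcases not_and_or.1 h with h | h
    · rw [Set.indicator_of_mem (show s ∈ Set.Icc (-((n : ℝ) + 1)) (n + 1) from
        abs_le.1 (not_le.1 h).le)]
      exact le_self_add
    · rw [Set.indicator_of_mem (show s' ∈ Set.Icc (-((n : ℝ) + 1)) (n + 1) from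
        abs_le.1 (not_le.1 h).le)]
      exact le_add_self
  calc ENNReal.ofReal ((tent n s - tent n s') ^ 2)
      ≤ ENNReal.ofReal ((((n : ℝ) + 1) ^ 2)⁻¹ * (s - s') ^ 2) := by
        refine ENNReal.ofReal_le_ofReal ?_
        rw [← sq_abs (tent n s - tent n s'), ← sq_abs (s - s')]
        have := pow_le_pow_left₀ (abs_nonneg _) (abs_tent_sub_le n s s') 2
        rwa [div_pow, div_eq_inv_mul] at this
    _ = ENNReal.ofReal (((n : ℝ) + 1) ^ 2)⁻¹ * 1 * ENNReal.ofReal ((s - s') ^ 2) := by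
        rw [mul_one, ENNReal.ofReal_mul (by positivity)]
    _ ≤ _ := by gcongr

theorem lintegral_tent_sq_lt_top (n : ℕ) : ∫⁻ s, ENNReal.ofReal (tent n s ^ 2) < ∞ := by
  have h1 : ∀ s, ENNReal.ofReal (tent n s ^ 2) ≤
      (Set.Icc (-((n : ℝ) + 1)) (n + 1)).indicator 1 s := by
    intro s
    by_cases hs : s ∈ Set.Icc (-((n : ℝ) + 1)) (n + 1)
    · rw [Set.indicator_of_mem hs, Pi.one_apply, ENNReal.ofReal_le_one]
      exact pow_le_one₀ (tent_nonneg n s) (tent_le_one n s)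
    · have : (n : ℝ) + 1 ≤ |s| := by
        by_contra! hcon
        exact hs (abs_le.1 hcon.le)
      rw [tent_eq_zero this]
      simp
  refine lt_of_le_of_lt (lintegral_mono h1) ?_
  rw [lintegral_indicator_one measurableSet_Icc, Real.volume_Icc]
  exact ENNReal.ofReal_lt_top

/-! ### Convolution forms tested on wide tents. -/

section Abstract

variable {β : ℝ → ℝ≥0∞}

theorem lintegral_mul_conv_left (hβ : Measurable β) {g : ℝ → ℝ≥0∞} (hg : Measurable g) :
    ∫⁻ p : ℝ × ℝ, g p.1 * β (p.1 - p.2) = (∫⁻ s, g s) * ∫⁻ σ, β σ := by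
  have hm : Measurable fun p : ℝ × ℝ => g p.1 * β (p.1 - p.2) :=
    (hg.comp measurable_fst).mul (hβ.comp (measurable_fst.sub measurable_snd))
  rw [Measure.volume_eq_prod, lintegral_prod _ hm.aemeasurable, ← lintegral_mul_const _ hg]
  refine lintegral_congr fun s => ?_
  have h1 : Measurable fun σ => β (s - σ) := hβ.comp (measurable_const.sub measurable_id)
  dsimp only
  rw [lintegral_const_mul _ h1,
    lintegral_sub_left_eq_self β s]

theorem lintegral_mul_conv_right (hβ : Measurable β) {g : ℝ → ℝ≥0∞} (hg : Measurable g) :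
    ∫⁻ p : ℝ × ℝ, g p.2 * β (p.1 - p.2) = (∫⁻ s, g s) * ∫⁻ σ, β σ := by
  have hm : Measurable fun p : ℝ × ℝ => g p.2 * β (p.1 - p.2) :=
    (hg.comp measurable_snd).mul (hβ.comp (measurable_fst.sub measurable_snd))
  rw [Measure.volume_eq_prod, lintegral_prod_symm _ hm.aemeasurable, ← lintegral_mul_const _ hg]
  refine lintegral_congr fun s => ?_
  have h1 : Measurable fun σ => β (σ - s) := hβ.comp (measurable_id.sub measurable_const)
  dsimp only
  rw [lintegral_const_mul _ h1,
    lintegral_sub_right_eq_self β s]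

theorem lintegral_tent_sub_sq_le (hβ : Measurable β) (n : ℕ) :
    ∫⁻ p : ℝ × ℝ, ENNReal.ofReal ((tent n p.1 - tent n p.2) ^ 2) * β (p.1 - p.2) ≤
      ENNReal.ofReal (4 / ((n : ℝ) + 1)) * ∫⁻ σ, ENNReal.ofReal (σ ^ 2) * β σ := by
  set I : ℝ → ℝ≥0∞ := (Set.Icc (-((n : ℝ) + 1)) (n + 1)).indicator 1 with hI
  have hIm : Measurable I := measurable_one.indicator measurableSet_Icc
  set β₂ : ℝ → ℝ≥0∞ := fun σ => ENNReal.ofReal (σ ^ 2) * β σ with hβ₂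
  have hβ₂m : Measurable β₂ := (measurable_id.pow_const 2).ennreal_ofReal.mul hβ
  have hIint : ∫⁻ s, I s = ENNReal.ofReal (2 * ((n : ℝ) + 1)) := by
    rw [hI, lintegral_indicator_one measurableSet_Icc, Real.volume_Icc]
    congr 1
    ring
  have hm : Measurable fun p : ℝ × ℝ => I p.1 * β₂ (p.1 - p.2) :=
    (hIm.comp measurable_fst).mul (hβ₂m.comp (measurable_fst.sub measurable_snd))
  calc _ ≤ ∫⁻ p : ℝ × ℝ, ENNReal.ofReal (((n : ℝ) + 1) ^ 2)⁻¹ *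
        (I p.1 * β₂ (p.1 - p.2) + I p.2 * β₂ (p.1 - p.2)) := by
        refine lintegral_mono fun p => ?_
        refine (mul_le_mul_left (sq_tent_sub_le n p.1 p.2) _).trans_eq ?_
        simp only [hβ₂]
        ring
    _ = ENNReal.ofReal (((n : ℝ) + 1) ^ 2)⁻¹ *
        (ENNReal.ofReal (2 * ((n : ℝ) + 1)) * (∫⁻ σ, β₂ σ) +
          ENNReal.ofReal (2 * ((n : ℝ) + 1)) * ∫⁻ σ, β₂ σ) := by
        rw [lintegral_const_mul' _ _ ENNReal.ofReal_ne_top, lintegral_add_left hm,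
          lintegral_mul_conv_left hβ₂m hIm, lintegral_mul_conv_right hβ₂m hIm, hIint]
    _ = _ := by
        rw [← add_mul, ← mul_assoc, ← ENNReal.ofReal_add (by positivity) (by positivity),
          ← ENNReal.ofReal_mul (by positivity)]
        congr 2
        field_simp
        ring

/-- The identity `χ² + χ'² = 2χχ' + (χ - χ')²`, integrated against `β(s - s')` and written without
subtraction so that it makes sense for extended values. -/
theorem lintegral_tent_sq_eq (hβ : Measurable β) (n : ℕ) :
    (∫⁻ s, ENNReal.ofReal (tent n s ^ 2)) * (∫⁻ σ, β σ) +
      (∫⁻ s, ENNReal.ofReal (tent n s ^ 2)) * (∫⁻ σ, β σ) =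
    (∫⁻ p : ℝ × ℝ, ENNReal.ofReal (tent n p.1 * tent n p.2) * β (p.1 - p.2)) +
      (∫⁻ p : ℝ × ℝ, ENNReal.ofReal (tent n p.1 * tent n p.2) * β (p.1 - p.2)) +
      ∫⁻ p : ℝ × ℝ, ENNReal.ofReal ((tent n p.1 - tent n p.2) ^ 2) * β (p.1 - p.2) := by
  have ht : Measurable (tent n) := (continuous_tent n).measurable
  have hb : Measurable fun p : ℝ × ℝ => β (p.1 - p.2) :=
    hβ.comp (measurable_fst.sub measurable_snd)
  have h1 : Measurable fun s => ENNReal.ofReal (tent n s ^ 2) := (ht.pow_const 2).ennreal_ofReal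
  have h2 : Measurable fun p : ℝ × ℝ =>
      ENNReal.ofReal (tent n p.1 * tent n p.2) * β (p.1 - p.2) :=
    ((ht.comp measurable_fst).mul (ht.comp measurable_snd)).ennreal_ofReal.mul hb
  have h3 : Measurable fun p : ℝ × ℝ => ENNReal.ofReal (tent n p.1 ^ 2) * β (p.1 - p.2) :=
    (h1.comp measurable_fst).mul hb
  have h4 : Measurable fun p : ℝ × ℝ =>
      ENNReal.ofReal (tent n p.1 * tent n p.2) * β (p.1 - p.2) +
        ENNReal.ofReal (tent n p.1 * tent n p.2) * β (p.1 - p.2) := h2.add h2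
  rw [← lintegral_add_left h2, ← lintegral_add_left h4]
  nth_rewrite 1 [← lintegral_mul_conv_left hβ h1]
  rw [← lintegral_mul_conv_right hβ h1, ← lintegral_add_left h3]
  refine lintegral_congr fun p => ?_
  have a1 := tent_nonneg n p.1
  have a2 := tent_nonneg n p.2
  rw [← add_mul, ← add_mul, ← add_mul, ← ENNReal.ofReal_add (by positivity) (by positivity),
    ← ENNReal.ofReal_add (by positivity) (by positivity),
    ← ENNReal.ofReal_add (by positivity) (by positivity)]
  congr 2
  ring

/-- A positive integral of the difference of a kernel and a convolution kernel makes the form of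
the kernel on a wide cut-off function exceed the total mass of the convolution kernel. -/
theorem exists_tent_lt (hβ : Measurable β) (hP : ∫⁻ σ, β σ ≠ ∞)
    (hm2 : ∫⁻ σ, ENNReal.ofReal (σ ^ 2) * β σ ≠ ∞) {a : ℝ × ℝ → ℝ≥0∞} (ha : Measurable a)
    {F : ℝ × ℝ → ℝ} (hF : Measurable F)
    (hid : ∀ᵐ p : ℝ × ℝ, a p < ∞ →
      ENNReal.ofReal (F p) + β (p.1 - p.2) = a p + ENNReal.ofReal (-F p))
    (hpos : HasPositiveIntegral F) :
    ∃ n, (∫⁻ s, ENNReal.ofReal (tent n s ^ 2)) * ∫⁻ σ, β σ <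
      ∫⁻ p : ℝ × ℝ, ENNReal.ofReal (tent n p.1 * tent n p.2) * a p := by
  by_contra! hcon
  have ht : ∀ n, Measurable (tent n) := fun n => (continuous_tent n).measurable
  have hb : Measurable fun p : ℝ × ℝ => β (p.1 - p.2) :=
    hβ.comp (measurable_fst.sub measurable_snd)
  have hw : ∀ n, Measurable fun p : ℝ × ℝ => ENNReal.ofReal (tent n p.1 * tent n p.2) := fun n =>
    (((ht n).comp measurable_fst).mul ((ht n).comp measurable_snd)).ennreal_ofReal
  have hXfin : ∀ n, (∫⁻ s, ENNReal.ofReal (tent n s ^ 2)) * ∫⁻ σ, β σ ≠ ∞ := fun n =>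
    ENNReal.mul_ne_top (lintegral_tent_sq_lt_top n).ne hP
  -- If `a` were infinite on a set of positive measure, the right side would already be infinite for
  -- some tent. Hence the identity relating `F` to `a` and `β` is available almost everywhere.
  have hafin : ∀ᵐ p, a p < ∞ := by
    have h1 : ∀ᵐ p : ℝ × ℝ, ∀ n, ENNReal.ofReal (tent n p.1 * tent n p.2) * a p < ∞ := by
      rw [ae_all_iff]
      intro n
      exact ae_lt_top ((hw n).mul ha) (ne_top_of_le_ne_top (hXfin n) (hcon n))
    filter_upwards [h1] with p hp
    obtain ⟨n, hn⟩ := (((tendsto_tent p.1).mul (tendsto_tent p.2)).eventually_const_lt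
      (show (0 : ℝ) < 1 * 1 by norm_num)).exists
    by_contra! htop
    rw [top_le_iff] at htop
    have h2 := hp n
    rw [htop, ENNReal.mul_top (ENNReal.ofReal_pos.2 hn).ne'] at h2
    exact lt_irrefl _ h2
  have hkey : ∀ n, ∫⁻ p : ℝ × ℝ, ENNReal.ofReal (tent n p.1 * tent n p.2) * ENNReal.ofReal (F p) ≤
      ENNReal.ofReal (4 / ((n : ℝ) + 1)) * (∫⁻ σ, ENNReal.ofReal (σ ^ 2) * β σ) +
        ∫⁻ p, ENNReal.ofReal (-F p) := by
    intro n
    have e1 := lintegral_tent_sq_eq hβ n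
    have e2 := lintegral_tent_sub_sq_le hβ n
    have e3 := hcon n
    have hx := hXfin n
    set x := (∫⁻ s, ENNReal.ofReal (tent n s ^ 2)) * ∫⁻ σ, β σ with hxdef
    set i := ∫⁻ p : ℝ × ℝ, ENNReal.ofReal (tent n p.1 * tent n p.2) * β (p.1 - p.2) with hi
    set e := ∫⁻ p : ℝ × ℝ, ENNReal.ofReal ((tent n p.1 - tent n p.2) ^ 2) * β (p.1 - p.2) with he
    have hifin : i ≠ ∞ := by
      refine ne_top_of_le_ne_top (ENNReal.add_ne_top.2 ⟨hx, hx⟩) ?_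
      rw [e1]
      exact le_self_add.trans le_self_add
    -- In fact `x = i + e/2`; the weaker bound suffices because `e` tends to zero.
    have hxi : x ≤ i + e := by
      by_contra! hlt
      have := ENNReal.add_lt_add hlt hlt
      rw [e1] at this
      refine absurd this (not_lt.2 ?_)
      calc i + i + e ≤ i + i + e + e := le_self_add
        _ = i + e + (i + e) := by ring
    have hsum : (∫⁻ p : ℝ × ℝ, ENNReal.ofReal (tent n p.1 * tent n p.2) * ENNReal.ofReal (F p)) + i
        = (∫⁻ p : ℝ × ℝ, ENNReal.ofReal (tent n p.1 * tent n p.2) * a p) +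
          ∫⁻ p : ℝ × ℝ, ENNReal.ofReal (tent n p.1 * tent n p.2) * ENNReal.ofReal (-F p) := by
      have m1 : Measurable fun p : ℝ × ℝ =>
        ENNReal.ofReal (tent n p.1 * tent n p.2) * β (p.1 - p.2) := (hw n).mul hb
      have m2 : Measurable fun p : ℝ × ℝ =>
        ENNReal.ofReal (tent n p.1 * tent n p.2) * a p := (hw n).mul ha
      rw [hi, ← lintegral_add_right _ m1, ← lintegral_add_left m2]
      refine lintegral_congr_ae ?_
      filter_upwards [hid, hafin] with p h1 h2
      rw [← mul_add, ← mul_add, h1 h2]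
    have hneg : ∫⁻ p : ℝ × ℝ, ENNReal.ofReal (tent n p.1 * tent n p.2) * ENNReal.ofReal (-F p) ≤
        ∫⁻ p, ENNReal.ofReal (-F p) := by
      refine lintegral_mono fun p => ?_
      refine mul_le_of_le_one_left zero_le (ENNReal.ofReal_le_one.2 ?_)
      exact mul_le_one₀ (tent_le_one n _) (tent_nonneg n _) (tent_le_one n _)
    have hfinal : (∫⁻ p : ℝ × ℝ, ENNReal.ofReal (tent n p.1 * tent n p.2) * ENNReal.ofReal (F p))
        + i ≤ (ENNReal.ofReal (4 / ((n : ℝ) + 1)) * (∫⁻ σ, ENNReal.ofReal (σ ^ 2) * β σ) +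
          ∫⁻ p, ENNReal.ofReal (-F p)) + i := by
      rw [hsum]
      calc _ ≤ (i + e) + ∫⁻ p, ENNReal.ofReal (-F p) := add_le_add (e3.trans hxi) hneg
        _ ≤ (i + ENNReal.ofReal (4 / ((n : ℝ) + 1)) * (∫⁻ σ, ENNReal.ofReal (σ ^ 2) * β σ)) +
          ∫⁻ p, ENNReal.ofReal (-F p) := by gcongr
        _ = _ := by ring
    exact (ENNReal.add_le_add_iff_right hifin).1 hfinal
  -- The tents increase to one, so monotone convergence recovers the full positive part, even when
  -- its integral is infinite.
  have hl1 : Tendsto (fun n => ∫⁻ p : ℝ × ℝ, ENNReal.ofReal (tent n p.1 * tent n p.2) *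
      ENNReal.ofReal (F p)) atTop (𝓝 (∫⁻ p, ENNReal.ofReal (F p))) := by
    refine lintegral_tendsto_of_tendsto_of_monotone
      (fun n => ((hw n).mul hF.ennreal_ofReal).aemeasurable) (ae_of_all _ fun p m n hmn => ?_)
      (ae_of_all _ fun p => ?_)
    · dsimp only
      have h1 := tent_mono p.1 hmn
      have h2 := tent_mono p.2 hmn
      have h3 := tent_nonneg n p.1
      have h4 := tent_nonneg m p.2
      dsimp only at h1 h2
      gcongr
    · have h1 := ENNReal.tendsto_ofReal ((tendsto_tent p.1).mul (tendsto_tent p.2))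
      have h2 := ENNReal.Tendsto.mul_const h1 (b := ENNReal.ofReal (F p))
        (Or.inl (by simp))
      simpa using h2
  have hl2 : Tendsto (fun n : ℕ => ENNReal.ofReal (4 / ((n : ℝ) + 1)) *
      (∫⁻ σ, ENNReal.ofReal (σ ^ 2) * β σ) + ∫⁻ p, ENNReal.ofReal (-F p)) atTop
      (𝓝 (∫⁻ p, ENNReal.ofReal (-F p))) := by
    have h1 : Tendsto (fun n : ℕ => 4 * (1 / ((n : ℝ) + 1))) atTop (𝓝 0) := by
      simpa using tendsto_one_div_add_atTop_nhds_zero_nat.const_mul (4 : ℝ)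
    have h2 := ENNReal.Tendsto.mul_const (ENNReal.tendsto_ofReal h1)
      (b := ∫⁻ σ, ENNReal.ofReal (σ ^ 2) * β σ) (Or.inr hm2)
    have h3 := h2.add_const (∫⁻ p, ENNReal.ofReal (-F p))
    simpa [div_eq_mul_inv] using h3
  exact absurd hpos (not_lt.2 (le_of_tendsto_of_tendsto' hl1 hl2 hkey))

end Abstract


/-! ### The trial function -/

/-- The quadratic form of the kernel of the straight tube at longitudinal distance `σ`. -/
def straightForm (V φ : E2 → ℝ) (κ σ : ℝ) : ℝ≥0∞ :=
  ∫⁻ q : E2 × E2, ENNReal.ofReal (V q.1 * φ q.1) *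
    (resK κ (straightMap σ (q.1 - q.2)) * ENNReal.ofReal (V q.2 * φ q.2))

/-- The quadratic form of the kernel of the tube between the cross sections at `p.1` and `p.2`. -/
def tubeForm (X : ℝ × E2 → E3) (J : ℝ × E2 → ℝ) (V φ : E2 → ℝ) (κ : ℝ) (p : ℝ × ℝ) : ℝ≥0∞ :=
  ∫⁻ q : E2 × E2, (ENNReal.ofReal √(J (p.1, q.1)) * ENNReal.ofReal (V q.1 * φ q.1)) *
    (resK κ (X (p.1, q.1) - X (p.2, q.2)) *
      (ENNReal.ofReal √(J (p.2, q.2)) * ENNReal.ofReal (V q.2 * φ q.2)))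

theorem continuous_straightMap : Continuous fun p : ℝ × E2 => straightMap p.1 p.2 := by
  unfold straightMap
  fun_prop

theorem straightMap_ne_zero {σ : ℝ} (hσ : σ ≠ 0) (u : E2) : straightMap σ u ≠ 0 := by
  intro h
  have := congrArg (fun y : E3 => y 0) h
  simp [straightMap] at this
  exact hσ this

/-- Half of the exponential decay absorbs `r²`, by `y²/2 ≤ e^y` at `y = κr/2`. -/
theorem sq_mul_yukawa_le {κ r : ℝ} (hκ : 0 < κ) (hr : 0 < r) :
    r ^ 2 * yukawa κ r ≤ 8 / κ ^ 2 * yukawa (κ / 2) r := by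
  have h1 : (κ / 2 * r) ^ 2 / 2 ≤ Real.exp (κ / 2 * r) :=
    Real.pow_div_factorial_le_exp _ (by positivity) 2
  have h2 : r ^ 2 ≤ 8 / κ ^ 2 * Real.exp (κ / 2 * r) := by
    rw [div_mul_eq_mul_div, le_div_iff₀ (by positivity)]
    nlinarith
  have h3 : Real.exp (-κ * r) = Real.exp (-(κ / 2) * r) * (Real.exp (κ / 2 * r))⁻¹ := by
    rw [← Real.exp_neg, ← Real.exp_add]
    congr 1
    ring
  have h4 := Real.exp_pos (κ / 2 * r)
  unfold yukawa
  rw [h3, mul_div_assoc', mul_div_assoc']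
  gcongr ?_ / _
  calc r ^ 2 * (Real.exp (-(κ / 2) * r) * (Real.exp (κ / 2 * r))⁻¹)
      ≤ (8 / κ ^ 2 * Real.exp (κ / 2 * r)) *
        (Real.exp (-(κ / 2) * r) * (Real.exp (κ / 2 * r))⁻¹) := by gcongr
    _ = _ := by field_simp

namespace TransverseState

variable {M : Set E2} {V φ : E2 → ℝ} {κ₀ C B : ℝ}

theorem measurable_density (st : TransverseState M V φ κ₀ C B) :
    Measurable fun u => ENNReal.ofReal (V u * φ u) := (st.pot.meas.mul st.meas).ennreal_ofReal

theorem density_le (st : TransverseState M V φ κ₀ C B) (u : E2) : V u * φ u ≤ C * B :=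
  mul_le_mul (st.pot.le u) (st.le u) (st.pos u).le st.pot.const_nonneg

theorem lintegral_density_lt_top (st : TransverseState M V φ κ₀ C B)
    (hM : Bornology.IsBounded M) : ∫⁻ u, ENNReal.ofReal (V u * φ u) < ∞ := by
  have h1 : ∀ u, ENNReal.ofReal (V u * φ u) ≤
      (closure M).indicator (fun _ => ENNReal.ofReal (C * B)) u := by
    intro u
    by_cases hu : u ∈ closure M
    · rw [Set.indicator_of_mem hu]
      exact ENNReal.ofReal_le_ofReal (st.density_le u)
    · rw [st.supp u fun h => hu (subset_closure h)]
      simp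
  refine lt_of_le_of_lt (lintegral_mono h1) ?_
  rw [lintegral_indicator_const isClosed_closure.measurableSet]
  exact ENNReal.mul_lt_top ENNReal.ofReal_lt_top hM.isCompact_closure.measure_lt_top

theorem measurable_straightForm (st : TransverseState M V φ κ₀ C B) (κ : ℝ) :
    Measurable (straightForm V φ κ) := by
  have hg := st.measurable_density
  have hk : Measurable fun z : ℝ × (E2 × E2) => resK κ (straightMap z.1 (z.2.1 - z.2.2)) :=
    (measurable_resK κ).comp (continuous_straightMap.comp (g := fun p : ℝ × E2 =>
      straightMap p.1 p.2) (f := fun z : ℝ × (E2 × E2) => (z.1, z.2.1 - z.2.2))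
      (by fun_prop)).measurable
  exact Measurable.lintegral_prod_right' (f := fun z : ℝ × (E2 × E2) =>
    ENNReal.ofReal (V z.2.1 * φ z.2.1) * (resK κ (straightMap z.1 (z.2.1 - z.2.2)) *
      ENNReal.ofReal (V z.2.2 * φ z.2.2)))
    ((hg.comp (measurable_fst.comp measurable_snd)).mul
      (hk.mul (hg.comp (measurable_snd.comp measurable_snd))))

theorem lintegral_straightForm (st : TransverseState M V φ κ₀ C B) (κ : ℝ) :
    ∫⁻ σ, straightForm V φ κ σ = ∫⁻ u, ENNReal.ofReal (V u * φ u) *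
      ∫⁻ u', resK κ (u - u') * ENNReal.ofReal (V u' * φ u') := by
  have hg := st.measurable_density
  have hk : Measurable fun z : ℝ × (E2 × E2) => resK κ (straightMap z.1 (z.2.1 - z.2.2)) :=
    (measurable_resK κ).comp (continuous_straightMap.comp (g := fun p : ℝ × E2 =>
      straightMap p.1 p.2) (f := fun z : ℝ × (E2 × E2) => (z.1, z.2.1 - z.2.2))
      (by fun_prop)).measurable
  have hm : Measurable fun z : ℝ × (E2 × E2) => ENNReal.ofReal (V z.2.1 * φ z.2.1) *
      (resK κ (straightMap z.1 (z.2.1 - z.2.2)) * ENNReal.ofReal (V z.2.2 * φ z.2.2)) :=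
    (hg.comp (measurable_fst.comp measurable_snd)).mul
      (hk.mul (hg.comp (measurable_snd.comp measurable_snd)))
  have h1 : ∫⁻ σ, straightForm V φ κ σ = ∫⁻ q : E2 × E2, ENNReal.ofReal (V q.1 * φ q.1) *
      (resK κ (q.1 - q.2) * ENNReal.ofReal (V q.2 * φ q.2)) := by
    unfold straightForm
    rw [lintegral_lintegral_swap hm.aemeasurable]
    refine lintegral_congr fun q => ?_
    rw [lintegral_const_mul' _ _ ENNReal.ofReal_ne_top,
      lintegral_mul_const' _ _ ENNReal.ofReal_ne_top, lintegral_resK_straightMap]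
  have hm2 : Measurable fun q : E2 × E2 => ENNReal.ofReal (V q.1 * φ q.1) *
      (resK κ (q.1 - q.2) * ENNReal.ofReal (V q.2 * φ q.2)) :=
    (hg.comp measurable_fst).mul (((measurable_resK κ).comp (measurable_fst.sub measurable_snd)).mul
      (hg.comp measurable_snd))
  rw [h1, Measure.volume_eq_prod, lintegral_prod _ hm2.aemeasurable]
  refine lintegral_congr fun u => ?_
  dsimp only
  rw [lintegral_const_mul' _ _ ENNReal.ofReal_ne_top]

theorem lintegral_straightForm_lt_top (st : TransverseState M V φ κ₀ C B)
    (hM : Bornology.IsBounded M) {κ : ℝ} (hκ : 0 < κ) : ∫⁻ σ, straightForm V φ κ σ < ∞ := by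
  have hg := st.measurable_density
  rw [st.lintegral_straightForm]
  have h1 : ∀ u : E2, ∫⁻ u', resK κ (u - u') * ENNReal.ofReal (V u' * φ u') ≤
      ENNReal.ofReal (1 / κ ^ 2) * ENNReal.ofReal (C * B) := by
    intro u
    calc _ ≤ ∫⁻ u', resK κ (u - u') * ENNReal.ofReal (C * B) := by
          refine lintegral_mono fun u' => ?_
          exact mul_le_mul_right (ENNReal.ofReal_le_ofReal (st.density_le u')) _
      _ = _ := by
          rw [lintegral_mul_const' _ _ ENNReal.ofReal_ne_top,
            lintegral_sub_left_eq_self (fun z => resK κ z) u, lintegral_resK hκ]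
  refine lt_of_le_of_lt (lintegral_mono fun u => mul_le_mul_right (h1 u) _) ?_
  rw [lintegral_mul_const _ hg]
  exact ENNReal.mul_lt_top (st.lintegral_density_lt_top hM)
    (ENNReal.mul_lt_top ENNReal.ofReal_lt_top ENNReal.ofReal_lt_top)

/-- Here `κ₀` has to be the exact threshold: the transverse integral equation turns the total mass
of the convolution kernel into the potential energy of the ground state. -/
theorem lintegral_straightForm_eq (st : TransverseState M V φ κ₀ C B) :
    ∫⁻ σ, straightForm V φ κ₀ σ = ∫⁻ u, ENNReal.ofReal (V u * φ u ^ 2) := by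
  rw [st.lintegral_straightForm]
  refine lintegral_congr fun u => ?_
  rw [← st.eqn u, ← ENNReal.ofReal_mul (mul_nonneg (st.pot.nonneg u) (st.pos u).le)]
  congr 1
  ring

/-- `σ` is at most the distance between the points, so the second moment at `κ` is controlled by the
total mass at `κ/2`. -/
theorem lintegral_sq_mul_straightForm_lt_top (st : TransverseState M V φ κ₀ C B)
    (hM : Bornology.IsBounded M) {κ : ℝ} (hκ : 0 < κ) :
    ∫⁻ σ, ENNReal.ofReal (σ ^ 2) * straightForm V φ κ σ < ∞ := by
  have h1 : ∀ σ : ℝ, σ ≠ 0 → ENNReal.ofReal (σ ^ 2) * straightForm V φ κ σ ≤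
      ENNReal.ofReal (8 / κ ^ 2) * straightForm V φ (κ / 2) σ := by
    intro σ hσ
    unfold straightForm
    rw [← lintegral_const_mul' _ _ ENNReal.ofReal_ne_top,
      ← lintegral_const_mul' _ _ ENNReal.ofReal_ne_top]
    refine lintegral_mono fun q => ?_
    have hne := straightMap_ne_zero hσ (q.1 - q.2)
    have hn : 0 < ‖straightMap σ (q.1 - q.2)‖ := norm_pos_iff.2 hne
    have hs : σ ^ 2 ≤ ‖straightMap σ (q.1 - q.2)‖ ^ 2 := by
      rw [norm_straightMap_sq]
      nlinarith [sq_nonneg ‖q.1 - q.2‖]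
    have hy := sq_mul_yukawa_le hκ hn
    have h2 : ENNReal.ofReal (σ ^ 2) * resK κ (straightMap σ (q.1 - q.2)) ≤
        ENNReal.ofReal (8 / κ ^ 2) * resK (κ / 2) (straightMap σ (q.1 - q.2)) := by
      rw [resK_three hκ hne, resK_three (half_pos hκ) hne, ← ENNReal.ofReal_mul (by positivity),
        ← ENNReal.ofReal_mul (by positivity)]
      refine ENNReal.ofReal_le_ofReal (le_trans ?_ hy)
      exact mul_le_mul_of_nonneg_right hs (yukawa_nonneg hn.le)
    calc _ = ENNReal.ofReal (V q.1 * φ q.1) * ((ENNReal.ofReal (σ ^ 2) *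
          resK κ (straightMap σ (q.1 - q.2))) * ENNReal.ofReal (V q.2 * φ q.2)) := by ring
      _ ≤ ENNReal.ofReal (V q.1 * φ q.1) * ((ENNReal.ofReal (8 / κ ^ 2) *
          resK (κ / 2) (straightMap σ (q.1 - q.2))) * ENNReal.ofReal (V q.2 * φ q.2)) := by gcongr
      _ = _ := by ring
  have h0 : ∀ᵐ σ : ℝ, σ ≠ 0 := compl_mem_ae_iff.2 (measure_singleton (0 : ℝ))
  refine lt_of_le_of_lt (lintegral_mono_ae (h0.mono fun σ hσ => h1 σ hσ)) ?_
  rw [lintegral_const_mul' _ _ ENNReal.ofReal_ne_top]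
  exact ENNReal.mul_lt_top ENNReal.ofReal_lt_top
    (st.lintegral_straightForm_lt_top hM (half_pos hκ))

end TransverseState

/-- The additive form of `∫ (f - g) = ∫ f - ∫ g`, split into positive and negative parts to stay
within extended nonnegative numbers. -/
theorem ofReal_integral_sub_add {Ω : Type*} [MeasurableSpace Ω] {μ : Measure Ω} {f g : Ω → ℝ}
    (hf : Measurable f) (hg : Measurable g) (hf0 : ∀ x, 0 ≤ f x) (hg0 : ∀ x, 0 ≤ g x)
    (hfi : ∫⁻ x, ENNReal.ofReal (f x) ∂μ < ∞) (hgi : ∫⁻ x, ENNReal.ofReal (g x) ∂μ < ∞) :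
    ENNReal.ofReal (∫ x, f x - g x ∂μ) + ∫⁻ x, ENNReal.ofReal (g x) ∂μ =
      (∫⁻ x, ENNReal.ofReal (f x) ∂μ) + ENNReal.ofReal (-∫ x, f x - g x ∂μ) := by
  have h1 : Integrable f μ := ⟨hf.aestronglyMeasurable,
    (hasFiniteIntegral_iff_ofReal (ae_of_all _ hf0)).2 hfi⟩
  have h2 : Integrable g μ := ⟨hg.aestronglyMeasurable,
    (hasFiniteIntegral_iff_ofReal (ae_of_all _ hg0)).2 hgi⟩
  rw [integral_sub h1 h2, ← ofReal_integral_eq_lintegral_ofReal h1 (ae_of_all _ hf0),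
    ← ofReal_integral_eq_lintegral_ofReal h2 (ae_of_all _ hg0)]
  have a0 : 0 ≤ ∫ x, f x ∂μ := integral_nonneg hf0
  have b0 : 0 ≤ ∫ x, g x ∂μ := integral_nonneg hg0
  rcases le_total (∫ x, f x ∂μ) (∫ x, g x ∂μ) with h | h
  · rw [ENNReal.ofReal_of_nonpos (sub_nonpos.2 h), zero_add,
      ← ENNReal.ofReal_add a0 (by linarith)]
    congr 1
    ring
  · rw [ENNReal.ofReal_of_nonpos (p := -_) (by linarith), add_zero,
      ← ENNReal.ofReal_add (by linarith) b0]
    congr 1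
    ring

theorem ae_fst_ne_snd : ∀ᵐ p : ℝ × ℝ, p.1 ≠ p.2 := by
  have hm : MeasurableSet {p : ℝ × ℝ | p.1 = p.2} := measurableSet_eq_fun measurable_fst measurable_snd
  have h0 : volume {p : ℝ × ℝ | p.1 = p.2} = 0 := by
    rw [Measure.volume_eq_prod, Measure.measure_prod_null hm]
    refine ae_of_all _ fun s => ?_
    have : Prod.mk s ⁻¹' {p : ℝ × ℝ | p.1 = p.2} = {s} := by
      ext s'
      simp [eq_comm]
    exact (congrArg _ this).trans (measure_singleton s)
  exact compl_mem_ae_iff.2 h0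

theorem measurable_green (κ : ℝ) : Measurable fun z : E3 × E3 => green κ z.1 z.2 := by
  unfold green
  fun_prop

theorem green_nonneg (κ : ℝ) (y y' : E3) : 0 ≤ green κ y y' := by
  unfold green
  positivity

theorem ofReal_green {κ : ℝ} (hκ : 0 < κ) {y y' : E3} (h : y ≠ y') :
    ENNReal.ofReal (green κ y y') = resK κ (y - y') := by
  rw [resK_three hκ (sub_ne_zero.2 h)]
  rfl


/-- The kernel of the tube minus that of the straight tube, integrated over the cross sections. -/
def formDifference (X : ℝ × E2 → E3) (J : ℝ × E2 → ℝ) (M : Set E2) (V φ : E2 → ℝ) (κ : ℝ)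
    (p : ℝ × ℝ) : ℝ :=
  ∫ q in M ×ˢ M, φ q.1 * V q.1 *
    (√(J (p.1, q.1)) * green κ (X (p.1, q.1)) (X (p.2, q.2)) * √(J (p.2, q.2)) -
      green κ (straightMap p.1 q.1) (straightMap p.2 q.2)) * (V q.2 * φ q.2)

theorem TransverseState.straightForm_lt_top {M : Set E2} {V φ : E2 → ℝ} {κ₀ C B : ℝ}
    (st : TransverseState M V φ κ₀ C B) (hM : Bornology.IsBounded M) {κ : ℝ} (hκ : 0 < κ) {σ : ℝ} (hσ : σ ≠ 0) : straightForm V φ κ σ < ∞ := by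
  have hg := st.measurable_density
  have h1 : ∀ q : E2 × E2, ENNReal.ofReal (V q.1 * φ q.1) *
      (resK κ (straightMap σ (q.1 - q.2)) * ENNReal.ofReal (V q.2 * φ q.2)) ≤
      ENNReal.ofReal (V q.1 * φ q.1) *
        (ENNReal.ofReal (yukawa κ |σ|) * ENNReal.ofReal (V q.2 * φ q.2)) := by
    intro q
    rw [resK_three hκ (straightMap_ne_zero hσ _)]
    gcongr
    refine yukawa_anti hκ.le (abs_pos.2 hσ) (abs_le_of_sq_le_sq ?_ (norm_nonneg _))
    rw [norm_straightMap_sq]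
    nlinarith [sq_nonneg ‖q.1 - q.2‖]
  refine lt_of_le_of_lt (lintegral_mono h1) ?_
  rw [Measure.volume_eq_prod, lintegral_prod_mul hg.aemeasurable (hg.const_mul _).aemeasurable,
    lintegral_const_mul _ hg]
  have := st.lintegral_density_lt_top hM
  exact ENNReal.mul_lt_top this (ENNReal.mul_lt_top ENNReal.ofReal_lt_top this)

namespace IsTubeChart

variable {X : ℝ × E2 → E3} {J : ℝ × E2 → ℝ} {M : Set E2} {V φ : E2 → ℝ} {κ₀ C B : ℝ} {U : E3 → ℝ}

theorem measurable_formDifference (h : IsTubeChart X J M) (st : TransverseState M V φ κ₀ C B) :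
    Measurable (formDifference X J M V φ κ₀) := by
  have hX := h.cont.measurable
  have hJ := h.cont_jac.measurable
  have hV := st.pot.meas
  have hφ := st.meas
  have hS := continuous_straightMap.measurable
  have m1 : Measurable fun z : (ℝ × ℝ) × (E2 × E2) => ((z.1.1, z.2.1) : ℝ × E2) := by fun_prop
  have m2 : Measurable fun z : (ℝ × ℝ) × (E2 × E2) => ((z.1.2, z.2.2) : ℝ × E2) := by fun_prop
  have g1 := (measurable_green κ₀).comp ((hX.comp m1).prodMk (hX.comp m2))
  have g2 := (measurable_green κ₀).comp ((hS.comp m1).prodMk (hS.comp m2))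
  have j1 := (hJ.comp m1).sqrt
  have j2 := (hJ.comp m2).sqrt
  have v1 : Measurable fun z : (ℝ × ℝ) × (E2 × E2) => φ z.2.1 * V z.2.1 := by fun_prop
  have v2 : Measurable fun z : (ℝ × ℝ) × (E2 × E2) => V z.2.2 * φ z.2.2 := by fun_prop
  have hm : Measurable fun z : (ℝ × ℝ) × (E2 × E2) => φ z.2.1 * V z.2.1 *
      (√(J (z.1.1, z.2.1)) * green κ₀ (X (z.1.1, z.2.1)) (X (z.1.2, z.2.2)) *
        √(J (z.1.2, z.2.2)) -
      green κ₀ (straightMap z.1.1 z.2.1) (straightMap z.1.2 z.2.2)) * (V z.2.2 * φ z.2.2) :=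
    (v1.mul (((j1.mul g1).mul j2).sub g2)).mul v2
  exact (hm.stronglyMeasurable.integral_prod_right' (ν := volume.restrict (M ×ˢ M))).measurable

theorem measurable_tubeForm (h : IsTubeChart X J M) (st : TransverseState M V φ κ₀ C B) (κ : ℝ) :
    Measurable fun z : (ℝ × ℝ) × (E2 × E2) =>
      (ENNReal.ofReal √(J (z.1.1, z.2.1)) * ENNReal.ofReal (V z.2.1 * φ z.2.1)) *
      (resK κ (X (z.1.1, z.2.1) - X (z.1.2, z.2.2)) *
      (ENNReal.ofReal √(J (z.1.2, z.2.2)) * ENNReal.ofReal (V z.2.2 * φ z.2.2))) := by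
  have hX := h.cont.measurable
  have hJ := h.cont_jac.measurable
  have hg := st.measurable_density
  have m1 : Measurable fun z : (ℝ × ℝ) × (E2 × E2) => ((z.1.1, z.2.1) : ℝ × E2) := by fun_prop
  have m2 : Measurable fun z : (ℝ × ℝ) × (E2 × E2) => ((z.1.2, z.2.2) : ℝ × E2) := by fun_prop
  have k := (measurable_resK κ).comp ((hX.comp m1).sub (hX.comp m2))
  have v1 := hg.comp (measurable_snd.comp m1)
  have v2 := hg.comp (measurable_snd.comp m2)
  exact ((hJ.comp m1).sqrt.ennreal_ofReal.mul v1).mul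
    (k.mul ((hJ.comp m2).sqrt.ennreal_ofReal.mul v2))

/-- Finiteness of the tube form makes the integral over the cross sections converge, so its default
value zero does not occur. Different `s` and injectivity keep all points apart, where `green` and
`resK` agree. -/
theorem ofReal_formDifference_add (h : IsTubeChart X J M) (st : TransverseState M V φ κ₀ C B)
    (hκ₀ : 0 < κ₀) {p : ℝ × ℝ} (hp : p.1 ≠ p.2) (hfin : tubeForm X J V φ κ₀ p < ∞) :
    ENNReal.ofReal (formDifference X J M V φ κ₀ p) + straightForm V φ κ₀ (p.1 - p.2) =
      tubeForm X J V φ κ₀ p + ENNReal.ofReal (-formDifference X J M V φ κ₀ p) := by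
  have hX := h.cont.measurable
  have hJ := h.cont_jac.measurable
  have hV := st.pot.meas
  have hφ := st.meas
  have hS := continuous_straightMap.measurable
  set f : E2 × E2 → ℝ := fun q => φ q.1 * V q.1 *
    (√(J (p.1, q.1)) * green κ₀ (X (p.1, q.1)) (X (p.2, q.2)) * √(J (p.2, q.2))) *
    (V q.2 * φ q.2) with hf
  set g : E2 × E2 → ℝ := fun q => φ q.1 * V q.1 *
    green κ₀ (straightMap p.1 q.1) (straightMap p.2 q.2) * (V q.2 * φ q.2) with hg
  have m1 : Measurable fun q : E2 × E2 => ((p.1, q.1) : ℝ × E2) := by fun_prop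
  have m2 : Measurable fun q : E2 × E2 => ((p.2, q.2) : ℝ × E2) := by fun_prop
  have v1 : Measurable fun q : E2 × E2 => φ q.1 * V q.1 := by fun_prop
  have v2 : Measurable fun q : E2 × E2 => V q.2 * φ q.2 := by fun_prop
  have hfm : Measurable f := (v1.mul (((hJ.comp m1).sqrt.mul
    ((measurable_green κ₀).comp ((hX.comp m1).prodMk (hX.comp m2)))).mul (hJ.comp m2).sqrt)).mul v2
  have hgm : Measurable g := (v1.mul
    ((measurable_green κ₀).comp ((hS.comp m1).prodMk (hS.comp m2)))).mul v2
  have hf0 : ∀ q, 0 ≤ f q := fun q => by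
    have := green_nonneg κ₀ (X (p.1, q.1)) (X (p.2, q.2))
    have := st.pot.nonneg q.1
    have := st.pot.nonneg q.2
    have := st.pos q.1
    have := st.pos q.2
    positivity
  have hg0 : ∀ q, 0 ≤ g q := fun q => by
    have := green_nonneg κ₀ (straightMap p.1 q.1) (straightMap p.2 q.2)
    have := st.pot.nonneg q.1
    have := st.pot.nonneg q.2
    have := st.pos q.1
    have := st.pos q.2
    positivity
  have hFint : formDifference X J M V φ κ₀ p = ∫ q, f q - g q := by
    unfold formDifference
    rw [setIntegral_eq_integral_of_forall_compl_eq_zero]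
    · refine integral_congr_ae (ae_of_all _ fun q => ?_)
      simp only [hf, hg]
      ring
    · rintro q hq
      rcases not_and_or.1 hq with hq | hq
      · simp [st.supp _ hq]
      · simp [st.supp _ hq]
  have e1 : ∫⁻ q, ENNReal.ofReal (f q) = tubeForm X J V φ κ₀ p := by
    refine lintegral_congr fun q => ?_
    by_cases hq : q.1 ∈ M ∧ q.2 ∈ M
    · have hne : X (p.1, q.1) ≠ X (p.2, q.2) := fun he => hp
        (congrArg Prod.fst (h.injOn (show (p.1, q.1) ∈ Set.univ ×ˢ M from ⟨trivial, hq.1⟩)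
          (show (p.2, q.2) ∈ Set.univ ×ˢ M from ⟨trivial, hq.2⟩) he))
      have := st.pot.nonneg q.1
      have := (st.pos q.1).le
      have := green_nonneg κ₀ (X (p.1, q.1)) (X (p.2, q.2))
      rw [← ofReal_green hκ₀ hne, ← ENNReal.ofReal_mul (by positivity),
        ← ENNReal.ofReal_mul (by positivity), ← ENNReal.ofReal_mul (by positivity),
        ← ENNReal.ofReal_mul (by positivity)]
      congr 1
      simp only [hf]
      ring
    · rcases not_and_or.1 hq with hq | hq
      · simp [hf, st.supp _ hq]
      · simp [hf, st.supp _ hq]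
  have e2 : ∫⁻ q, ENNReal.ofReal (g q) = straightForm V φ κ₀ (p.1 - p.2) := by
    refine lintegral_congr fun q => ?_
    have hne : straightMap p.1 q.1 ≠ straightMap p.2 q.2 := by
      rw [← sub_ne_zero, straightMap_sub]
      exact straightMap_ne_zero (sub_ne_zero.2 hp) _
    have := st.pot.nonneg q.1
    have := (st.pos q.1).le
    have := green_nonneg κ₀ (straightMap p.1 q.1) (straightMap p.2 q.2)
    rw [← straightMap_sub, ← ofReal_green hκ₀ hne, ← ENNReal.ofReal_mul (by positivity),
      ← ENNReal.ofReal_mul (by positivity)]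
    congr 1
    simp only [hg]
    ring
  have := ofReal_integral_sub_add hfm hgm hf0 hg0 (by rw [e1]; exact hfin)
    (by rw [e2]; exact st.straightForm_lt_top h.bounded hκ₀ (sub_ne_zero.2 hp))
  rwa [e1, e2, ← hFint] at this

/-- The form of the tube on a cut-off function, as an iterated integral. -/
theorem lintegral_tent_tubeForm (h : IsTubeChart X J M) (st : TransverseState M V φ κ₀ C B)
    (κ : ℝ) (n : ℕ) :
    ∫⁻ p : ℝ × ℝ, ENNReal.ofReal (tent n p.1 * tent n p.2) * tubeForm X J V φ κ p =
      ∫⁻ s, ∫⁻ u, (ENNReal.ofReal (tent n s) * (ENNReal.ofReal √(J (s, u)) *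
        ENNReal.ofReal (V u * φ u))) * ∫⁻ s', ∫⁻ u', resK κ (X (s, u) - X (s', u')) *
        (ENNReal.ofReal (tent n s') * (ENNReal.ofReal √(J (s', u')) *
          ENNReal.ofReal (V u' * φ u'))) := by
  have ht : Measurable (tent n) := (continuous_tent n).measurable
  have hk := h.measurable_tubeForm st κ
  have htf : Measurable fun p => tubeForm X J V φ κ p := hk.lintegral_prod_right'
  have hw : Measurable fun p : ℝ × ℝ => ENNReal.ofReal (tent n p.1 * tent n p.2) :=
    ((ht.comp measurable_fst).mul (ht.comp measurable_snd)).ennreal_ofReal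
  refine (lintegral_prod (fun p : ℝ × ℝ => ENNReal.ofReal (tent n p.1 * tent n p.2) *
    tubeForm X J V φ κ p) (hw.mul htf).aemeasurable).trans ?_
  refine lintegral_congr fun s => ?_
  have hGm : Measurable fun z : (E2 × ℝ) × E2 =>
      (ENNReal.ofReal (tent n s) * (ENNReal.ofReal √(J (s, z.1.1)) *
        ENNReal.ofReal (V z.1.1 * φ z.1.1))) * (resK κ (X (s, z.1.1) - X (z.1.2, z.2)) *
        (ENNReal.ofReal (tent n z.1.2) * (ENNReal.ofReal √(J (z.1.2, z.2)) *
          ENNReal.ofReal (V z.2 * φ z.2)))) := by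
    have hX := h.cont.measurable
    have hJ := h.cont_jac.measurable
    have hg := st.measurable_density
    have m1 : Measurable fun z : (E2 × ℝ) × E2 => ((s, z.1.1) : ℝ × E2) := by fun_prop
    have m2 : Measurable fun z : (E2 × ℝ) × E2 => ((z.1.2, z.2) : ℝ × E2) := by fun_prop
    have k := (measurable_resK κ).comp ((hX.comp m1).sub (hX.comp m2))
    have v1 := hg.comp (measurable_snd.comp m1)
    have v2 := hg.comp (measurable_snd.comp m2)
    exact (measurable_const.mul ((hJ.comp m1).sqrt.ennreal_ofReal.mul v1)).mul
      (k.mul (((ht.comp (measurable_fst.comp m2)).ennreal_ofReal).mul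
        ((hJ.comp m2).sqrt.ennreal_ofReal.mul v2)))
  calc ∫⁻ s', ENNReal.ofReal (tent n s * tent n s') * tubeForm X J V φ κ (s, s')
      = ∫⁻ s', ∫⁻ u, ∫⁻ u', (ENNReal.ofReal (tent n s) * (ENNReal.ofReal √(J (s, u)) *
        ENNReal.ofReal (V u * φ u))) * (resK κ (X (s, u) - X (s', u')) *
        (ENNReal.ofReal (tent n s') * (ENNReal.ofReal √(J (s', u')) *
          ENNReal.ofReal (V u' * φ u')))) := by
        refine lintegral_congr fun s' => ?_
        unfold tubeForm
        have hk' := hk.comp (measurable_prodMk_left (x := ((s, s') : ℝ × ℝ)))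
        rw [← lintegral_const_mul' _ _ ENNReal.ofReal_ne_top]
        refine (lintegral_prod _ (hk'.const_mul _).aemeasurable).trans ?_
        refine lintegral_congr fun u => lintegral_congr fun u' => ?_
        simp only [Function.comp_apply]
        rw [ENNReal.ofReal_mul (tent_nonneg _ _)]
        ring
    _ = ∫⁻ u, ∫⁻ s', ∫⁻ u', (ENNReal.ofReal (tent n s) * (ENNReal.ofReal √(J (s, u)) *
        ENNReal.ofReal (V u * φ u))) * (resK κ (X (s, u) - X (s', u')) *
        (ENNReal.ofReal (tent n s') * (ENNReal.ofReal √(J (s', u')) *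
          ENNReal.ofReal (V u' * φ u')))) := by
        rw [lintegral_lintegral_swap]
        exact ((hGm.lintegral_prod_right').comp measurable_swap).aemeasurable
    _ = _ := by
        refine lintegral_congr fun u => ?_
        have hfin : ENNReal.ofReal (tent n s) * (ENNReal.ofReal √(J (s, u)) *
          ENNReal.ofReal (V u * φ u)) ≠ ∞ := by finiteness
        rw [← lintegral_const_mul' _ _ hfin]
        refine lintegral_congr fun s' => ?_
        rw [lintegral_const_mul' _ _ hfin]

/-- The trial function violates the threshold inequality. -/
theorem exists_trial (h : IsTubeChart X J M) (st : TransverseState M V φ κ₀ C B) (hκ₀ : 0 < κ₀)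
    (hUX : ∀ s, ∀ u ∈ M, U (X (s, u)) = V u) (hU0 : ∀ y ∉ X '' (Set.univ ×ˢ M), U y = 0)
    (hpos : HasPositiveIntegral (formDifference X J M V φ κ₀)) :
    ∃ η : E3 → ℝ, Measurable η ∧ (∀ y, 0 ≤ η y) ∧ MemLp (fun y => (η y : ℂ)) 2 volume ∧
      ∫⁻ y, ENNReal.ofReal (U y * η y ^ 2) < ∫⁻ y, ∫⁻ y', ENNReal.ofReal (U y * η y) *
        (resK κ₀ (y - y') * ENNReal.ofReal (U y' * η y')) := by
  classical
  have hU := h.bddPotential st.pot hUX hU0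
  have hk := h.measurable_tubeForm st κ₀
  obtain ⟨n, hn⟩ := exists_tent_lt (st.measurable_straightForm κ₀)
    (st.lintegral_straightForm_lt_top h.bounded hκ₀).ne
    (st.lintegral_sq_mul_straightForm_lt_top h.bounded hκ₀).ne
    (a := tubeForm X J V φ κ₀) hk.lintegral_prod_right' (h.measurable_formDifference st)
    (ae_fst_ne_snd.mono fun p hp hfin => h.ofReal_formDifference_add st hκ₀ hp hfin) hpos
  have ht : Measurable (tent n) := (continuous_tent n).measurable
  -- With volume element `J`, the factor `J^{-1/2}` cancels in `Uη²` and leaves one `√J` in each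
  -- `Uη`, precisely the weights of the tube form.
  have hgm : Measurable fun p : ℝ × E2 => φ p.2 * (√(J p))⁻¹ * tent n p.1 :=
    ((st.meas.comp measurable_snd).mul h.cont_jac.measurable.sqrt.inv).mul
      (ht.comp measurable_fst)
  obtain ⟨η, hηm, hηX, hη0⟩ := h.exists_extension hgm 0
  have hηX' : ∀ s, ∀ u ∈ M, η (X (s, u)) = φ u * (√(J (s, u)))⁻¹ * tent n s :=
    fun s u hu => hηX (s, u) ⟨trivial, hu⟩
  have hUη : ∀ s, ∀ u ∈ M, ENNReal.ofReal (J (s, u)) * ENNReal.ofReal (U (X (s, u)) * η (X (s, u)))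
      = ENNReal.ofReal (tent n s) * (ENNReal.ofReal √(J (s, u)) * ENNReal.ofReal (V u * φ u)) := by
    intro s u hu
    have hJ := h.pos s u hu
    have hq : 0 < √(J (s, u)) := Real.sqrt_pos.2 hJ
    have := tent_nonneg n s
    rw [hUX s u hu, hηX' s u hu, ← ENNReal.ofReal_mul hJ.le, ← ENNReal.ofReal_mul hq.le,
      ← ENNReal.ofReal_mul this]
    congr 1
    nth_rewrite 1 [← Real.mul_self_sqrt hJ.le]
    field_simp
  have hUη2 : ∫⁻ y, ENNReal.ofReal (U y * η y ^ 2) =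
      (∫⁻ s, ENNReal.ofReal (tent n s ^ 2)) * ∫⁻ σ, straightForm V φ κ₀ σ := by
    rw [h.lintegral_eq (F := fun y => ENNReal.ofReal (U y * η y ^ 2))
      (G := fun s u => ENNReal.ofReal (tent n s ^ 2) * ENNReal.ofReal (V u * φ u ^ 2))
      (hU.meas.mul (hηm.pow_const 2)).ennreal_ofReal (fun y hy => by simp [hU0 y hy])
      (fun s u hu => by simp [st.supp u hu]) ?_, st.lintegral_straightForm_eq]
    · rw [← lintegral_mul_const _ (ht.pow_const 2).ennreal_ofReal]
      refine lintegral_congr fun s => ?_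
      rw [lintegral_const_mul' _ _ ENNReal.ofReal_ne_top]
    · intro s u hu
      have hJ := h.pos s u hu
      have hq : 0 < √(J (s, u)) := Real.sqrt_pos.2 hJ
      rw [hUX s u hu, hηX' s u hu, ← ENNReal.ofReal_mul hJ.le, ← ENNReal.ofReal_mul (by positivity)]
      congr 1
      nth_rewrite 1 [← Real.mul_self_sqrt hJ.le]
      field_simp
  refine ⟨η, hηm, fun y => ?_, ?_, ?_⟩
  · by_cases hy : y ∈ X '' (Set.univ ×ˢ M)
    · obtain ⟨⟨s, u⟩, ⟨-, hu⟩, rfl⟩ := hy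
      rw [hηX' s u hu]
      exact mul_nonneg (mul_nonneg (st.pos u).le (inv_nonneg.2 (Real.sqrt_nonneg _)))
        (tent_nonneg n s)
    · exact (hη0 y hy).ge
  · refine ⟨(Complex.measurable_ofReal.comp hηm).aestronglyMeasurable, ?_⟩
    rw [eLpNorm_lt_top_iff_lintegral_rpow_enorm_lt_top (by norm_num) (by norm_num)]
    have e : ∀ y, ‖(η y : ℂ)‖ₑ ^ (2 : ℝ≥0∞).toReal = ENNReal.ofReal (η y ^ 2) := by
      intro y
      rw [← ofReal_norm, Complex.norm_real, ENNReal.toReal_ofNat, ENNReal.rpow_ofNat,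
        ← ENNReal.ofReal_pow (norm_nonneg _), Real.norm_eq_abs, sq_abs]
    simp only [e]
    rw [h.lintegral_eq (F := fun y => ENNReal.ofReal (η y ^ 2))
      (G := fun s u => if u ∈ M then ENNReal.ofReal (tent n s ^ 2) * ENNReal.ofReal (φ u ^ 2) else 0)
      (hηm.pow_const 2).ennreal_ofReal (fun y hy => by simp [hη0 y hy])
      (fun s u hu => if_neg hu) (fun s u hu => ?_)]
    · have hφ2 := lintegral_enorm_sq_lt_top st.memLp
      have e2 : ∀ u, ‖(φ u : ℂ)‖ₑ ^ 2 = ENNReal.ofReal (φ u ^ 2) := by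
        intro u
        rw [← ofReal_norm, Complex.norm_real, ← ENNReal.ofReal_pow (norm_nonneg _),
          Real.norm_eq_abs, sq_abs]
      simp only [e2] at hφ2
      refine lt_of_le_of_lt ?_ (ENNReal.mul_lt_top (lintegral_tent_sq_lt_top n) hφ2)
      rw [← lintegral_mul_const _ (ht.pow_const 2).ennreal_ofReal]
      refine lintegral_mono fun s => ?_
      rw [← lintegral_const_mul' _ _ ENNReal.ofReal_ne_top]
      refine lintegral_mono fun u => ?_
      split_ifs
      · exact le_rfl
      · exact zero_le
    · have hJ := h.pos s u hu
      have hq : 0 < √(J (s, u)) := Real.sqrt_pos.2 hJ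
      rw [if_pos hu, hηX' s u hu, ← ENNReal.ofReal_mul hJ.le, ← ENNReal.ofReal_mul (by positivity)]
      congr 1
      nth_rewrite 1 [← Real.mul_self_sqrt hJ.le]
      field_simp
  · rw [hUη2]
    refine hn.trans_eq ?_
    rw [h.lintegral_tent_tubeForm st κ₀ n]
    have hUm : Measurable fun y => ENNReal.ofReal (U y * η y) := (hU.meas.mul hηm).ennreal_ofReal
    have hinner : ∀ y, ∫⁻ y', resK κ₀ (y - y') * ENNReal.ofReal (U y' * η y') =
        ∫⁻ s', ∫⁻ u', resK κ₀ (y - X (s', u')) *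
        (ENNReal.ofReal (tent n s') * (ENNReal.ofReal √(J (s', u')) *
          ENNReal.ofReal (V u' * φ u'))) := by
      intro y
      have hKm : Measurable fun y' => resK κ₀ (y - y') :=
        (measurable_resK κ₀).comp (measurable_const.sub measurable_id)
      refine h.lintegral_eq (F := fun y' => resK κ₀ (y - y') * ENNReal.ofReal (U y' * η y'))
        (hKm.mul hUm) (fun y' hy' => by simp [hU0 y' hy'])
        (fun s u hu => by simp [st.supp u hu]) (fun s u hu => ?_)
      rw [mul_left_comm, hUη s u hu]
    have hKm2 : Measurable fun z : E3 × E3 =>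
        resK κ₀ (z.1 - z.2) * ENNReal.ofReal (U z.2 * η z.2) :=
      ((measurable_resK κ₀).comp (measurable_fst.sub measurable_snd)).mul (hUm.comp measurable_snd)
    have hrhs : ∀ y, ∫⁻ y', ENNReal.ofReal (U y * η y) *
        (resK κ₀ (y - y') * ENNReal.ofReal (U y' * η y')) = ENNReal.ofReal (U y * η y) *
        ∫⁻ y', resK κ₀ (y - y') * ENNReal.ofReal (U y' * η y') := fun y =>
      lintegral_const_mul' _ _ ENNReal.ofReal_ne_top
    simp only [hrhs]
    symm
    refine h.lintegral_eq (F := fun y => ENNReal.ofReal (U y * η y) *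
        ∫⁻ y', resK κ₀ (y - y') * ENNReal.ofReal (U y' * η y'))
      (hUm.mul hKm2.lintegral_prod_right') (fun y hy => by simp [hU0 y hy])
      (fun s u hu => by simp [st.supp u hu]) (fun s u hu => ?_)
    rw [← mul_assoc, hUη s u hu, hinner]

end IsTubeChart


/-! ### Passage from the given potential and ground state to regular representatives. -/

variable {Γ n b : ℝ → E3} {γ α : ℝ → ℝ} {M : Set E2}

theorem injOn_of_injective_subtype
    (hinj : Function.Injective fun p : ℝ × M => tubeMap Γ n b α p.1 p.2) :
    Set.InjOn (fun p : ℝ × E2 => tubeMap Γ n b α p.1 p.2) (Set.univ ×ˢ M) := by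
  rintro ⟨s, u⟩ ⟨-, hu⟩ ⟨s', u'⟩ ⟨-, hu'⟩ h
  have := hinj (a₁ := (s, ⟨u, hu⟩)) (a₂ := (s', ⟨u', hu'⟩)) h
  simp only [Prod.mk.injEq, Subtype.mk.injEq] at this
  rw [this.1, this.2]

theorem tubePotential_tubeMap
    (hinj : Function.Injective fun p : ℝ × M => tubeMap Γ n b α p.1 p.2) (V : E2 → ℝ) (s : ℝ)
    {u : E2} (hu : u ∈ M) : tubePotential Γ n b α M V (tubeMap Γ n b α s u) = V u :=
  hinj.extend_apply (fun p : ℝ × M => V p.2) 0 (s, ⟨u, hu⟩)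

theorem tubePotential_eq_zero (V : E2 → ℝ) {y : E3}
    (hy : y ∉ (fun p : ℝ × E2 => tubeMap Γ n b α p.1 p.2) '' (Set.univ ×ˢ M)) :
    tubePotential Γ n b α M V y = 0 := by
  refine Function.extend_apply' _ _ _ ?_
  rintro ⟨⟨s, u, hu⟩, rfl⟩
  exact hy ⟨(s, u), ⟨trivial, hu⟩, rfl⟩

/-- The tube map sends null sets to null sets, so changing the profile on a null set changes the
tube potential only on a null set. -/
theorem tubePotential_ae_eq {J : ℝ × E2 → ℝ}
    (h : IsTubeChart (fun p : ℝ × E2 => tubeMap Γ n b α p.1 p.2) J M)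
    (hinj : Function.Injective fun p : ℝ × M => tubeMap Γ n b α p.1 p.2) {V W : E2 → ℝ}
    (hVW : V =ᵐ[volume] W) :
    tubePotential Γ n b α M V =ᵐ[volume] tubePotential Γ n b α M W := by
  have h0 : volume {u | V u ≠ W u} = 0 := hVW
  have h1 : volume ((Set.univ : Set ℝ) ×ˢ {u | V u ≠ W u}) = 0 := by
    rw [Measure.volume_eq_prod, Measure.prod_prod, h0, mul_zero]
  refine measure_mono_null (fun y hy => ?_) (h.null_image _ h1)
  by_cases hm : y ∈ (fun p : ℝ × E2 => tubeMap Γ n b α p.1 p.2) '' (Set.univ ×ˢ M)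
  · obtain ⟨⟨s, u⟩, ⟨-, hu⟩, rfl⟩ := hm
    refine ⟨(s, u), ⟨trivial, fun he => hy ?_⟩, rfl⟩
    change tubePotential Γ n b α M V (tubeMap Γ n b α s u) =
      tubePotential Γ n b α M W (tubeMap Γ n b α s u)
    rw [tubePotential_tubeMap hinj V s hu, tubePotential_tubeMap hinj W s hu]
    exact he
  · exact absurd ((tubePotential_eq_zero V hm).trans (tubePotential_eq_zero W hm).symm) hy

/-- The exceptional set involves only the transverse variables, so the equality holds for every `p`
and the positivity hypothesis transfers by plain rewriting. -/
theorem integral_kernelC_congr {V W φ ψ : E2 → ℝ} (hVW : V =ᵐ[volume] W) (hφψ : φ =ᵐ[volume] ψ)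
    (κ : ℝ) (p : ℝ × ℝ) :
    ∫ q in M ×ˢ M, kernelC Γ n b γ α V φ κ p.1 q.1 p.2 q.2 =
      formDifference (fun p : ℝ × E2 => tubeMap Γ n b α p.1 p.2)
        (fun p : ℝ × E2 => jac γ α p.1 p.2) M W ψ κ p := by
  refine integral_congr_ae (ae_restrict_of_ae ?_)
  have h1 := Measure.quasiMeasurePreserving_fst (μ := (volume : Measure E2))
    (ν := (volume : Measure E2))
  have h2 := Measure.quasiMeasurePreserving_snd (μ := (volume : Measure E2))
    (ν := (volume : Measure E2))
  filter_upwards [h1.ae hVW, h1.ae hφψ, h2.ae hVW, h2.ae hφψ] with q a1 a2 a3 a4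
  simp only [kernelC, a1, a2, a3, a4]

end SoftWaveguide

end

theorem theorem5p1
    (Γ n b : ℝ → SoftWaveguide.E3) (γ τ α : ℝ → ℝ)
    (M : Set SoftWaveguide.E2) (V φ₀ : SoftWaveguide.E2 → ℝ)
    -- the curve
    (hΓ : ContDiff ℝ 2 Γ)
    (hfrenet : SoftWaveguide.IsFrenetTriad Γ n b γ τ)
    (hasymp : SoftWaveguide.IsAsymptoticallyStraight Γ γ τ)
    (hends : Tendsto (fun p : ℝ × ℝ => ‖Γ p.1 - Γ p.2‖)
      (comap (fun p : ℝ × ℝ => |p.1 - p.2|) atTop) atTop)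
    -- the tube
    (hMo : IsOpen M) (hMb : Bornology.IsBounded M) (hM0 : (0 : SoftWaveguide.E2) ∈ M)
    (hinj : Function.Injective
      (fun p : ℝ × M => SoftWaveguide.tubeMap Γ n b α p.1 p.2))
    (htang : SoftWaveguide.IsTangAngle n b γ τ α)
    -- the profile
    (hV : MemLp V ∞ volume) (hVpos : ∀ᵐ u, 0 ≤ V u) (hVne : ¬ V =ᵐ[volume] 0)
    (hVsupp : Function.support V ⊆ M)
    -- the transverse ground state
    (hφ : SoftWaveguide.IsGroundState V φ₀)
    -- the integral over `ℝ²` of the integral over `M × M` of the kernel is positive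
    (hpos : SoftWaveguide.HasPositiveIntegral (fun p : ℝ × ℝ =>
      ∫ q in M ×ˢ M, SoftWaveguide.kernelC Γ n b γ α V φ₀
        (Real.sqrt (-SoftWaveguide.specBottom V)) p.1 q.1 p.2 q.2)) :
    (SoftWaveguide.discSpec (SoftWaveguide.schrodinger
      (SoftWaveguide.tubePotential Γ n b α M V))).Nonempty := by
  have hframe := hfrenet.isBishopFrame hΓ hasymp htang
  have hinj' := SoftWaveguide.injOn_of_injective_subtype hinj
  have hchart : SoftWaveguide.IsTubeChart
      (fun p : ℝ × SoftWaveguide.E2 => SoftWaveguide.tubeMap Γ n b α p.1 p.2)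
      (fun p : ℝ × SoftWaveguide.E2 => SoftWaveguide.jac γ α p.1 p.2) M := by
    rw [SoftWaveguide.tubeMap_eq_frameMap] at hinj' ⊢
    rw [SoftWaveguide.jac_eq_frameJac]
    exact hframe.isTubeChart hends hMo hMb hinj'
  obtain ⟨hκ₀, V₁, φ₁, C, B, hVV, hφφ, st⟩ :=
    SoftWaveguide.exists_transverseState hMo hMb hV hVpos hVne hVsupp hφ
  have hUX : ∀ s, ∀ u ∈ M, SoftWaveguide.tubePotential Γ n b α M V₁
      (SoftWaveguide.tubeMap Γ n b α s u) = V₁ u := fun s u hu =>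
    SoftWaveguide.tubePotential_tubeMap hinj V₁ s hu
  have hU0 := fun y hy =>
    SoftWaveguide.tubePotential_eq_zero (Γ := Γ) (n := n) (b := b) (α := α) (M := M) V₁ (y := y) hy
  simp only [SoftWaveguide.integral_kernelC_congr hVV hφφ] at hpos
  obtain ⟨η, hηm, hη0, hη2, hlt⟩ := hchart.exists_trial st hκ₀ hUX hU0 hpos
  exact SoftWaveguide.discSpec_nonempty_of_schur (by simp) (hchart.bddPotential st.pot hUX hU0)
    (SoftWaveguide.tubePotential_ae_eq hchart hinj hVV) hκ₀ hηm hη0 hη2 hlt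
    fun κ hκ => hchart.exists_schur st hκ₀ hUX hU0 hκ
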